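/- **Setting.** Let $a<L$ and $\mu$ be real numbers, and let $\beta\in L^2(\mathbb R)$ be a fixed real-valued function vanishing outside $[-L,L]$. Inner products are conjugate linear in the first argument, $\langle f,g\rangle=\int_{\mathbb R}\overline{f}\,g\,dx$. A real potential $V\in L^2([-a,a])$ is extended by $0$ to $\mathbb R$, and $H_V=-\partial_x^2+V$ on $L^2(\mathbb R)$. * $\lambda_V<0$ is the lowest negative eigenvalue of $H_V$, $\psi_V$ a real eigenfunction, $H_V\psi_V=\lambda_V\psi_V$, $\|\psi_V\|_2=1$, and $k_V=\sqrt{\lambda_V+\mu}$. * For $k>0$, $R_V(k)$ is the outgoing resolvent on compactly supported $f\in L^2(\mathbb R)$: $R_V(k)f=\lim_{\kappa\to k,\ \Im\kappa>0}(H_V-\kappa^2)^{-1}f$ pointwise. * $e_{V\pm}(x,k)=e^{\pm ikx}-R_V(k)[Ve^{\pm ik\,\cdot}](x)$ are the distorted plane waves; write $e_{V\pm}=e_{V\pm}(\cdot,k_V)$ and $\phi_{V\pm}(x)=e^{\pm ik_Vx}-e_{V\pm}(x)$. * $\displaystyle \Gamma[V]=\frac1{16k_V}\sum_\pm\left|\langle\beta\psi_V,e_{V\pm}\rangle\right|^2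 .$ * If $\lambda_V$ is the only negative eigenvalue, $P_ch=h-\langle\psi_V,h\rangle\psi_V$, and $R_V(\sqrt{\lambda_V})P_ch$ is the solution $u\in L^2(\mathbb R)$, $u\perp\psi_V$, of $(H_V-\lambda_V)u=P_ch$. **Proposition.** Let $V\in L^2([-a,a])$ be real, such that $H_V$ has exactly one negative eigenvalue $\lambda_V$, and $\lambda_V+\mu>0$. Then $\phi_{V\pm}$ satisfies $$(H_V-k_V^2)\phi_{V\pm}=Ve^{\pm ik_Vx},\qquad \phi_{V\pm}'(L)=ik_V\phi_{V\pm}(L),\quad -\phi_{V\pm}'(-L)=ik_V\phi_{V\pm}(-L),$$ and the functional $U\mapsto\Gamma[U]$ is Fréchet differentiable at $V$ with respect to the norm of $L^2([-a,a])$. Moreover: 1. *(Chain rule.)* At $V$, the map $U\mapsto k_U$ is Fréchet differentiable, so is $U\mapsto\psi_U\in L^2(\mathbb R)$ (for a suitable choice of the signs of the normalized eigenfunctions $\psi_U$, $U$ near $V$), and so are $U\mapsto e_{U\pm}(\cdot,k_U)\in C([-L,L];\mathbb C)$. Consider $\frac1{16k}\sum_\pm|\langle\beta\psi,e_\pm\rangle|^2$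 as a function of $k$, $\psi$ and $e_\pm$; its partial Fréchet derivatives with respect to $\psi\in L^2(\mathbb R)$ and to each $e_\pm\in C([-L,L];\mathbb C)$, denoted $\frac{\delta\Gamma}{\delta\psi_V}$ and $\frac{\delta\Gamma}{\delta e_{V\pm}}$, exist at $(k_V,\psi_V,e_{V\pm})$. For all real $\delta V\in L^2([-a,a])$, $$\Big\langle\frac{\delta\Gamma}{\delta V},\delta V\Big\rangle=\frac{\delta\Gamma}{\delta\psi_V}\Big[\frac{\delta\psi_V}{\delta V}[\delta V]\Big]+\sum_\pm\frac{\delta\Gamma}{\delta e_{V\pm}}\Big[\frac{\delta e_{V\pm}(\cdot,k_V)}{\delta V}[\delta V]\Big]-\frac{\Gamma[V]}{k_V}\Big\langle\frac{\delta k_V}{\delta V},\delta V\Big\rangle .$$ 2. *(Explicit formula.)* The derivative is represented in $L^2([-a,a])$ by the function $$\begin{aligned}\frac{\delta\Gamma}{\delta V}={}&-\frac1{8k_V}\,\psi_V\,R_V(\sqrt{\lambda_V})P_c\Big[\Re\sum_\pm\langle e_{V\pm},\beta\psi_V\rangle\,\beta e_{V\pm}\Big]-\frac{\Gamma[V]}{2k_V^2}\,\psi_V^2\\&+\sum_\pm\frac1{8k_V}\,\Re\Big\{\langle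 e_{V\pm},\beta\psi_V\rangle\Big(\frac1{2k_V}\langle\beta\psi_V,A_\pm\rangle\,\psi_V^2-e_{V\pm}\,R_V(k_V)[\beta\psi_V]\Big)\Big\},\end{aligned}$$ where, for $x\in[-L,L]$, $$\begin{aligned}A_\pm(x)={}&\pm ix\,e^{\pm ik_Vx}-R_V(k_V)\big[2k_V\mathbf 1_{[-L,L]}\phi_{V\pm}\pm ixVe^{\pm ik_Vx}\big](x)\\&+\frac{e^{ik_VL}}{2k_V}\Big(\phi_{V\pm}(-L)\,e_{V+}(x)+\phi_{V\pm}(L)\,e_{V-}(x)\Big).\end{aligned}$$ -/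

import Mathlib

open MeasureTheory Set Filter Topology

noncomputable section

namespace FermiGoldenRule

/-- `u` is a solution of `(-∂ₓ² + V - z) u = f` on the line, for a locally integrable potential `V`
and a locally integrable source `f`: `u` is differentiable and `u'` is a primitive of
`(V - z) u - f`, so that `u` is `C¹`, `u'` is locally absolutely continuous and the equation holds
almost everywhere (equivalently, in the sense of distributions). -/
def IsSol {𝕜 : Type*} [RCLike 𝕜] (V : ℝ → ℝ) (z : 𝕜) (f u : ℝ → 𝕜) : Prop :=
  Differentiable ℝ u ∧
    ∀ x y : ℝ, deriv u y - deriv u x = ∫ t in x..y, (((V t : ℝ) : 𝕜) - z) * u t - f t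

/-- `ψ` is a real, `L²`-normalized bound state: `H_V ψ = E ψ`, `‖ψ‖₂ = 1`. -/
structure IsBoundState (V : ℝ → ℝ) (E : ℝ) (ψ : ℝ → ℝ) : Prop where
  memLp : MemLp ψ 2 volume
  normalized : ∫ x, ψ x ^ 2 = 1
  eigen : IsSol V E (fun _ => 0) ψ

/-- `E` is a negative eigenvalue of `H_V = -∂ₓ² + V` on `L²(ℝ)`. -/
def IsNegEigenvalue (V : ℝ → ℝ) (E : ℝ) : Prop :=
  E < 0 ∧ ∃ ψ : ℝ → ℝ, IsBoundState V E ψ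

/-- `λ_V`: the lowest negative eigenvalue of `H_V`; when `H_V` has exactly one negative eigenvalue,
it is that eigenvalue. -/
def groundEnergy (V : ℝ → ℝ) : ℝ := sInf {E : ℝ | IsNegEigenvalue V E}

open Classical in
/-- `ψ_V`: a real normalized eigenfunction of `H_V` for `λ_V` (unique up to a sign). -/
def groundState (V : ℝ → ℝ) : ℝ → ℝ :=
  if h : ∃ ψ : ℝ → ℝ, IsBoundState V (groundEnergy V) ψ then h.choose else 0

/-- The resonant frequency `k_V = √(λ_V + μ)`. -/
def resFreq (μ : ℝ) (V : ℝ → ℝ) : ℝ := Real.sqrt (groundEnergy V + μ)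

open Classical in
/-- The resolvent `(H_V - κ²)⁻¹ f` on `L²(ℝ)`, for `Im κ > 0` and `κ²` not an eigenvalue: the
solution `u ∈ L²(ℝ)` of `(H_V - κ²) u = f`. -/
def resolventL2 (V : ℝ → ℝ) (κ : ℂ) (f : ℝ → ℂ) : ℝ → ℂ :=
  if h : ∃ u : ℝ → ℂ, MemLp u 2 volume ∧ IsSol V (κ ^ 2) f u then h.choose else 0

/-- The outgoing resolvent `R_V(k) f` at a real frequency `k ≠ 0`, by limiting absorption: the limit
of `(H_V - κ²)⁻¹ f` as `κ → k` from the upper half plane. -/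
def outResolvent (V : ℝ → ℝ) (k : ℝ) (f : ℝ → ℂ) (x : ℝ) : ℂ :=
  limUnder (𝓝[{κ : ℂ | 0 < κ.im}] (k : ℂ)) (fun κ => resolventL2 V κ f x)

/-- `P_c h = h - ⟨ψ_V, h⟩ ψ_V`, the projection onto the continuous subspace of `H_V` when `ψ_V` is
its only bound state. -/
def projCont (V : ℝ → ℝ) (h : ℝ → ℝ) (x : ℝ) : ℝ :=
  h x - (∫ y, groundState V y * h y) * groundState V x

open Classical in
/-- `R_V(√λ_V) P_c h = (H_V - λ_V)⁻¹ P_c h`, the inverse being taken on the range of `P_c`: the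
solution `u ∈ L²(ℝ)` of `(H_V - λ_V) u = P_c h` that is orthogonal to `ψ_V`. -/
def resolventPc (V : ℝ → ℝ) (h : ℝ → ℝ) : ℝ → ℝ :=
  if hu : ∃ u : ℝ → ℝ, MemLp u 2 volume ∧ IsSol V (groundEnergy V) (projCont V h) u ∧
      ∫ x, groundState V x * u x = 0
  then hu.choose else 0

/-- The plane wave `e^{± i k x}`; the sign is `σ`. -/
def planeWave (σ : ℤˣ) (k : ℝ) (x : ℝ) : ℂ :=
  Complex.exp (((σ : ℤ) : ℂ) * Complex.I * k * x)

/-- The distorted plane wave `e_{V±}(x, k) = e^{± i k x} - R_V(k)[V e^{± i k ·}](x)`. -/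
def distorted (V : ℝ → ℝ) (σ : ℤˣ) (k : ℝ) (x : ℝ) : ℂ :=
  planeWave σ k x - outResolvent V k (fun y => (V y : ℂ) * planeWave σ k y) x

/-- `e_{V±}(x, k_V)`. -/
def resWave (μ : ℝ) (V : ℝ → ℝ) (σ : ℤˣ) (x : ℝ) : ℂ := distorted V σ (resFreq μ V) x

/-- `φ_{V±}(x) = e^{± i k_V x} - e_{V±}(x, k_V)`. -/
def resPhi (μ : ℝ) (V : ℝ → ℝ) (σ : ℤˣ) (x : ℝ) : ℂ :=
  planeWave σ (resFreq μ V) x - resWave μ V σ x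

/-- `(16 k)⁻¹ ∑_± |⟨β ψ, e_±⟩|²` as a function of `k`, `ψ` and `e_±`. -/
def goldenRule (β : ℝ → ℝ) (k : ℝ) (ψ : ℝ → ℝ) (e : ℤˣ → ℝ → ℂ) : ℝ :=
  1 / (16 * k) * ∑ σ : ℤˣ, ‖∫ x, ((β x * ψ x : ℝ) : ℂ) * e σ x‖ ^ 2

/-- `Γ[V] = (16 k_V)⁻¹ ∑_± |⟨β ψ_V, e_{V±}(·, k_V)⟩|²`. -/
def Gam (β : ℝ → ℝ) (μ : ℝ) (V : ℝ → ℝ) : ℝ :=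
  goldenRule β (resFreq μ V) (groundState V) (resWave μ V)

/-- `⟨e_{V±}, β ψ_V⟩`, with the inner product conjugate linear in its first argument. -/
def coupling (β : ℝ → ℝ) (μ : ℝ) (V : ℝ → ℝ) (σ : ℤˣ) : ℂ :=
  ∫ x, (starRingEnd ℂ) (resWave μ V σ x) * ((β x * groundState V x : ℝ) : ℂ)

/-- The auxiliary function `A_±` on the truncated domain `[-L, L]`. -/
def auxA (L μ : ℝ) (V : ℝ → ℝ) (σ : ℤˣ) (x : ℝ) : ℂ :=
  ((σ : ℤ) : ℂ) * Complex.I * x * planeWave σ (resFreq μ V) x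
    - outResolvent V (resFreq μ V)
        (fun y => (Icc (-L) L).indicator (fun y => 2 * (resFreq μ V : ℂ) * resPhi μ V σ y) y
          + ((σ : ℤ) : ℂ) * Complex.I * y * V y * planeWave σ (resFreq μ V) y) x
    + Complex.exp (Complex.I * resFreq μ V * L) / (2 * resFreq μ V) *
        (resPhi μ V σ (-L) * resWave μ V 1 x + resPhi μ V σ L * resWave μ V (-1) x)

/-- The explicit expression for `δΓ/δV` as a function of `x`. -/
def gradGam (β : ℝ → ℝ) (L μ : ℝ) (V : ℝ → ℝ) (x : ℝ) : ℝ :=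
  - (1 / (8 * resFreq μ V)) * groundState V x *
      resolventPc V
        (fun y => (∑ σ : ℤˣ, coupling β μ V σ * β y * resWave μ V σ y).re) x
    - Gam β μ V / (2 * resFreq μ V ^ 2) * groundState V x ^ 2
    + ∑ σ : ℤˣ, 1 / (8 * resFreq μ V) *
        (coupling β μ V σ *
          (1 / (2 * (resFreq μ V : ℂ)) *
              (∫ y, ((β y * groundState V y : ℝ) : ℂ) * auxA L μ V σ y) *
              ((groundState V x ^ 2 : ℝ) : ℂ)
            - resWave μ V σ x *
              outResolvent V (resFreq μ V)
                (fun y => ((β y * groundState V y : ℝ) : ℂ)) x)).re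

/-- The real Hilbert space `L²([-a, a])`. -/
abbrev L2Icc (a : ℝ) : Type := Lp ℝ 2 (volume.restrict (Icc (-a) a))

/-- The potential on the line given by an element of `L²([-a, a])`, extended by `0`. -/
def pot {a : ℝ} (V : L2Icc a) : ℝ → ℝ := (Icc (-a) a).indicator V

/-- The extension by `0` to the line of a continuous function on `[-L, L]`. -/
def extendZero {L : ℝ} (e : C(Icc (-L) L, ℂ)) : ℝ → ℂ := Function.extend Subtype.val e 0

end FermiGoldenRule

end

/-! Since the potentials live in `[-a, a]` with `a < L`, a solution of `u'' = (U + κ²) u` is a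
combination of `e^{±κx}` outside `[-L, L]`. Both spectral problems therefore become the same
boundary value problem on `[-L, L]`, namely `u'(-L) = κ u(-L)` and `u'(L) = -κ u(L)`: real `κ > 0`
describes bound states of energy `-κ²`, and `κ = -ik` describes outgoing waves of frequency `k`. The
initial value problem is solved by inverting `1 - T`, with `T` a Volterra operator that is affine in
`U` and polynomial in `κ`. Inversion is smooth and `1 - T` is always a unit, so solutions are smooth
in `(U, κ)`. The boundary problem is then governed by one smooth scalar function, `shoot`.

Bound states are the positive zeros of `shoot`. A Wronskian identity makes them simple
(`deriv_shoot_ne_zero`), and an energy estimate bounds them by a multiple of `‖U‖`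
(`le_of_shoot_eq_zero`), so no zero can come in from infinity. The implicit function theorem then
follows the largest zero (`exists_shoot_zero`) and yields a differentiable branch of normalized
ground states (`exists_branch`). At `κ = -ik` the Wronskian of a solution with its conjugate shows
that `shoot` does not vanish (`shoot_ne_zero_of_real`). This gives the limiting absorption principle
(`outResolvent_isOutgoing`) and an explicit differentiable formula `waveSol` for the distorted plane
waves.

The derivatives are computed without any differential equation for them: an exact Green identity for
the finite perturbation `V + tδ` is written down and differentiated at `t = 0`. Pairing `ψ_U` with
`ψ_V` gives the derivative of the energy; pairing it with `R_V(√λ_V) P_c b` gives that of the ground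
state (`IsBranch.deriv_pairing`). Pairing `e_U` with `R_V(k)[βψ_V]` gives that of the waves
(`integral_fderiv_waveSol`), where the part due to the motion of `k_U` is recognized because `A_±`
solves the boundary value problem obtained by differentiating that of `e_±` in `k` (`auxA_isRobin`).

Finally `Γ` is a product of `1/(16k)` and squares of real bilinear pairings, so the product rule
gives the chain rule, and inserting the three derivatives gives the explicit gradient. The chosen
eigenfunctions `groundState (pot U)` have arbitrary signs, but `Γ` is even in `ψ`, so a smooth
branch may replace them. -/

noncomputable section

/-! ### Integrated form of `u'' = q u - f` with integrable coefficients; Lagrange's identity. -/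

namespace FermiGoldenRule

/-- The primitive of a vector-valued integrable function is absolutely continuous. -/
theorem absolutelyContinuousOnInterval_primitive {F : Type*} [NormedAddCommGroup F]
    [NormedSpace ℝ F] {f : ℝ → F} {a b : ℝ} (h : IntervalIntegrable f volume a b) :
    AbsolutelyContinuousOnInterval (fun x ↦ ∫ t in a..x, f t) a b := by
  have hn := h.norm.absolutelyContinuousOnInterval_intervalIntegral (c := a) left_mem_uIcc
  rw [absolutelyContinuousOnInterval_iff] at hn ⊢
  intro ε hε
  obtain ⟨δ, hδ, H⟩ := hn ε hε
  refine ⟨δ, hδ, fun E hE hE' => lt_of_le_of_lt (Finset.sum_le_sum fun i hi => ?_) (H E hE hE')⟩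
  have hm := hE.1 i hi
  have h1 : IntervalIntegrable f volume a (E.2 i).1 :=
    h.mono_set (uIcc_subset_uIcc left_mem_uIcc hm.1)
  have h2 : IntervalIntegrable f volume a (E.2 i).2 :=
    h.mono_set (uIcc_subset_uIcc left_mem_uIcc hm.2)
  rw [dist_comm, dist_comm (∫ t in a..(E.2 i).1, ‖f t‖), dist_eq_norm, dist_eq_norm,
    intervalIntegral.integral_interval_sub_left h2 h1,
    intervalIntegral.integral_interval_sub_left h2.norm h1.norm]
  exact intervalIntegral.norm_integral_le_abs_integral_norm

/-- Product rule for two primitives of integrable functions. -/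
theorem mul_sub_mul_eq_integral {𝕜 : Type*} [RCLike 𝕜] {g h u v : ℝ → 𝕜} {a b : ℝ}
    (hg : IntervalIntegrable g volume a b) (hh : IntervalIntegrable h volume a b)
    (hu : ∀ x ∈ uIcc a b, u x - u a = ∫ t in a..x, g t)
    (hv : ∀ x ∈ uIcc a b, v x - v a = ∫ t in a..x, h t) :
    u b * v b - u a * v a = ∫ t in a..b, (g t * v t + u t * h t) := by
  set U : ℝ → 𝕜 := fun x => ∫ t in a..x, g t
  set W : ℝ → 𝕜 := fun x => ∫ t in a..x, h t
  have aU : AbsolutelyContinuousOnInterval U a b := absolutelyContinuousOnInterval_primitive hg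
  have aW : AbsolutelyContinuousOnInterval W a b := absolutelyContinuousOnInterval_primitive hh
  have aU' : AbsolutelyContinuousOnInterval (fun x => U x + u a) a b := by
    refine aU.fun_add (LipschitzOnWith.absolutelyContinuousOnInterval (K := 0) ?_)
    exact (LipschitzWith.const (u a)).lipschitzOnWith
  have aW' : AbsolutelyContinuousOnInterval (fun x => W x + v a) a b := by
    refine aW.fun_add (LipschitzOnWith.absolutelyContinuousOnInterval (K := 0) ?_)
    exact (LipschitzWith.const (v a)).lipschitzOnWith
  have hint : IntervalIntegrable (fun t => g t * (W t + v a) + (U t + u a) * h t) volume a b :=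
    (hg.mul_continuousOn aW'.continuousOn).add (hh.continuousOn_mul aU'.continuousOn)
  -- The product minus the primitive of its expected derivative is absolutely continuous with zero
  -- derivative almost everywhere, hence constant.
  have aP := (aU'.fun_smul aW').fun_sub (absolutelyContinuousOnInterval_primitive hint)
  have hd : ∀ᵐ x, x ∈ uIcc a b → HasDerivAt (fun x => (U x + u a) • (W x + v a) -
      ∫ t in a..x, (g t * (W t + v a) + (U t + u a) * h t)) 0 x := by
    filter_upwards [hg.ae_hasDerivAt_integral, hh.ae_hasDerivAt_integral,
      hint.ae_hasDerivAt_integral] with x h1 h2 h3 hx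
    have e1 : HasDerivAt (fun x => U x + u a) (g x) x := (h1 hx a left_mem_uIcc).add_const _
    have e2 : HasDerivAt (fun x => W x + v a) (h x) x := (h2 hx a left_mem_uIcc).add_const _
    have := (e1.mul e2).sub (h3 hx a left_mem_uIcc)
    rw [sub_self] at this
    exact this
  obtain ⟨C, hC⟩ := aP.const_of_ae_hasDerivAt_zero hd
  have hca := hC a left_mem_uIcc
  have hcb := hC b right_mem_uIcc
  have hUa : U a = 0 := by simp [U]
  have hWa : W a = 0 := by simp [W]
  simp only [hUa, hWa, zero_add, intervalIntegral.integral_same, sub_zero, smul_eq_mul] at hca hcb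
  have : ∫ t in a..b, (g t * v t + u t * h t)
      = ∫ t in a..b, (g t * (W t + v a) + (U t + u a) * h t) := by
    refine intervalIntegral.integral_congr fun t ht => ?_
    have h1 : u t = U t + u a := sub_eq_iff_eq_add.1 (hu t ht)
    have h2 : v t = W t + v a := sub_eq_iff_eq_add.1 (hv t ht)
    simp only [h1, h2]
  have h1 : u b = U b + u a := sub_eq_iff_eq_add.1 (hu b right_mem_uIcc)
  have h2 : v b = W b + v a := sub_eq_iff_eq_add.1 (hv b right_mem_uIcc)
  rw [this, h1, h2, sub_eq_iff_eq_add.1 hcb, hca]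
  ring

variable {𝕜 : Type*} [RCLike 𝕜]

theorem locallyIntegrable_intervalIntegrable {q : ℝ → 𝕜} (hq : LocallyIntegrable q volume)
    {x y : ℝ} : IntervalIntegrable q volume x y :=
  (hq.integrableOn_isCompact isCompact_uIcc).intervalIntegrable

theorem locallyIntegrable_ofReal {V : ℝ → ℝ} (hV : LocallyIntegrable V volume) :
    LocallyIntegrable (fun t => ((V t : ℝ) : 𝕜)) volume := fun x => by
  obtain ⟨s, hs, h⟩ := hV x
  exact ⟨s, hs, (RCLike.ofRealCLM (K := 𝕜)).integrable_comp h⟩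

/-- `u`, with derivative `v`, solves `u'' = q u - f` on `S`, in integrated form. -/
structure SolOn (S : Set ℝ) (q f u v : ℝ → 𝕜) : Prop where
  cont : ContinuousOn u S
  cont' : ContinuousOn v S
  int : ∀ x ∈ S, ∀ y ∈ S, u y - u x = ∫ t in x..y, v t
  int' : ∀ x ∈ S, ∀ y ∈ S, v y - v x = ∫ t in x..y, (q t * u t - f t)

namespace SolOn

variable {S T : Set ℝ} {q q₁ q₂ f f₁ f₂ u v u₁ v₁ u₂ v₂ : ℝ → 𝕜}

theorem mono (h : SolOn S q f u v) (hT : T ⊆ S) : SolOn T q f u v :=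
  ⟨h.cont.mono hT, h.cont'.mono hT, fun x hx y hy => h.int x (hT hx) y (hT hy),
    fun x hx y hy => h.int' x (hT hx) y (hT hy)⟩

theorem intervalIntegrable [OrdConnected S] (h : SolOn S q f u v)
    (hq : LocallyIntegrable q volume) (hf : LocallyIntegrable f volume) {x y : ℝ} (hx : x ∈ S)
    (hy : y ∈ S) : IntervalIntegrable (fun t => q t * u t - f t) volume x y := by
  have hs : uIcc x y ⊆ S := OrdConnected.uIcc_subset ‹_› hx hy
  exact ((locallyIntegrable_intervalIntegrable hq).mul_continuousOn (h.cont.mono hs)).sub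
    (locallyIntegrable_intervalIntegrable hf)

theorem congr_fun [OrdConnected S] (h : SolOn S q f u₁ v₁) (hu : EqOn u₂ u₁ S) (hv : EqOn v₂ v₁ S) :
    SolOn S q f u₂ v₂ := by
  refine ⟨h.cont.congr hu, h.cont'.congr hv, fun x hx y hy => ?_, fun x hx y hy => ?_⟩
  · have hs : uIcc x y ⊆ S := OrdConnected.uIcc_subset ‹_› hx hy
    rw [hu hx, hu hy, h.int x hx y hy]
    exact intervalIntegral.integral_congr fun t ht => (hv (hs ht)).symm
  · have hs : uIcc x y ⊆ S := OrdConnected.uIcc_subset ‹_› hx hy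
    rw [hv hx, hv hy, h.int' x hx y hy]
    exact intervalIntegral.integral_congr fun t ht => by simp only [hu (hs ht)]

/-- Only the combination `q u - f` enters the equation, and only up to null sets. Terms can thus be
moved between coefficient and source, and single points ignored. -/
theorem congr_coeff [OrdConnected S] (h : SolOn S q₁ f₁ u v)
    (hq : ∀ᵐ x, x ∈ S → q₂ x * u x - f₂ x = q₁ x * u x - f₁ x) :
    SolOn S q₂ f₂ u v := by
  refine ⟨h.cont, h.cont', h.int, fun x hx y hy => ?_⟩
  have hs : uIcc x y ⊆ S := OrdConnected.uIcc_subset ‹_› hx hy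
  rw [h.int' x hx y hy]
  refine intervalIntegral.integral_congr_ae ?_
  filter_upwards [hq] with t ht htm using (ht (hs (uIoc_subset_uIcc htm))).symm

/-- All increments are computed from the common point `m`, so no case distinction on the two pieces
is needed for a pair `x, y`. -/
theorem union {m : ℝ} (hS : SolOn S q f u v) (hT : SolOn T q f u v) [OrdConnected S]
    [OrdConnected T] (hSc : IsClosed S) (hTc : IsClosed T) (hmS : m ∈ S) (hmT : m ∈ T)
    (hq : LocallyIntegrable q volume) (hf : LocallyIntegrable f volume) :
    SolOn (S ∪ T) q f u v := by
  have A : ∀ x ∈ S ∪ T, u x - u m = ∫ t in m..x, v t := fun x hx =>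
    hx.elim (fun h => hS.int m hmS x h) (fun h => hT.int m hmT x h)
  have B : ∀ x ∈ S ∪ T, v x - v m = ∫ t in m..x, (q t * u t - f t) := fun x hx =>
    hx.elim (fun h => hS.int' m hmS x h) (fun h => hT.int' m hmT x h)
  have A' : ∀ x ∈ S ∪ T, IntervalIntegrable v volume m x := fun x hx =>
    hx.elim (fun h => (hS.cont'.mono (OrdConnected.uIcc_subset ‹_› hmS h)).intervalIntegrable)
      (fun h => (hT.cont'.mono (OrdConnected.uIcc_subset ‹_› hmT h)).intervalIntegrable)
  have B' : ∀ x ∈ S ∪ T, IntervalIntegrable (fun t => q t * u t - f t) volume m x := fun x hx =>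
    hx.elim (fun h => hS.intervalIntegrable hq hf hmS h)
      (fun h => hT.intervalIntegrable hq hf hmT h)
  refine ⟨hS.cont.union_of_isClosed hT.cont hSc hTc, hS.cont'.union_of_isClosed hT.cont' hSc hTc,
    fun x hx y hy => ?_, fun x hx y hy => ?_⟩
  · rw [← intervalIntegral.integral_interval_sub_left (A' y hy) (A' x hx), ← A x hx, ← A y hy]
    ring
  · rw [← intervalIntegral.integral_interval_sub_left (B' y hy) (B' x hx), ← B x hx, ← B y hy]
    ring

theorem hasDerivAt (h : SolOn univ q f u v) (x : ℝ) : HasDerivAt u (v x) x := by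
  have hc : Continuous v := continuousOn_univ.1 h.cont'
  have h1 : u = fun y => u x + ∫ t in x..y, v t := by
    ext y
    rw [← h.int x trivial y trivial]; ring
  rw [h1]
  exact (intervalIntegral.integral_hasDerivAt_right (hc.intervalIntegrable _ _)
    (hc.stronglyMeasurableAtFilter _ _) hc.continuousAt).const_add _

/-- `IsSol` only asks for differentiability; continuity of `u'` comes from its being a primitive,
and the fundamental theorem then recovers `u` from `u'`. -/
theorem of_isSol {V : ℝ → ℝ} {z : 𝕜} (hV : LocallyIntegrable V volume)
    (hf : LocallyIntegrable f volume) (h : IsSol V z f u) :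
    SolOn univ (fun t => ((V t : ℝ) : 𝕜) - z) f u (deriv u) := by
  have hc : Continuous u := h.1.continuous
  have hi : ∀ x y, IntervalIntegrable (fun t => (((V t : ℝ) : 𝕜) - z) * u t - f t) volume x y := by
    intro x y
    have : LocallyIntegrable (fun t => ((V t : ℝ) : 𝕜) - z) volume :=
      (locallyIntegrable_ofReal hV).sub (locallyIntegrable_const z)
    exact ((locallyIntegrable_intervalIntegrable this).mul_continuousOn hc.continuousOn).sub
      (locallyIntegrable_intervalIntegrable hf)
  have hdc : Continuous (deriv u) := by
    have : deriv u = fun y => deriv u 0 + ∫ t in (0:ℝ)..y, (((V t : ℝ) : 𝕜) - z) * u t - f t := by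
      ext y
      rw [← h.2 0 y]; ring
    rw [this]
    exact continuous_const.add (intervalIntegral.continuous_primitive hi 0)
  refine ⟨hc.continuousOn, hdc.continuousOn, fun x _ y _ => ?_, fun x _ y _ => h.2 x y⟩
  exact (intervalIntegral.integral_deriv_eq_sub (fun t _ => h.1 t)
    (hdc.intervalIntegrable _ _)).symm

theorem deriv_eq (h : SolOn univ q f u v) : deriv u = v := funext fun x => (h.hasDerivAt x).deriv

theorem isSol {V : ℝ → ℝ} {z : 𝕜} (h : SolOn univ (fun t => ((V t : ℝ) : 𝕜) - z) f u v) :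
    IsSol V z f u :=
  ⟨fun x => (h.hasDerivAt x).differentiableAt, fun x y => by
    rw [h.deriv_eq]; exact h.int' x trivial y trivial⟩

/-- Lagrange's identity on a compact interval. -/
theorem lagrange {c d : ℝ} (hcd : c ≤ d) (h₁ : SolOn (Icc c d) q₁ f₁ u₁ v₁)
    (h₂ : SolOn (Icc c d) q₂ f₂ u₂ v₂)
    (hq₁ : LocallyIntegrable q₁ volume) (hf₁ : LocallyIntegrable f₁ volume)
    (hq₂ : LocallyIntegrable q₂ volume) (hf₂ : LocallyIntegrable f₂ volume) :
    (u₁ d * v₂ d - v₁ d * u₂ d) - (u₁ c * v₂ c - v₁ c * u₂ c) =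
      ∫ t in c..d, ((q₂ t - q₁ t) * u₁ t * u₂ t - u₁ t * f₂ t + u₂ t * f₁ t) := by
  have hc : c ∈ Icc c d := left_mem_Icc.2 hcd
  have hd : d ∈ Icc c d := right_mem_Icc.2 hcd
  have hI : uIcc c d = Icc c d := uIcc_of_le hcd
  have k : ∀ {g : ℝ → 𝕜}, ContinuousOn g (Icc c d) → IntervalIntegrable g volume c d := fun hg =>
    (hI ▸ hg : ContinuousOn _ (uIcc c d)).intervalIntegrable
  have i₁ := h₁.intervalIntegrable hq₁ hf₁ hc hd
  have i₂ := h₂.intervalIntegrable hq₂ hf₂ hc hd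
  have e1 := mul_sub_mul_eq_integral (k h₁.cont') i₂
    (fun x hx => h₁.int c hc x (hI ▸ hx)) (fun x hx => h₂.int' c hc x (hI ▸ hx))
  have e2 := mul_sub_mul_eq_integral i₁ (k h₂.cont')
    (fun x hx => h₁.int' c hc x (hI ▸ hx)) (fun x hx => h₂.int c hc x (hI ▸ hx))
  have j1 : IntervalIntegrable (fun t => v₁ t * v₂ t + u₁ t * (q₂ t * u₂ t - f₂ t)) volume c d :=
    (k (h₁.cont'.mul h₂.cont')).add (i₂.continuousOn_mul (hI ▸ h₁.cont))
  have j2 : IntervalIntegrable (fun t => (q₁ t * u₁ t - f₁ t) * u₂ t + v₁ t * v₂ t) volume c d :=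
    (i₁.mul_continuousOn (hI ▸ h₂.cont)).add (k (h₁.cont'.mul h₂.cont'))
  have : (u₁ d * v₂ d - v₁ d * u₂ d) - (u₁ c * v₂ c - v₁ c * u₂ c) =
      (u₁ d * v₂ d - u₁ c * v₂ c) - (v₁ d * u₂ d - v₁ c * u₂ c) := by ring
  rw [this, e1, e2, ← intervalIntegral.integral_sub j1 j2]
  refine intervalIntegral.integral_congr fun t _ => ?_
  ring

theorem add (h₁ : SolOn S q f₁ u₁ v₁) (h₂ : SolOn S q f₂ u₂ v₂) [OrdConnected S]
    (hq : LocallyIntegrable q volume)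
    (hf₁ : LocallyIntegrable f₁ volume) (hf₂ : LocallyIntegrable f₂ volume) :
    SolOn S q (fun t => f₁ t + f₂ t) (fun t => u₁ t + u₂ t) (fun t => v₁ t + v₂ t) := by
  refine ⟨h₁.cont.add h₂.cont, h₁.cont'.add h₂.cont', fun x hx y hy => ?_, fun x hx y hy => ?_⟩
  · have hs : uIcc x y ⊆ S := OrdConnected.uIcc_subset ‹_› hx hy
    rw [intervalIntegral.integral_add ((h₁.cont'.mono hs).intervalIntegrable)
      ((h₂.cont'.mono hs).intervalIntegrable), ← h₁.int x hx y hy, ← h₂.int x hx y hy]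
    ring
  · rw [show v₁ y + v₂ y - (v₁ x + v₂ x) = (v₁ y - v₁ x) + (v₂ y - v₂ x) by ring,
      h₁.int' x hx y hy, h₂.int' x hx y hy, ← intervalIntegral.integral_add
      (h₁.intervalIntegrable hq hf₁ hx hy) (h₂.intervalIntegrable hq hf₂ hx hy)]
    refine intervalIntegral.integral_congr fun t _ => ?_
    ring

theorem const_mul (h : SolOn S q f u v) (c : 𝕜) :
    SolOn S q (fun t => c * f t) (fun t => c * u t) (fun t => c * v t) := by
  refine ⟨continuousOn_const.mul h.cont, continuousOn_const.mul h.cont', fun x hx y hy => ?_,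
    fun x hx y hy => ?_⟩
  · rw [← mul_sub, h.int x hx y hy, intervalIntegral.integral_const_mul]
  · rw [← mul_sub, h.int' x hx y hy, ← intervalIntegral.integral_const_mul]
    refine intervalIntegral.integral_congr fun t _ => ?_
    ring

theorem sub (h₁ : SolOn S q f₁ u₁ v₁) (h₂ : SolOn S q f₂ u₂ v₂) [OrdConnected S]
    (hq : LocallyIntegrable q volume)
    (hf₁ : LocallyIntegrable f₁ volume) (hf₂ : LocallyIntegrable f₂ volume) :
    SolOn S q (fun t => f₁ t - f₂ t) (fun t => u₁ t - u₂ t) (fun t => v₁ t - v₂ t) := by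
  have hf : LocallyIntegrable (fun t => -1 * f₂ t) volume := hf₂.smul (-1 : 𝕜)
  have := h₁.add (h₂.const_mul (-1)) hq hf₁ hf
  simpa [sub_eq_add_neg] using this

/-- Reflection `x ↦ -x`. -/
theorem reflect (h : SolOn S q f u v) :
    SolOn (-S) (fun t => q (-t)) (fun t => f (-t)) (fun t => u (-t)) (fun t => -v (-t)) := by
  have hm : MapsTo (fun t : ℝ => -t) (-S) S := fun t ht => ht
  refine ⟨h.cont.comp continuous_neg.continuousOn hm,
    (h.cont'.comp continuous_neg.continuousOn hm).neg, fun x hx y hy => ?_, fun x hx y hy => ?_⟩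
  · rw [h.int (-x) hx (-y) hy, intervalIntegral.integral_neg,
      intervalIntegral.integral_comp_neg (fun t => v t), intervalIntegral.integral_symm]
  · rw [intervalIntegral.integral_comp_neg (fun t => q t * u t - f t), ← h.int' (-y) hy (-x) hx]
    ring

end SolOn

end FermiGoldenRule
end

/-! ### The initial value problem through Volterra operators on `C([c, d])`. -/

noncomputable section

namespace FermiGoldenRule

variable {𝕜 : Type*} [RCLike 𝕜] {c d : ℝ}

theorem norm_IccExtend_le (hcd : c ≤ d) (w : C(Icc c d, 𝕜)) (t : ℝ) :
    ‖IccExtend hcd w t‖ ≤ ‖w‖ := w.norm_coe_le_norm _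

theorem continuous_extend (hcd : c ≤ d) (w : C(Icc c d, 𝕜)) :
    Continuous (IccExtend hcd w) := w.continuous.Icc_extend'

theorem locallyIntegrable_mul_extend (hcd : c ≤ d) {q : ℝ → 𝕜} (hq : LocallyIntegrable q volume)
    (w : C(Icc c d, 𝕜)) : LocallyIntegrable (fun t => q t * IccExtend hcd w t) volume := by
  rw [← locallyIntegrableOn_univ]
  exact (hq.locallyIntegrableOn univ).mul_continuousOn (continuous_extend hcd w).continuousOn
    isClosed_univ.isLocallyClosed

theorem continuous_primitive_of_locallyIntegrable {g : ℝ → 𝕜} (hg : LocallyIntegrable g volume)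
    (c : ℝ) : Continuous fun x => ∫ t in c..x, g t :=
  intervalIntegral.continuous_primitive (fun _ _ => locallyIntegrable_intervalIntegrable hg) c

theorem norm_integral_mul_extend_le (hcd : c ≤ d) {q : ℝ → 𝕜} (hq : LocallyIntegrable q volume)
    (w : C(Icc c d, 𝕜)) {x : ℝ} (hx : x ∈ Icc c d) :
    ‖∫ t in c..x, q t * IccExtend hcd w t‖ ≤ (∫ t in c..d, ‖q t‖) * ‖w‖ := by
  have hqi : ∀ {x y : ℝ}, IntervalIntegrable (fun t => ‖q t‖) volume x y :=
    (locallyIntegrable_intervalIntegrable hq).norm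
  calc ‖∫ t in c..x, q t * IccExtend hcd w t‖ ≤ ∫ t in c..x, ‖q t‖ * ‖w‖ := by
        refine intervalIntegral.norm_integral_le_of_norm_le hx.1 ?_ (hqi.mul_const _)
        filter_upwards with t _
        rw [norm_mul]
        gcongr
        exact norm_IccExtend_le hcd w t
    _ = (∫ t in c..x, ‖q t‖) * ‖w‖ := intervalIntegral.integral_mul_const _ _
    _ ≤ (∫ t in c..d, ‖q t‖) * ‖w‖ := by
        gcongr
        exact intervalIntegral.integral_mono_interval le_rfl hx.1 hx.2
          (by filter_upwards with t using norm_nonneg _) hqi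

/-- The operator `w ↦ ∫_c^x q w` on `C([c, d])`. -/
def primMul (hcd : c ≤ d) (q : ℝ → 𝕜) (hq : LocallyIntegrable q volume) :
    C(Icc c d, 𝕜) →L[ℝ] C(Icc c d, 𝕜) :=
  LinearMap.mkContinuous
    { toFun := fun w => ⟨fun x => ∫ t in c..(x : ℝ), q t * IccExtend hcd w t,
        (continuous_primitive_of_locallyIntegrable
          (locallyIntegrable_mul_extend hcd hq w) c).comp continuous_subtype_val⟩
      map_add' := fun w₁ w₂ => by
        ext x
        simp only [ContinuousMap.coe_mk, ContinuousMap.add_apply]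
        rw [← intervalIntegral.integral_add
          (locallyIntegrable_intervalIntegrable (locallyIntegrable_mul_extend hcd hq w₁))
          (locallyIntegrable_intervalIntegrable (locallyIntegrable_mul_extend hcd hq w₂))]
        refine intervalIntegral.integral_congr fun t _ => ?_
        simp [IccExtend, mul_add]
      map_smul' := fun r w => by
        ext x
        simp only [ContinuousMap.coe_mk, ContinuousMap.smul_apply, RingHom.id_apply]
        rw [← intervalIntegral.integral_smul]
        refine intervalIntegral.integral_congr fun t _ => ?_
        simp [IccExtend] }
    (∫ t in c..d, ‖q t‖) fun w => by
      rw [ContinuousMap.norm_le _ (mul_nonneg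
        (intervalIntegral.integral_nonneg hcd fun t _ => norm_nonneg _) (norm_nonneg _))]
      intro x
      exact norm_integral_mul_extend_le hcd hq w x.2

theorem primMul_apply (hcd : c ≤ d) {q : ℝ → 𝕜} (hq : LocallyIntegrable q volume)
    (w : C(Icc c d, 𝕜)) (x : Icc c d) :
    primMul hcd q hq w x = ∫ t in c..(x : ℝ), q t * IccExtend hcd w t := rfl

theorem norm_primMul_le (hcd : c ≤ d) {q : ℝ → 𝕜} (hq : LocallyIntegrable q volume) :
    ‖primMul hcd q hq‖ ≤ ∫ t in c..d, ‖q t‖ :=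
  LinearMap.mkContinuous_norm_le _
    (intervalIntegral.integral_nonneg hcd fun _ _ => norm_nonneg _) _

theorem locallyIntegrable_one : LocallyIntegrable (fun _ : ℝ => (1 : 𝕜)) volume :=
  locallyIntegrable_const 1

/-- The primitive vanishing at `c`, as an operator on `C([c, d])`. -/
def prim (𝕜 : Type*) [RCLike 𝕜] (hcd : c ≤ d) : C(Icc c d, 𝕜) →L[ℝ] C(Icc c d, 𝕜) :=
  primMul hcd (fun _ => 1) locallyIntegrable_one

theorem prim_apply (hcd : c ≤ d) (w : C(Icc c d, 𝕜)) (x : Icc c d) :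
    prim 𝕜 hcd w x = ∫ t in c..(x : ℝ), IccExtend hcd w t := by
  simp [prim, primMul_apply]

/-- The Volterra operator `w ↦ ∫_c^x ∫_c^s q w` of the equation `u'' = q u`. -/
def volterra (hcd : c ≤ d) (q : ℝ → 𝕜) (hq : LocallyIntegrable q volume) :
    C(Icc c d, 𝕜) →L[ℝ] C(Icc c d, 𝕜) := prim 𝕜 hcd * primMul hcd q hq

/-- The exponential weight. -/
def expWeight (𝕜 : Type*) [RCLike 𝕜] (c d r : ℝ) : C(Icc c d, 𝕜) :=
  ⟨fun x => ((Real.exp (r * x) : ℝ) : 𝕜), by fun_prop⟩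

theorem expWeight_mul (r : ℝ) : expWeight 𝕜 c d r * expWeight 𝕜 c d (-r) = 1 := by
  ext x
  simp only [expWeight, ContinuousMap.mul_apply, ContinuousMap.coe_mk, ContinuousMap.one_apply]
  rw [← RCLike.ofReal_mul, ← Real.exp_add]
  simp

theorem integral_exp_le {r : ℝ} (hr : 0 < r) (c x : ℝ) :
    ∫ s in c..x, Real.exp (r * s) ≤ Real.exp (r * x) / r := by
  have : ∀ s ∈ uIcc c x, HasDerivAt (fun s => Real.exp (r * s) / r) (Real.exp (r * s)) s := by
    intro s _
    have h1 : HasDerivAt (fun s : ℝ => r * s) r s := by simpa using (hasDerivAt_id s).const_mul r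
    have := h1.exp.div_const r
    rwa [mul_div_assoc, div_self hr.ne', mul_one] at this
  rw [intervalIntegral.integral_eq_sub_of_hasDerivAt this
    ((by fun_prop : Continuous fun s => Real.exp (r * s)).intervalIntegrable _ _)]
  have : 0 ≤ Real.exp (r * c) / r := by positivity
  linarith

/-- A Volterra operator is quasi-nilpotent; here: `1 - T` is invertible. -/
theorem isUnit_one_sub_volterra (hcd : c ≤ d) {q : ℝ → 𝕜} (hq : LocallyIntegrable q volume) :
    IsUnit (1 - volterra hcd q hq) := by
  set Q := ∫ t in c..d, ‖q t‖ with hQ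
  have hQ0 : 0 ≤ Q := intervalIntegral.integral_nonneg hcd fun t _ => norm_nonneg _
  -- Conjugation by `e^{rx}` reduces the norm of the Volterra operator to at most `Q / r`, because
  -- `∫ e^{rs}` gains a factor `1 / r`. The choice `r = Q + 1` makes this less than one, and keeps
  -- `r > 0` when `Q = 0`.
  set r := Q + 1 with hr
  have hr0 : 0 < r := by positivity
  set M := ContinuousLinearMap.mul ℝ C(Icc c d, 𝕜) (expWeight 𝕜 c d r)
  set M' := ContinuousLinearMap.mul ℝ C(Icc c d, 𝕜) (expWeight 𝕜 c d (-r))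
  have hMM' : M * M' = 1 := by
    ext1 w
    simp only [M, M', mul_apply_eq_comp, ContinuousLinearMap.mul_apply',
      one_apply_eq_self]
    rw [← mul_assoc, expWeight_mul, one_mul]
  have hM'M : M' * M = 1 := by
    ext1 w
    simp only [M, M', mul_apply_eq_comp, ContinuousLinearMap.mul_apply',
      one_apply_eq_self]
    rw [← mul_assoc, mul_comm (expWeight 𝕜 c d (-r)), expWeight_mul, one_mul]
  set T := volterra hcd q hq
  have hkey : ‖M' * T * M‖ ≤ Q / r := by
    refine ContinuousLinearMap.opNorm_le_bound _ (by positivity) fun w => ?_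
    rw [ContinuousMap.norm_le _ (by positivity)]
    intro x
    have h1 : (M' * T * M) w x = ((Real.exp (-r * x) : ℝ) : 𝕜) *
        ∫ s in c..(x : ℝ), IccExtend hcd (primMul hcd q hq (expWeight 𝕜 c d r * w)) s := by
      rw [← prim_apply]; rfl
    rw [h1, norm_mul, RCLike.norm_ofReal, abs_of_pos (Real.exp_pos _)]
    have h2 : ‖∫ s in c..(x : ℝ), IccExtend hcd (primMul hcd q hq (expWeight 𝕜 c d r * w)) s‖ ≤
        ∫ s in c..(x : ℝ), Q * ‖w‖ * Real.exp (r * s) := by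
      refine intervalIntegral.norm_integral_le_of_norm_le x.2.1 ?_
        ((by fun_prop : Continuous fun s => Q * ‖w‖ * Real.exp (r * s)).intervalIntegrable _ _)
      filter_upwards with s hs
      have hsm : s ∈ Icc c d := ⟨hs.1.le, hs.2.trans x.2.2⟩
      rw [IccExtend_of_mem _ _ hsm, primMul_apply]
      have hqi : ∀ {x y : ℝ}, IntervalIntegrable (fun t => ‖q t‖) volume x y :=
        (locallyIntegrable_intervalIntegrable hq).norm
      calc _ ≤ ∫ t in c..s, ‖q t‖ * (Real.exp (r * s) * ‖w‖) := by
            refine intervalIntegral.norm_integral_le_of_norm_le hs.1.le ?_ (hqi.mul_const _)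
            filter_upwards with t ht
            have htm : t ∈ Icc c d := ⟨ht.1.le, ht.2.trans hsm.2⟩
            rw [norm_mul, IccExtend_of_mem _ _ htm, ContinuousMap.mul_apply, norm_mul]
            gcongr
            · simp only [expWeight, ContinuousMap.coe_mk]
              rw [RCLike.norm_ofReal, abs_of_pos (Real.exp_pos _)]
              exact Real.exp_le_exp.2 (mul_le_mul_of_nonneg_left ht.2 hr0.le)
            · exact w.norm_coe_le_norm _
        _ = (∫ t in c..s, ‖q t‖) * (Real.exp (r * s) * ‖w‖) :=
            intervalIntegral.integral_mul_const _ _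
        _ ≤ Q * (Real.exp (r * s) * ‖w‖) := by
            gcongr
            exact intervalIntegral.integral_mono_interval le_rfl hsm.1 hsm.2
              (by filter_upwards with t using norm_nonneg _) hqi
        _ = _ := by ring
    rw [intervalIntegral.integral_const_mul] at h2
    have h3 := integral_exp_le hr0 c x
    calc _ ≤ Real.exp (-r * x) * (Q * ‖w‖ * (Real.exp (r * x) / r)) := by
          gcongr
          exact h2.trans (by gcongr)
      _ = (Real.exp (-r * x) * Real.exp (r * x)) * (Q / r * ‖w‖) := by ring
      _ = Q / r * ‖w‖ := by rw [← Real.exp_add]; simp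
  have hlt : ‖M' * T * M‖ < 1 := lt_of_le_of_lt hkey (by rw [div_lt_one hr0]; linarith)
  have hu := isUnit_one_sub_of_norm_lt_one (x := M' * T * M) hlt
  have : 1 - T = M * (1 - M' * T * M) * M' := by
    rw [mul_sub, sub_mul, mul_one, hMM']
    congr 1
    rw [show M * (M' * T * M) * M' = (M * M') * T * (M * M') by simp only [mul_assoc], hMM',
      one_mul, mul_one]
  rw [this]
  exact ((Units.isUnit ⟨M, M', hMM', hM'M⟩).mul hu).mul (Units.isUnit ⟨M', M, hM'M, hMM'⟩)

/-- The function `α + β (x - c)`. -/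
def affine (c d : ℝ) (α β : 𝕜) : C(Icc c d, 𝕜) :=
  ⟨fun x => α + β * (((x : ℝ) - c : ℝ) : 𝕜), by fun_prop⟩

/-- The solution of `u'' = q u - f` with `u c = α`, `u' c = β`. -/
def ivp (hcd : c ≤ d) (q : ℝ → 𝕜) (hq : LocallyIntegrable q volume)
    (b : C(Icc c d, 𝕜)) : C(Icc c d, 𝕜) := Ring.inverse (1 - volterra hcd q hq) b

theorem ivp_eq (hcd : c ≤ d) {q : ℝ → 𝕜} (hq : LocallyIntegrable q volume) (b : C(Icc c d, 𝕜)) :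
    ivp hcd q hq b = b + volterra hcd q hq (ivp hcd q hq b) := by
  have := congrArg (fun S => S b) (Ring.mul_inverse_cancel _ (isUnit_one_sub_volterra hcd hq))
  simp only [mul_apply_eq_comp, sub_apply,
    one_apply_eq_self] at this
  rw [← ivp, sub_eq_iff_eq_add] at this
  exact this

theorem eq_ivp (hcd : c ≤ d) {q : ℝ → 𝕜} (hq : LocallyIntegrable q volume) {w b : C(Icc c d, 𝕜)}
    (h : w = b + volterra hcd q hq w) : w = ivp hcd q hq b := by
  have h1 : (1 - volterra hcd q hq) w = b := by
    rw [sub_apply, one_apply_eq_self, sub_eq_iff_eq_add]; exact h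
  have := congrArg (fun S => S w) (Ring.inverse_mul_cancel _ (isUnit_one_sub_volterra hcd hq))
  simp only [mul_apply_eq_comp, one_apply_eq_self, h1] at this
  exact this.symm

/-- The double primitive `∫_c^x ∫_c^s f` of the source. -/
def source (hcd : c ≤ d) (f : ℝ → 𝕜) (hf : LocallyIntegrable f volume) : C(Icc c d, 𝕜) :=
  prim 𝕜 hcd (primMul hcd f hf 1)

/-- The derivative of the solution `w` with initial slope `β`. -/
def slopeOf (hcd : c ≤ d) (q f : ℝ → 𝕜) (β : 𝕜) (w : C(Icc c d, 𝕜)) (x : ℝ) : 𝕜 :=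
  β + ∫ t in c..x, (q t * IccExtend hcd w t - f t)

theorem slopeOf_continuous (hcd : c ≤ d) {q f : ℝ → 𝕜} (hq : LocallyIntegrable q volume)
    (hf : LocallyIntegrable f volume) (β : 𝕜) (w : C(Icc c d, 𝕜)) :
    Continuous (slopeOf hcd q f β w) :=
  continuous_const.add (continuous_primitive_of_locallyIntegrable
    ((locallyIntegrable_mul_extend hcd hq w).sub hf) c)

/-- The Volterra equation is the differential equation integrated twice from `c`; undoing the outer
integration exposes `slopeOf` as the derivative. -/
theorem fixed_point_iff (hcd : c ≤ d) {q f : ℝ → 𝕜} (hq : LocallyIntegrable q volume)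
    (hf : LocallyIntegrable f volume) {α β : 𝕜} {w : C(Icc c d, 𝕜)} :
    w = affine c d α β - source hcd f hf + volterra hcd q hq w ↔
      ∀ x : Icc c d, w x = α + ∫ t in c..(x : ℝ), slopeOf hcd q f β w t := by
  rw [ContinuousMap.ext_iff]
  refine forall_congr' fun x => ?_
  have e : (affine c d α β - source hcd f hf + volterra hcd q hq w) x =
      α + ∫ t in c..(x : ℝ), slopeOf hcd q f β w t := by
    have h1 : ∀ s ∈ uIcc c (x : ℝ), slopeOf hcd q f β w s =
        β - IccExtend hcd (primMul hcd f hf 1) s + IccExtend hcd (primMul hcd q hq w) s := by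
      intro s hs
      rw [uIcc_of_le x.2.1] at hs
      have hsm : s ∈ Icc c d := ⟨hs.1, hs.2.trans x.2.2⟩
      rw [IccExtend_of_mem _ _ hsm, IccExtend_of_mem _ _ hsm, primMul_apply, primMul_apply,
        slopeOf, intervalIntegral.integral_sub
          (locallyIntegrable_intervalIntegrable (locallyIntegrable_mul_extend hcd hq w))
          (locallyIntegrable_intervalIntegrable hf)]
      have : ∀ t, IccExtend hcd (1 : C(Icc c d, 𝕜)) t = 1 := fun t => rfl
      simp only [this, mul_one]
      ring
    have i1 : ∀ w : C(Icc c d, 𝕜), IntervalIntegrable (IccExtend hcd w) volume c x := fun w =>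
      (continuous_extend hcd w).intervalIntegrable _ _
    rw [intervalIntegral.integral_congr h1, intervalIntegral.integral_add
      ((intervalIntegrable_const).sub (i1 _)) (i1 _), intervalIntegral.integral_sub
      intervalIntegrable_const (i1 _), ← prim_apply, ← prim_apply]
    simp only [affine, source, volterra, ContinuousMap.add_apply, ContinuousMap.sub_apply,
      ContinuousMap.coe_mk, mul_apply_eq_comp, intervalIntegral.integral_const,
      RCLike.real_smul_eq_coe_mul]
    ring
  rw [e]

theorem ivp_solOn (hcd : c ≤ d) {q f : ℝ → 𝕜} (hq : LocallyIntegrable q volume)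
    (hf : LocallyIntegrable f volume) {α β : 𝕜} {w : C(Icc c d, 𝕜)}
    (hw : w = ivp hcd q hq (affine c d α β - source hcd f hf)) :
    SolOn (Icc c d) q f (IccExtend hcd w) (slopeOf hcd q f β w) ∧
      IccExtend hcd w c = α ∧ slopeOf hcd q f β w c = β := by
  have h0 : w = affine c d α β - source hcd f hf + volterra hcd q hq w := by
    conv_lhs => rw [hw, ivp_eq]
    rw [← hw]
  have h := (fixed_point_iff hcd hq hf).1 h0
  have hvc := slopeOf_continuous hcd hq hf β w
  refine ⟨⟨(continuous_extend hcd w).continuousOn, hvc.continuousOn, fun x hx y hy => ?_,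
    fun x hx y hy => ?_⟩, ?_, ?_⟩
  · rw [IccExtend_of_mem _ _ hx, IccExtend_of_mem _ _ hy, h, h, add_sub_add_left_eq_sub,
      intervalIntegral.integral_interval_sub_left (hvc.intervalIntegrable _ _)
        (hvc.intervalIntegrable _ _)]
  · rw [slopeOf, slopeOf, add_sub_add_left_eq_sub]
    have : LocallyIntegrable (fun t => q t * IccExtend hcd w t - f t) volume :=
      (locallyIntegrable_mul_extend hcd hq w).sub hf
    rw [intervalIntegral.integral_interval_sub_left
      (locallyIntegrable_intervalIntegrable this) (locallyIntegrable_intervalIntegrable this)]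
  · rw [IccExtend_of_mem _ _ (left_mem_Icc.2 hcd), h]
    simp
  · simp [slopeOf]

/-- The restriction to `[c, d]` of a function that is continuous there. -/
def restrictIcc (u : ℝ → 𝕜) (h : ContinuousOn u (Icc c d)) : C(Icc c d, 𝕜) :=
  ⟨fun x => u x, continuousOn_iff_continuous_domRestrict.1 h⟩

theorem restrictIcc_apply (u : ℝ → 𝕜) (h : ContinuousOn u (Icc c d)) (x : Icc c d) :
    restrictIcc u h x = u x := rfl

/-- Every solution on `[c, d]` is given by the solution operator of the initial value problem. -/
theorem SolOn.eq_ivp (hcd : c ≤ d) {q f u v : ℝ → 𝕜} (hq : LocallyIntegrable q volume)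
    (hf : LocallyIntegrable f volume) (h : SolOn (Icc c d) q f u v) :
    restrictIcc u h.cont =
      ivp hcd q hq (affine c d (u c) (v c) - source hcd f hf) := by
  have hc : c ∈ Icc c d := left_mem_Icc.2 hcd
  refine FermiGoldenRule.eq_ivp hcd hq ((fixed_point_iff hcd hq hf).2 fun x => ?_)
  have hs : ∀ {y : ℝ}, y ∈ Icc c d → uIcc c y ⊆ Icc c d := fun hy =>
    OrdConnected.uIcc_subset inferInstance hc hy
  have h1 : u x = u c + ∫ t in c..(x : ℝ), v t := by rw [← h.int c hc x x.2]; ring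
  rw [restrictIcc_apply, h1]
  congr 1
  refine intervalIntegral.integral_congr fun t ht => ?_
  have htm := hs x.2 ht
  have h2 : v t = v c + ∫ s in c..t, (q s * u s - f s) := by rw [← h.int' c hc t htm]; ring
  rw [h2, slopeOf]
  congr 1
  refine intervalIntegral.integral_congr fun s hs' => ?_
  simp only [IccExtend_of_mem _ _ (hs htm hs'), restrictIcc_apply]

/-- Uniqueness for the initial value problem. -/
theorem SolOn.unique (hcd : c ≤ d) {q f u₁ v₁ u₂ v₂ : ℝ → 𝕜} (hq : LocallyIntegrable q volume)
    (hf : LocallyIntegrable f volume) (h₁ : SolOn (Icc c d) q f u₁ v₁)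
    (h₂ : SolOn (Icc c d) q f u₂ v₂) (hu : u₁ c = u₂ c) (hv : v₁ c = v₂ c) :
    EqOn u₁ u₂ (Icc c d) ∧ EqOn v₁ v₂ (Icc c d) := by
  have hc : c ∈ Icc c d := left_mem_Icc.2 hcd
  have e : EqOn u₁ u₂ (Icc c d) := fun x hx => by
    have e1 := SolOn.eq_ivp hcd hq hf h₁
    have e2 := SolOn.eq_ivp hcd hq hf h₂
    rw [hu, hv] at e1
    exact congrArg (fun w : C(Icc c d, 𝕜) => w ⟨x, hx⟩) (e1.trans e2.symm)
  refine ⟨e, fun x hx => ?_⟩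
  have := (h₁.int' c hc x hx).trans ((intervalIntegral.integral_congr fun t ht => by
    simp only [e (OrdConnected.uIcc_subset inferInstance hc hx ht)]).trans
      (h₂.int' c hc x hx).symm)
  rw [hv] at this
  exact sub_left_inj.1 this

end FermiGoldenRule
end

/-! ### Free solutions on the tails: decay, square integrability and gluing. -/

noncomputable section

namespace FermiGoldenRule

theorem SolOn.of_hasDerivAt {𝕜 : Type*} [RCLike 𝕜] {q f u v : ℝ → 𝕜}
    (hu : ∀ x, HasDerivAt u (v x) x)
    (hv : ∀ x, HasDerivAt v (q x * u x - f x) x) (hq : Continuous q) (hf : Continuous f) :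
    SolOn univ q f u v := by
  have cu : Continuous u := continuous_iff_continuousAt.2 fun x => (hu x).continuousAt
  have cv : Continuous v := continuous_iff_continuousAt.2 fun x => (hv x).continuousAt
  refine ⟨cu.continuousOn, cv.continuousOn, fun x _ y _ => ?_, fun x _ y _ => ?_⟩
  · exact (intervalIntegral.integral_eq_sub_of_hasDerivAt (fun t _ => hu t)
      (cv.intervalIntegrable _ _)).symm
  · exact (intervalIntegral.integral_eq_sub_of_hasDerivAt (fun t _ => hv t)
      (((hq.mul cu).sub hf).intervalIntegrable _ _)).symm

theorem SolOn.ofReal {S : Set ℝ} {q f u v : ℝ → ℝ} (h : SolOn S q f u v) :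
    SolOn S (fun x => (q x : ℂ)) (fun x => (f x : ℂ)) (fun x => (u x : ℂ))
      (fun x => (v x : ℂ)) := by
  refine ⟨Complex.continuous_ofReal.comp_continuousOn h.cont,
    Complex.continuous_ofReal.comp_continuousOn h.cont', fun x hx y hy => ?_, fun x hx y hy => ?_⟩
  · rw [intervalIntegral.integral_ofReal, ← h.int x hx y hy]
    push_cast; rfl
  · rw [← Complex.ofReal_sub, h.int' x hx y hy, ← intervalIntegral.integral_ofReal]
    push_cast; rfl

theorem hasDerivAt_cexp_mul (κ : ℂ) (c x : ℝ) :
    HasDerivAt (fun x : ℝ => Complex.exp (κ * (x - c))) (κ * Complex.exp (κ * (x - c))) x := by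
  have h1 : HasDerivAt (fun x : ℝ => κ * ((x : ℂ) - c)) κ x := by
    simpa using ((Complex.ofRealCLM.hasDerivAt (x := x)).sub_const (c : ℂ)).const_mul κ
  have := h1.cexp
  rwa [mul_comm] at this

theorem solOn_cexp (κ A B : ℂ) (c : ℝ) :
    SolOn univ (fun _ => κ ^ 2) (fun _ => 0)
      (fun x : ℝ => A * Complex.exp (-κ * (x - c)) + B * Complex.exp (κ * (x - c)))
      (fun x : ℝ => -κ * A * Complex.exp (-κ * (x - c)) + κ * B * Complex.exp (κ * (x - c))) := by
  refine SolOn.of_hasDerivAt (fun x => ?_) (fun x => ?_) continuous_const continuous_const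
  · have := ((hasDerivAt_cexp_mul (-κ) c x).const_mul A).add
      ((hasDerivAt_cexp_mul κ c x).const_mul B)
    convert! this using 1
    ring
  · have := ((hasDerivAt_cexp_mul (-κ) c x).const_mul (-κ * A)).add
      ((hasDerivAt_cexp_mul κ c x).const_mul (κ * B))
    convert! this using 1
    ring

/-- The exponentials on the right-hand side have the same data at `c`, so uniqueness on `[c, x]`
applies. -/
theorem SolOn.tail_right {κ : ℂ} (hκ : κ ≠ 0) {c : ℝ} {u v : ℝ → ℂ}
    (h : SolOn (Ici c) (fun _ => κ ^ 2) (fun _ => 0) u v) {x : ℝ} (hx : c ≤ x) :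
    u x = (u c - v c / κ) / 2 * Complex.exp (-κ * (x - c)) +
        (u c + v c / κ) / 2 * Complex.exp (κ * (x - c)) ∧
      v x = -κ * ((u c - v c / κ) / 2) * Complex.exp (-κ * (x - c)) +
        κ * ((u c + v c / κ) / 2) * Complex.exp (κ * (x - c)) := by
  have := SolOn.unique hx (locallyIntegrable_const _) (locallyIntegrable_const _)
    (h.mono Icc_subset_Ici_self) ((solOn_cexp κ ((u c - v c / κ) / 2)
      ((u c + v c / κ) / 2) c).mono (subset_univ (Icc c x))) (by simp; ring) (by
      simp; field_simp; ring)
  exact ⟨this.1 (right_mem_Icc.2 hx), this.2 (right_mem_Icc.2 hx)⟩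

/-- The boundary condition says that the coefficient of `e^{κ(x-c)}` vanishes. As `κ` is complex and
only nonzero, this covers decaying tails and, for `κ = -ik`, outgoing ones. -/
theorem SolOn.tail_right_decay {κ : ℂ} (hκ : κ ≠ 0) {c : ℝ} {u v : ℝ → ℂ}
    (h : SolOn (Ici c) (fun _ => κ ^ 2) (fun _ => 0) u v) (hb : v c = -κ * u c)
    {x : ℝ} (hx : c ≤ x) :
    u x = u c * Complex.exp (-κ * (x - c)) ∧ v x = -κ * u x := by
  have h1 : v c / κ = -u c := by rw [hb]; field_simp
  obtain ⟨e1, e2⟩ := h.tail_right hκ hx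
  rw [h1] at e1 e2
  constructor
  · rw [e1]; ring
  · rw [e2, e1]; ring

theorem not_memLp_of_le {c : ℝ} {u : ℝ → ℂ} (h : ∀ x, c ≤ x → 1 ≤ ‖u x‖) : ¬ MemLp u 2 volume := by
  intro hu
  have hi : Integrable (fun x => ‖u x‖ ^ 2) volume := by
    simpa using hu.integrable_norm_pow (by norm_num)
  have h1 : Integrable (fun _ : ℝ => (1 : ℝ)) (volume.restrict (Ici c)) := by
    refine (hi.restrict (s := Ici c)).mono' aestronglyMeasurable_const ?_
    filter_upwards [ae_restrict_mem measurableSet_Ici] with x hx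
    have := h x hx
    rw [norm_one]
    nlinarith
  rw [integrable_const_iff] at h1
  simp [isFiniteMeasure_restrict] at h1

/-- Square integrability kills the growing exponential: otherwise it eventually beats the bounded
remainder and `‖u‖ ≥ 1` on a half-line. -/
theorem SolOn.memLp_right {κ : ℂ} (hκ : 0 < κ.re) {c : ℝ} {u v : ℝ → ℂ}
    (h : SolOn (Ici c) (fun _ => κ ^ 2) (fun _ => 0) u v) (hu : MemLp u 2 volume) :
    v c = -κ * u c := by
  have hκ0 : κ ≠ 0 := fun h0 => by simp [h0] at hκ
  set A := (u c - v c / κ) / 2 with hA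
  set B := (u c + v c / κ) / 2 with hB
  by_contra hne
  have hB0 : B ≠ 0 := by
    intro h0
    apply hne
    rw [hB] at h0
    have : u c + v c / κ = 0 := by simpa using h0
    field_simp at this
    linear_combination this
  have hBn : 0 < ‖B‖ := norm_pos_iff.2 hB0
  have ht : Tendsto (fun x : ℝ => ‖B‖ * Real.exp (κ.re * (x - c)) - ‖A‖) atTop atTop := by
    refine tendsto_atTop_add_const_right _ _ (Tendsto.const_mul_atTop hBn ?_)
    exact Real.tendsto_exp_atTop.comp ((tendsto_atTop_add_const_right _ (-c) tendsto_id).const_mul_atTop hκ)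
  obtain ⟨m, hm⟩ := eventually_atTop.1 ((ht.eventually_ge_atTop 1).and (eventually_ge_atTop c))
  refine not_memLp_of_le (c := m) (fun x hx => ?_) hu
  obtain ⟨h1, h2⟩ := hm x hx
  rw [(h.tail_right hκ0 h2).1]
  have e1 : ‖B * Complex.exp (κ * (x - c))‖ = ‖B‖ * Real.exp (κ.re * (x - c)) := by
    rw [norm_mul, Complex.norm_exp]
    congr 2
    simp
  have e2 : ‖A * Complex.exp (-κ * (x - c))‖ ≤ ‖A‖ := by
    rw [norm_mul, Complex.norm_exp]
    refine mul_le_of_le_one_right (norm_nonneg _) (Real.exp_le_one_iff.2 ?_)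
    have : (-κ * ((x : ℂ) - c)).re = -(κ.re * (x - c)) := by simp
    rw [this]
    have : 0 ≤ κ.re * (x - c) := mul_nonneg hκ.le (by linarith)
    linarith
  have := norm_sub_norm_le (B * Complex.exp (κ * (x - c))) (-(A * Complex.exp (-κ * (x - c))))
  rw [norm_neg, sub_neg_eq_add, add_comm (B * _)] at this
  linarith

theorem neg_Iic_eq (c : ℝ) : -(Iic c) = Ici (-c) := by ext; simp

theorem SolOn.tail_left_decay {κ : ℂ} (hκ : κ ≠ 0) {c : ℝ} {u v : ℝ → ℂ}
    (h : SolOn (Iic c) (fun _ => κ ^ 2) (fun _ => 0) u v) (hb : v c = κ * u c)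
    {x : ℝ} (hx : x ≤ c) :
    u x = u c * Complex.exp (κ * (x - c)) ∧ v x = κ * u x := by
  have hr := h.reflect
  rw [neg_Iic_eq] at hr
  obtain ⟨e1, e2⟩ := hr.tail_right_decay hκ (by simp [hb]) (neg_le_neg hx)
  simp only [neg_neg, Complex.ofReal_neg] at e1 e2
  refine ⟨?_, by linear_combination -e2⟩
  rw [e1]
  congr 2
  ring

theorem SolOn.memLp_left {κ : ℂ} (hκ : 0 < κ.re) {c : ℝ} {u v : ℝ → ℂ}
    (h : SolOn (Iic c) (fun _ => κ ^ 2) (fun _ => 0) u v) (hu : MemLp u 2 volume) :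
    v c = κ * u c := by
  have hr := h.reflect
  rw [neg_Iic_eq] at hr
  have := hr.memLp_right hκ (hu.comp_measurePreserving (Measure.measurePreserving_neg volume))
  simp only [neg_neg] at this
  linear_combination -this

/-- A continuous function with exponential decay is square integrable. -/
theorem memLp_two_of_exp_decay {𝕜 : Type*} [RCLike 𝕜] {u : ℝ → 𝕜} (hu : Continuous u) {δ : ℝ}
    (hδ : 0 < δ) (h₁ : (fun x => ‖u x‖) =O[atTop] fun x => Real.exp (-δ * x))
    (h₂ : (fun x => ‖u (-x)‖) =O[atTop] fun x => Real.exp (-δ * x)) : MemLp u 2 volume := by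
  have key : ∀ w : ℝ → 𝕜, Continuous w → (fun x => ‖w x‖) =O[atTop] (fun x => Real.exp (-δ * x)) →
      IntegrableOn (fun x => ‖w x‖ ^ 2) (Ioi 0) volume := by
    intro w hw h
    refine integrable_of_isBigO_exp_neg (b := 2 * δ) (by positivity)
      (hw.norm.pow 2).continuousOn ?_
    have := h.pow 2
    refine this.congr_right fun x => ?_
    rw [← Real.exp_nat_mul]
    congr 1
    push_cast
    ring
  have k1 := key u hu h₁
  have k2 := key (fun x => u (-x)) (hu.comp continuous_neg) h₂
  rw [memLp_two_iff_integrable_sq_norm hu.aestronglyMeasurable, ← integrableOn_univ,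
    ← Iic_union_Ioi (a := (0 : ℝ))]
  refine IntegrableOn.union ?_ k1
  have := k2.comp_neg
  simp only [neg_neg] at this
  rw [integrableOn_Iic_iff_integrableOn_Iio]
  simpa using this

/-- Gluing a solution on `[-L, L]` with solutions on both tails. -/
theorem SolOn.glue {𝕜 : Type*} [RCLike 𝕜] {L : ℝ} (hL : 0 < L) {q f u v ul vl ur vr : ℝ → 𝕜}
    (hq : LocallyIntegrable q volume) (hf : LocallyIntegrable f volume)
    (h : SolOn (Icc (-L) L) q f u v) (hl : SolOn (Iic (-L)) q f ul vl)
    (hr : SolOn (Ici L) q f ur vr) (hul : ul (-L) = u (-L)) (hvl : vl (-L) = v (-L))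
    (hur : ur L = u L) (hvr : vr L = v L) :
    ∃ U W : ℝ → 𝕜, SolOn univ q f U W ∧ EqOn U u (Icc (-L) L) ∧ EqOn W v (Icc (-L) L) ∧
      EqOn U ul (Iic (-L)) ∧ EqOn W vl (Iic (-L)) ∧ EqOn U ur (Ici L) ∧ EqOn W vr (Ici L) := by
  let P : (ℝ → 𝕜) → (ℝ → 𝕜) → (ℝ → 𝕜) → ℝ → 𝕜 := fun a b c x =>
    if x ≤ -L then a x else if x ≤ L then b x else c x
  have P1 : ∀ a b c : ℝ → 𝕜, EqOn (P a b c) a (Iic (-L)) := fun a b c x hx => if_pos hx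
  have P2 : ∀ a b c : ℝ → 𝕜, a (-L) = b (-L) → EqOn (P a b c) b (Icc (-L) L) := by
    intro a b c hab x hx
    simp only [P]
    split_ifs with h1 h2
    · rw [le_antisymm h1 hx.1, hab]
    · rfl
    · exact absurd hx.2 h2
  have P3 : ∀ a b c : ℝ → 𝕜, c L = b L → EqOn (P a b c) c (Ici L) := by
    intro a b c hbc x hx
    have hx : L ≤ x := hx
    simp only [P]
    rw [if_neg (by linarith)]
    split_ifs with h2
    · rw [le_antisymm h2 hx, hbc]
    · rfl
  refine ⟨P ul u ur, P vl v vr, ?_, P2 _ _ _ hul, P2 _ _ _ hvl, P1 _ _ _, P1 _ _ _,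
    P3 _ _ _ hur, P3 _ _ _ hvr⟩
  have s1 := hl.congr_fun (P1 ul u ur) (P1 vl v vr)
  have s2 := h.congr_fun (P2 ul u ur hul) (P2 vl v vr hvl)
  have s3 := hr.congr_fun (P3 ul u ur hur) (P3 vl v vr hvr)
  have hLL : -L ≤ L := by linarith
  have s12 := s1.union s2 isClosed_Iic isClosed_Icc (mem_Iic.2 le_rfl) (left_mem_Icc.2 hLL) hq hf
  rw [Iic_union_Icc_eq_Iic hLL] at s12
  have s := s12.union s3 isClosed_Iic isClosed_Ici (mem_Iic.2 le_rfl) (mem_Ici.2 le_rfl) hq hf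
  rwa [Iic_union_Ici] at s

end FermiGoldenRule
end

/-! ### Smooth dependence of solutions on the potential and on `κ`; the shooting function. -/

noncomputable section

namespace FermiGoldenRule

variable {a L : ℝ}

theorem integrable_pot (U : L2Icc a) : Integrable (pot U) volume := by
  rw [pot, integrable_indicator_iff measurableSet_Icc]
  exact (Lp.memLp U).integrable (by norm_num)

theorem pot_eq_zero {U : L2Icc a} {x : ℝ} (hx : x ∉ Icc (-a) a) : pot U x = 0 :=
  indicator_of_notMem hx _

theorem locallyIntegrable_pot (U : L2Icc a) : LocallyIntegrable (pot U) volume :=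
  (integrable_pot U).locallyIntegrable

theorem pot_add (U W : L2Icc a) : pot (U + W) =ᵐ[volume] fun x => pot U x + pot W x := by
  have h := (ae_restrict_iff' measurableSet_Icc).1 (Lp.coeFn_add U W)
  filter_upwards [h] with x hx
  by_cases hm : x ∈ Icc (-a) a
  · simp only [pot, indicator_of_mem hm, hx hm, Pi.add_apply]
  · simp [pot, indicator_of_notMem hm]

theorem pot_smul (r : ℝ) (U : L2Icc a) : pot (r • U) =ᵐ[volume] fun x => r * pot U x := by
  have h := (ae_restrict_iff' measurableSet_Icc).1 (Lp.coeFn_smul r U)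
  filter_upwards [h] with x hx
  by_cases hm : x ∈ Icc (-a) a
  · simp only [pot, indicator_of_mem hm, hx hm, Pi.smul_apply, smul_eq_mul]
  · simp [pot, indicator_of_notMem hm]

theorem pot_sub (U W : L2Icc a) : pot (U - W) =ᵐ[volume] fun x => pot U x - pot W x := by
  have h := (ae_restrict_iff' measurableSet_Icc).1 (Lp.coeFn_sub U W)
  filter_upwards [h] with x hx
  by_cases hm : x ∈ Icc (-a) a
  · simp only [pot, indicator_of_mem hm, hx hm, Pi.sub_apply]
  · simp [pot, indicator_of_notMem hm]

/-- The constant in `‖U‖₁ ≤ C ‖U‖₂` on `[-a, a]`. -/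
def embedConst (a : ℝ) : ℝ := ‖indicatorConstLp 2 (μ := volume.restrict (Icc (-a) a))
    MeasurableSet.univ (measure_ne_top _ _) (1 : ℝ)‖

/-- Cauchy–Schwarz against the constant function `1` on `[-a, a]`. The solution theory sees a
potential only through its `L¹` norm, and this makes it continuous in the `L²` norm. -/
theorem integral_abs_pot_le (U : L2Icc a) : ∫ x, ‖pot U x‖ ≤ embedConst a * ‖U‖ := by
  have h1 : ∫ x, ‖pot U x‖ = ∫ x in Icc (-a) a, ‖U x‖ := by
    rw [← integral_indicator measurableSet_Icc]
    congr 1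
    ext x
    by_cases hm : x ∈ Icc (-a) a
    · simp only [pot, indicator_of_mem hm]
    · simp [pot, indicator_of_notMem hm]
  have h2 := real_inner_le_norm (indicatorConstLp 2 (μ := volume.restrict (Icc (-a) a))
    MeasurableSet.univ (measure_ne_top _ _) (1 : ℝ)) (|U|)
  rw [norm_abs_eq_norm, L2.inner_indicatorConstLp_one, Measure.restrict_univ] at h2
  rw [h1]
  refine le_trans (le_of_eq ?_) h2
  refine integral_congr_ae ?_
  filter_upwards [Lp.coeFn_abs U] with x hx
  rw [hx, Real.norm_eq_abs]

variable {𝕜 : Type*} [RCLike 𝕜]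

/-- The coefficient `V + κ²` of the equation `u'' = (V + κ²) u`. -/
def coef (V : ℝ → ℝ) (κ : 𝕜) (t : ℝ) : 𝕜 := ((V t : ℝ) : 𝕜) + κ ^ 2

theorem locallyIntegrable_coef {V : ℝ → ℝ} (hV : LocallyIntegrable V volume) (κ : 𝕜) :
    LocallyIntegrable (coef V κ) volume :=
  (locallyIntegrable_ofReal hV).add (locallyIntegrable_const _)

theorem coef_eq (V : ℝ → ℝ) (κ : 𝕜) : coef V κ = fun t => ((V t : ℝ) : 𝕜) - (-κ ^ 2) := by
  ext t; simp [coef]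

/-- `U ↦ (w ↦ ∫ U w)`, as a continuous linear map. -/
def potMul (𝕜 : Type*) [RCLike 𝕜] {c d : ℝ} (a : ℝ) (hcd : c ≤ d) :
    L2Icc a →L[ℝ] (C(Icc c d, 𝕜) →L[ℝ] C(Icc c d, 𝕜)) :=
  LinearMap.mkContinuous
    { toFun := fun U => primMul hcd (fun t => ((pot U t : ℝ) : 𝕜))
        (locallyIntegrable_ofReal (locallyIntegrable_pot U))
      map_add' := fun U W => by
        ext w x
        simp only [add_apply, ContinuousMap.add_apply, primMul_apply]
        rw [← intervalIntegral.integral_add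
          (locallyIntegrable_intervalIntegrable (locallyIntegrable_mul_extend hcd
            (locallyIntegrable_ofReal (locallyIntegrable_pot U)) w))
          (locallyIntegrable_intervalIntegrable (locallyIntegrable_mul_extend hcd
            (locallyIntegrable_ofReal (locallyIntegrable_pot W)) w))]
        refine intervalIntegral.integral_congr_ae ?_
        filter_upwards [pot_add U W] with t ht _
        rw [ht]; push_cast; ring
      map_smul' := fun r U => by
        ext w x
        simp only [smul_apply, ContinuousMap.smul_apply, primMul_apply, RingHom.id_apply]
        rw [← intervalIntegral.integral_smul]
        refine intervalIntegral.integral_congr_ae ?_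
        filter_upwards [pot_smul r U] with t ht _
        rw [ht, RCLike.real_smul_eq_coe_mul]; push_cast; ring }
    (embedConst a) fun U => by
      refine (norm_primMul_le hcd (locallyIntegrable_ofReal (locallyIntegrable_pot U))).trans
        (le_trans ?_ (integral_abs_pot_le U))
      rw [intervalIntegral.integral_of_le hcd]
      simp only [RCLike.norm_ofReal, ← Real.norm_eq_abs]
      exact setIntegral_le_integral (integrable_pot U).norm
        (by filter_upwards with t using norm_nonneg _)

theorem potMul_apply {c d : ℝ} (hcd : c ≤ d) (U : L2Icc a) (w : C(Icc c d, 𝕜)) (x : Icc c d) :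
    potMul 𝕜 a hcd U w x = ∫ t in c..(x : ℝ), ((pot U t : ℝ) : 𝕜) * IccExtend hcd w t := rfl

/-- Splitting off `κ²` shows the operator as linear in `U` plus a monomial in `κ`, which is where
smoothness in both variables comes from. -/
theorem volterra_coef {c d : ℝ} (hcd : c ≤ d) (U : L2Icc a) (κ : 𝕜)
    (h : LocallyIntegrable (coef (pot U) κ) volume) :
    volterra hcd (coef (pot U) κ) h =
      prim 𝕜 hcd * potMul 𝕜 a hcd U + κ ^ 2 • (prim 𝕜 hcd * prim 𝕜 hcd) := by
  have : primMul hcd (coef (pot U) κ) h = potMul 𝕜 a hcd U + κ ^ 2 • prim 𝕜 hcd := by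
    ext w x
    simp only [add_apply, smul_apply, ContinuousMap.add_apply, ContinuousMap.smul_apply,
      primMul_apply, potMul_apply, prim_apply, smul_eq_mul, coef]
    rw [← intervalIntegral.integral_const_mul, ← intervalIntegral.integral_add
      (locallyIntegrable_intervalIntegrable (locallyIntegrable_mul_extend hcd
        (locallyIntegrable_ofReal (locallyIntegrable_pot U)) w))
      (((continuous_extend hcd w).const_mul _).intervalIntegrable _ _)]
    exact intervalIntegral.integral_congr fun t _ => add_mul _ _ _
  rw [volterra, this, mul_add]
  congr 1
  ext w x
  simp only [mul_apply_eq_comp, smul_apply, ContinuousMap.smul_apply, prim_apply, smul_eq_mul]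
  rw [← intervalIntegral.integral_const_mul]
  rfl

/-- The solution operator of the initial value problem, as a function of `(U, κ)`. -/
def ivpOp {c d : ℝ} (hcd : c ≤ d) (p : L2Icc a × 𝕜) : C(Icc c d, 𝕜) →L[ℝ] C(Icc c d, 𝕜) :=
  Ring.inverse (1 - (prim 𝕜 hcd * potMul 𝕜 a hcd p.1 + p.2 ^ 2 • (prim 𝕜 hcd * prim 𝕜 hcd)))

theorem ivpOp_apply {c d : ℝ} (hcd : c ≤ d) (U : L2Icc a) (κ : 𝕜) (b : C(Icc c d, 𝕜)) :
    ivpOp hcd (U, κ) b =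
      ivp hcd (coef (pot U) κ) (locallyIntegrable_coef (locallyIntegrable_pot U) κ) b := by
  rw [ivpOp, ivp, volterra_coef]

theorem contDiff_potMul {c d : ℝ} (hcd : c ≤ d) {n : WithTop ℕ∞} :
    ContDiff ℝ n (potMul 𝕜 a hcd) := by fun_prop

/-- Inversion in a Banach algebra is smooth at units, and `1 - T` is a unit for every `(U, κ)`; no
smallness is needed. -/
theorem contDiff_ivpOp {c d : ℝ} (hcd : c ≤ d) {n : WithTop ℕ∞} :
    ContDiff ℝ n (ivpOp hcd : L2Icc a × 𝕜 → _) := by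
  rw [contDiff_iff_contDiffAt]
  intro p
  have hu : IsUnit (1 - (prim 𝕜 hcd * potMul 𝕜 a hcd p.1 +
      p.2 ^ 2 • (prim 𝕜 hcd * prim 𝕜 hcd))) := by
    rw [← volterra_coef hcd p.1 p.2 (locallyIntegrable_coef (locallyIntegrable_pot _) _)]
    exact isUnit_one_sub_volterra hcd _
  obtain ⟨y, hy⟩ := hu
  have h1 := contDiffAt_ringInverse ℝ (R := C(Icc c d, 𝕜) →L[ℝ] C(Icc c d, 𝕜)) (n := n) y
  rw [hy] at h1
  refine ContDiffAt.comp (f := fun p : L2Icc a × 𝕜 => 1 - (prim 𝕜 hcd * potMul 𝕜 a hcd p.1 +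
      p.2 ^ 2 • (prim 𝕜 hcd * prim 𝕜 hcd))) p h1 ?_
  have h2 : ContDiff ℝ n fun p : L2Icc a × 𝕜 => potMul 𝕜 a hcd p.1 :=
    (contDiff_potMul hcd).comp contDiff_fst
  have h3 : ContDiff ℝ n fun p : L2Icc a × 𝕜 =>
      (ContinuousLinearMap.lsmul ℝ 𝕜 (E := C(Icc c d, 𝕜))) (p.2 ^ 2) :=
    ContDiff.comp (g := fun z : 𝕜 => (ContinuousLinearMap.lsmul ℝ 𝕜 (E := C(Icc c d, 𝕜))) z)
      (by fun_prop) (contDiff_snd.pow 2)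
  -- The operators are only real-linear, so the scalar `κ² ∈ 𝕜` is turned into a multiplication
  -- operator and the expression into a product in a real Banach algebra.
  have h4 : ∀ p : L2Icc a × 𝕜, p.2 ^ 2 • (prim 𝕜 hcd * prim 𝕜 hcd) =
      (ContinuousLinearMap.lsmul ℝ 𝕜 (E := C(Icc c d, 𝕜))) (p.2 ^ 2) *
        (prim 𝕜 hcd * prim 𝕜 hcd) := fun p => rfl
  simp_rw [h4]
  refine contDiffAt_const.sub (ContDiffAt.add ?_ ?_)
  · exact (ContDiff.mul (𝔸 := C(Icc c d, 𝕜) →L[ℝ] C(Icc c d, 𝕜)) contDiff_const h2).contDiffAt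
  · exact (ContDiff.mul (𝔸 := C(Icc c d, 𝕜) →L[ℝ] C(Icc c d, 𝕜)) h3 contDiff_const).contDiffAt

theorem affine_eq {c d : ℝ} (α β : 𝕜) :
    affine c d α β = α • (1 : C(Icc c d, 𝕜)) + β • affine c d 0 1 := by
  ext x
  simp [affine]

theorem contDiff_affine {E : Type*} [NormedAddCommGroup E] [NormedSpace ℝ E] {c d : ℝ}
    {n : WithTop ℕ∞} {α β : E → 𝕜} (hα : ContDiff ℝ n α) (hβ : ContDiff ℝ n β) :
    ContDiff ℝ n fun p => affine c d (α p) (β p) := by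
  simp_rw [fun p => affine_eq (c := c) (d := d) (α p) (β p)]
  exact (hα.smul contDiff_const).add (hβ.smul contDiff_const)

/-- The slope at `d` of the solution `w` with slope `β` at `c`. -/
def endSlope {c d : ℝ} (hcd : c ≤ d) (p : L2Icc a × 𝕜) (β : 𝕜) (w : C(Icc c d, 𝕜)) : 𝕜 :=
  β + potMul 𝕜 a hcd p.1 w ⟨d, right_mem_Icc.2 hcd⟩ +
    p.2 ^ 2 * prim 𝕜 hcd w ⟨d, right_mem_Icc.2 hcd⟩

/-- `endSlope` is phrased by bounded operators so that its smoothness is evident; here it is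
identified with the actual derivative at the right end. -/
theorem endSlope_eq {c d : ℝ} (hcd : c ≤ d) (U : L2Icc a) (κ β : 𝕜) (w : C(Icc c d, 𝕜)) :
    endSlope hcd (U, κ) β w = slopeOf hcd (coef (pot U) κ) (fun _ => 0) β w d := by
  rw [endSlope, potMul_apply, prim_apply, slopeOf, ← intervalIntegral.integral_const_mul,
    add_assoc, ← intervalIntegral.integral_add
      (locallyIntegrable_intervalIntegrable (locallyIntegrable_mul_extend hcd
        (locallyIntegrable_ofReal (locallyIntegrable_pot U)) w))
      (((continuous_extend hcd w).const_mul _).intervalIntegrable _ _)]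
  congr 1
  refine intervalIntegral.integral_congr fun t _ => ?_
  simp only [coef, sub_zero, add_mul]

theorem contDiff_eval {E : Type*} [NormedAddCommGroup E] [NormedSpace ℝ E] {c d : ℝ}
    {n : WithTop ℕ∞} {w : E → C(Icc c d, 𝕜)} (hw : ContDiff ℝ n w) (x : Icc c d) :
    ContDiff ℝ n fun p => w p x :=
  (ContinuousMap.evalCLM ℝ x : C(Icc c d, 𝕜) →L[ℝ] 𝕜).contDiff.comp hw

theorem contDiff_endSlope {c d : ℝ} (hcd : c ≤ d) {n : WithTop ℕ∞} {β : L2Icc a × 𝕜 → 𝕜}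
    {w : L2Icc a × 𝕜 → C(Icc c d, 𝕜)} (hβ : ContDiff ℝ n β) (hw : ContDiff ℝ n w) :
    ContDiff ℝ n fun p => endSlope hcd p (β p) (w p) := by
  refine (hβ.add (contDiff_eval ?_ _)).add ((contDiff_snd.pow 2).mul (contDiff_eval ?_ _))
  · exact ((potMul 𝕜 a hcd).contDiff.comp contDiff_fst).clm_apply hw
  · exact (prim 𝕜 hcd).contDiff.comp hw

/-- The solution of `u'' = (U + κ²) u` on `[-L, L]` with `u (-L) = 1`, `u' (-L) = κ`. -/
def leftSol (hL : -L ≤ L) (p : L2Icc a × 𝕜) : C(Icc (-L) L, 𝕜) :=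
  ivpOp hL p (affine (-L) L 1 p.2)

/-- The solution of `u'' = (U + κ²) u` on `[-L, L]` with `u (-L) = 0`, `u' (-L) = 1`. -/
def sineSol (hL : -L ≤ L) (p : L2Icc a × 𝕜) : C(Icc (-L) L, 𝕜) :=
  ivpOp hL p (affine (-L) L 0 1)

/-- The boundary form `u' (L) + κ u (L)` of the solution with initial slope `β`. -/
def bdry (hL : -L ≤ L) (p : L2Icc a × 𝕜) (β : 𝕜) (w : C(Icc (-L) L, 𝕜)) : 𝕜 :=
  endSlope hL p β w + p.2 * w ⟨L, right_mem_Icc.2 hL⟩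

/-- The shooting function; it vanishes exactly when there is an outgoing (decaying) solution. -/
def shoot (hL : -L ≤ L) (p : L2Icc a × 𝕜) : 𝕜 := bdry hL p p.2 (leftSol hL p)

variable {n : WithTop ℕ∞}

theorem contDiff_leftSol (hL : -L ≤ L) : ContDiff ℝ n (leftSol hL : L2Icc a × 𝕜 → _) :=
  (contDiff_ivpOp hL).clm_apply (contDiff_affine contDiff_const contDiff_snd)

theorem contDiff_sineSol (hL : -L ≤ L) : ContDiff ℝ n (sineSol hL : L2Icc a × 𝕜 → _) :=
  (contDiff_ivpOp hL).clm_apply contDiff_const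

theorem contDiff_bdry (hL : -L ≤ L) {β : L2Icc a × 𝕜 → 𝕜}
    {w : L2Icc a × 𝕜 → C(Icc (-L) L, 𝕜)} (hβ : ContDiff ℝ n β) (hw : ContDiff ℝ n w) :
    ContDiff ℝ n fun p => bdry hL p (β p) (w p) :=
  (contDiff_endSlope hL hβ hw).add (contDiff_snd.mul (contDiff_eval hw _))

theorem contDiff_shoot (hL : -L ≤ L) : ContDiff ℝ n (shoot hL : L2Icc a × 𝕜 → 𝕜) :=
  contDiff_bdry hL contDiff_snd (contDiff_leftSol hL)

theorem source_zero {c d : ℝ} (hcd : c ≤ d) (h : LocallyIntegrable (fun _ : ℝ => (0 : 𝕜)) volume) :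
    source hcd (fun _ => (0 : 𝕜)) h = 0 := by
  have : primMul hcd (fun _ => (0 : 𝕜)) h = 0 := by
    ext w x; simp [primMul_apply]
  rw [source, this]; simp

theorem solOn_ivpOp {c d : ℝ} (hcd : c ≤ d) (U : L2Icc a) (κ α β : 𝕜) :
    SolOn (Icc c d) (coef (pot U) κ) (fun _ => 0)
        (IccExtend hcd (ivpOp hcd (U, κ) (affine c d α β)))
        (slopeOf hcd (coef (pot U) κ) (fun _ => 0) β (ivpOp hcd (U, κ) (affine c d α β))) ∧
      IccExtend hcd (ivpOp hcd (U, κ) (affine c d α β)) c = α ∧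
      slopeOf hcd (coef (pot U) κ) (fun _ => 0) β (ivpOp hcd (U, κ) (affine c d α β)) c = β := by
  refine ivp_solOn hcd (locallyIntegrable_coef (locallyIntegrable_pot U) κ)
    (locallyIntegrable_const _) ?_
  rw [ivpOp_apply, source_zero, sub_zero]

/-- A homogeneous solution on `[-L, L]` is determined by its data at `-L`. -/
theorem SolOn.eq_ivpOp {c d : ℝ} (hcd : c ≤ d) {U : L2Icc a} {κ : 𝕜} {u v : ℝ → 𝕜}
    (h : SolOn (Icc c d) (coef (pot U) κ) (fun _ => 0) u v) :
    restrictIcc u h.cont = ivpOp hcd (U, κ) (affine c d (u c) (v c)) ∧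
      v d = endSlope hcd (U, κ) (v c) (ivpOp hcd (U, κ) (affine c d (u c) (v c))) := by
  constructor
  · rw [SolOn.eq_ivp hcd (locallyIntegrable_coef (locallyIntegrable_pot U) κ)
      (locallyIntegrable_const _) h, ivpOp_apply, source_zero, sub_zero]
  · obtain ⟨h1, h2, h3⟩ := solOn_ivpOp hcd U κ (u c) (v c)
    rw [endSlope_eq]
    exact (SolOn.unique hcd (locallyIntegrable_coef (locallyIntegrable_pot U) κ)
      (locallyIntegrable_const _) h h1 h2.symm h3.symm).2 (right_mem_Icc.2 hcd)

theorem endSlope_smul {c d : ℝ} (hcd : c ≤ d) (p : L2Icc a × 𝕜) (r β : 𝕜) (w : C(Icc c d, 𝕜)) :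
    endSlope hcd p (r * β) (r • w) = r * endSlope hcd p β w := by
  have h1 := endSlope_eq hcd p.1 p.2 (r * β) (r • w)
  have h2 := endSlope_eq hcd p.1 p.2 β w
  rw [Prod.mk.eta] at h1 h2
  rw [h1, h2, slopeOf, slopeOf, mul_add, ← intervalIntegral.integral_const_mul]
  congr 1
  refine intervalIntegral.integral_congr fun t _ => ?_
  simp only [IccExtend, Function.comp_apply, ContinuousMap.smul_apply, smul_eq_mul]
  ring

end FermiGoldenRule
end

/-! ### Bound states as zeros of the shooting function. -/

noncomputable section

namespace FermiGoldenRule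

variable {a L : ℝ}

section Generic

variable {𝕜 : Type*} [RCLike 𝕜]

theorem coef_pot_right (haL : a < L) (U : L2Icc a) (κ : 𝕜) {x : ℝ} (hx : L ≤ x) :
    coef (pot U) κ x = κ ^ 2 := by
  rw [coef, pot_eq_zero fun h => by have := h.2; linarith]; simp

theorem coef_pot_left (haL : a < L) (U : L2Icc a) (κ : 𝕜) {x : ℝ} (hx : x ≤ -L) :
    coef (pot U) κ x = κ ^ 2 := by
  rw [coef, pot_eq_zero fun h => by have := h.1; linarith]; simp

/-- The source is only assumed to vanish strictly beyond `L`; its value at the single point `L` does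
not matter. -/
theorem SolOn.free_right (haL : a < L) {U : L2Icc a} {κ : 𝕜} {f u v : ℝ → 𝕜}
    (h : SolOn univ (coef (pot U) κ) f u v) (hf : ∀ x, L < x → f x = 0) :
    SolOn (Ici L) (fun _ => κ ^ 2) (fun _ => 0) u v := by
  refine (h.mono (subset_univ _)).congr_coeff ?_
  have : ∀ᵐ x : ℝ, x ≠ L := by simp [ae_iff]
  filter_upwards [this] with x hx hxL
  rw [coef_pot_right haL U κ hxL, hf x (lt_of_le_of_ne hxL hx.symm)]

theorem SolOn.free_left (haL : a < L) {U : L2Icc a} {κ : 𝕜} {f u v : ℝ → 𝕜}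
    (h : SolOn univ (coef (pot U) κ) f u v) (hf : ∀ x, x < -L → f x = 0) :
    SolOn (Iic (-L)) (fun _ => κ ^ 2) (fun _ => 0) u v := by
  refine (h.mono (subset_univ _)).congr_coeff ?_
  have : ∀ᵐ x : ℝ, x ≠ -L := by simp [ae_iff]
  filter_upwards [this] with x hx hxL
  rw [coef_pot_left haL U κ hxL, hf x (lt_of_le_of_ne hxL hx)]

theorem SolOn.of_free_right (haL : a < L) {U : L2Icc a} {κ : 𝕜} {f g u v : ℝ → 𝕜}
    (h : SolOn (Ici L) (fun _ => κ ^ 2) g u v) (hf : ∀ x, L < x → f x = g x) :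
    SolOn (Ici L) (coef (pot U) κ) f u v := by
  refine h.congr_coeff ?_
  have : ∀ᵐ x : ℝ, x ≠ L := by simp [ae_iff]
  filter_upwards [this] with x hx hxL
  rw [coef_pot_right haL U κ hxL, hf x (lt_of_le_of_ne hxL hx.symm)]

theorem SolOn.of_free_left (haL : a < L) {U : L2Icc a} {κ : 𝕜} {f g u v : ℝ → 𝕜}
    (h : SolOn (Iic (-L)) (fun _ => κ ^ 2) g u v) (hf : ∀ x, x < -L → f x = g x) :
    SolOn (Iic (-L)) (coef (pot U) κ) f u v := by
  refine h.congr_coeff ?_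
  have : ∀ᵐ x : ℝ, x ≠ -L := by simp [ae_iff]
  filter_upwards [this] with x hx hxL
  rw [coef_pot_left haL U κ hxL, hf x (lt_of_le_of_ne hxL hx)]

/-- The spectral parameter is written `z = -κ²`, with `κ` the decay rate on the tails: `κ = √(-E)`
for bound states and `κ = -ik` for waves. -/
theorem isSol_iff_solOn {V : ℝ → ℝ} (hV : LocallyIntegrable V volume) {κ z : 𝕜} (hz : z = -κ ^ 2)
    {f u : ℝ → 𝕜} (hf : LocallyIntegrable f volume) :
    IsSol V z f u ↔ SolOn univ (coef V κ) f u (deriv u) := by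
  rw [coef_eq, ← hz]
  exact ⟨fun h => SolOn.of_isSol hV hf h, fun h => h.isSol⟩

theorem affine_zero_left (κ r : 𝕜) {c d : ℝ} : affine c d r (κ * r) = r • affine c d 1 κ := by
  ext x; simp [affine]; ring

/-- The solution operator is packaged as real-linear only; homogeneity over `𝕜` is recovered from
uniqueness of the fixed point. -/
theorem ivpOp_smul {c d : ℝ} (hcd : c ≤ d) (p : L2Icc a × 𝕜) (r : 𝕜) (b : C(Icc c d, 𝕜)) :
    ivpOp hcd p (r • b) = r • ivpOp hcd p b := by
  obtain ⟨U, κ⟩ := p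
  rw [ivpOp_apply, ivpOp_apply]
  refine (eq_ivp hcd _ ?_).symm
  set w := ivp hcd (coef (pot U) κ) (locallyIntegrable_coef (locallyIntegrable_pot U) κ) b with hw
  have h : w = _ := ivp_eq hcd (locallyIntegrable_coef (locallyIntegrable_pot U) κ) b
  rw [← hw] at h
  conv_lhs => rw [h]
  have hadd : ∀ w₁ w₂ : C(Icc c d, 𝕜), r • (w₁ + w₂) = r • w₁ + r • w₂ := fun w₁ w₂ => by
    ext x; simp [mul_add]
  rw [hadd]
  congr 1
  have hprim : ∀ (q : ℝ → 𝕜) (hq : LocallyIntegrable q volume) (w : C(Icc c d, 𝕜)),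
      primMul hcd q hq (r • w) = r • primMul hcd q hq w := by
    intro q hq w
    ext x
    simp only [ContinuousMap.smul_apply, primMul_apply, smul_eq_mul]
    rw [← intervalIntegral.integral_const_mul]
    refine intervalIntegral.integral_congr fun t _ => ?_
    simp only [IccExtend, Function.comp_apply, ContinuousMap.smul_apply, smul_eq_mul]
    ring
  simp only [volterra, mul_apply_eq_comp, hprim, prim]

/-- A homogeneous solution that decays on the left is a multiple of `leftSol`. -/
theorem SolOn.eq_leftSol (hL : -L ≤ L) {U : L2Icc a} {κ : 𝕜} {u v : ℝ → 𝕜}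
    (h : SolOn (Icc (-L) L) (coef (pot U) κ) (fun _ => 0) u v) (hb : v (-L) = κ * u (-L)) :
    restrictIcc u h.cont = u (-L) • leftSol hL (U, κ) ∧
      v L + κ * u L = u (-L) * shoot hL (U, κ) := by
  obtain ⟨h1, h2⟩ := h.eq_ivpOp hL
  have e : ivpOp hL (U, κ) (affine (-L) L (u (-L)) (v (-L))) = u (-L) • leftSol hL (U, κ) := by
    rw [hb, affine_zero_left, ivpOp_smul, leftSol]
  rw [e] at h1 h2
  refine ⟨h1, ?_⟩
  have h3 : u L = u (-L) * leftSol hL (U, κ) ⟨L, right_mem_Icc.2 hL⟩ :=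
    congrArg (fun w : C(Icc (-L) L, 𝕜) => w ⟨L, right_mem_Icc.2 hL⟩) h1
  rw [h2, hb, mul_comm κ, endSlope_smul, h3, shoot, bdry]
  ring

theorem leftSol_solOn (hL : -L ≤ L) (U : L2Icc a) (κ : 𝕜) :
    ∃ v : ℝ → 𝕜, SolOn (Icc (-L) L) (coef (pot U) κ) (fun _ => 0)
      (IccExtend hL (leftSol hL (U, κ))) v ∧ IccExtend hL (leftSol hL (U, κ)) (-L) = 1 ∧
      v (-L) = κ ∧ v L + κ * IccExtend hL (leftSol hL (U, κ)) L = shoot hL (U, κ) := by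
  obtain ⟨h1, h2, h3⟩ := solOn_ivpOp hL U κ 1 κ
  refine ⟨_, h1, h2, h3, ?_⟩
  have := (SolOn.eq_leftSol hL h1 (by rw [h2, h3, mul_one])).2
  rwa [h2, one_mul] at this

end Generic

theorem coef_ofReal (V : ℝ → ℝ) (κ : ℝ) : (fun x => ((coef V κ x : ℝ) : ℂ)) = coef V (κ : ℂ) := by
  ext x; simp [coef]

/-- `u`, with derivative `v`, is a solution of `u'' = (U + κ²) u` that decays at both ends. -/
structure IsDecaying (L : ℝ) (U : L2Icc a) (κ : ℝ) (u v : ℝ → ℝ) : Prop where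
  sol : SolOn univ (coef (pot U) κ) (fun _ => 0) u v
  right : v L = -κ * u L
  left : v (-L) = κ * u (-L)

namespace IsDecaying

variable {U : L2Icc a} {κ : ℝ} {u v : ℝ → ℝ}

theorem tail_right (h : IsDecaying L U κ u v) (haL : a < L) (hκ : 0 < κ) {x : ℝ} (hx : L ≤ x) :
    u x = u L * Real.exp (-κ * (x - L)) ∧ v x = -κ * u x := by
  have hc := h.sol.ofReal
  rw [coef_ofReal] at hc
  obtain ⟨e1, e2⟩ := (SolOn.free_right haL hc (by simp)).tail_right_decay
    (Complex.ofReal_ne_zero.2 hκ.ne') (by rw [h.right]; push_cast; ring) hx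
  exact ⟨by exact_mod_cast e1, by exact_mod_cast e2⟩

theorem tail_left (h : IsDecaying L U κ u v) (haL : a < L) (hκ : 0 < κ) {x : ℝ} (hx : x ≤ -L) :
    u x = u (-L) * Real.exp (κ * (x + L)) ∧ v x = κ * u x := by
  have hc := h.sol.ofReal
  rw [coef_ofReal] at hc
  obtain ⟨e1, e2⟩ := (SolOn.free_left haL hc (by simp)).tail_left_decay
    (Complex.ofReal_ne_zero.2 hκ.ne') (by rw [h.left]; push_cast; ring) hx
  refine ⟨?_, by exact_mod_cast e2⟩
  rw [Complex.ofReal_neg, sub_neg_eq_add] at e1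
  exact_mod_cast e1

theorem isBigO_right (h : IsDecaying L U κ u v) (haL : a < L) (hκ : 0 < κ) :
    (fun x => ‖u x‖) =O[atTop] fun x => Real.exp (-κ * x) := by
  refine Asymptotics.IsBigO.of_bound (|u L| * Real.exp (κ * L)) ?_
  filter_upwards [eventually_ge_atTop L] with x hx
  rw [(h.tail_right haL hκ hx).1, norm_norm, norm_mul, Real.norm_eq_abs, Real.norm_eq_abs,
    Real.norm_eq_abs, Real.abs_exp, Real.abs_exp, mul_assoc, ← Real.exp_add]
  apply le_of_eq; congr 2; ring

theorem isBigO_left (h : IsDecaying L U κ u v) (haL : a < L) (hκ : 0 < κ) :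
    (fun x => ‖u (-x)‖) =O[atTop] fun x => Real.exp (-κ * x) := by
  refine Asymptotics.IsBigO.of_bound (|u (-L)| * Real.exp (κ * L)) ?_
  filter_upwards [eventually_ge_atTop L] with x hx
  rw [(h.tail_left haL hκ (neg_le_neg hx)).1, norm_norm, norm_mul, Real.norm_eq_abs,
    Real.norm_eq_abs, Real.norm_eq_abs, Real.abs_exp, Real.abs_exp, mul_assoc, ← Real.exp_add]
  apply le_of_eq; congr 2; ring

theorem memLp (h : IsDecaying L U κ u v) (haL : a < L) (hκ : 0 < κ) : MemLp u 2 volume :=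
  memLp_two_of_exp_decay (continuousOn_univ.1 h.sol.cont) hκ (h.isBigO_right haL hκ)
    (h.isBigO_left haL hκ)

theorem const_mul (h : IsDecaying L U κ u v) (r : ℝ) :
    IsDecaying L U κ (fun x => r * u x) (fun x => r * v x) :=
  ⟨by simpa using h.sol.const_mul r, by rw [h.right]; ring, by rw [h.left]; ring⟩

/-- The condition at `-L` fixes the Cauchy data up to the factor `u (-L)`; the condition at `L` then
says that this factor times the shooting function vanishes. -/
theorem eq_leftSol (h : IsDecaying L U κ u v) (hL : -L ≤ L) :
    (∀ x : Icc (-L) L, u x = u (-L) * leftSol hL (U, κ) x) ∧ u (-L) * shoot hL (U, κ) = 0 := by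
  obtain ⟨h1, h2⟩ := SolOn.eq_leftSol hL (h.sol.mono (subset_univ _)) h.left
  refine ⟨fun x => congrArg (fun w : C(Icc (-L) L, ℝ) => w x) h1, ?_⟩
  rw [← h2, h.right]; ring

theorem eq_zero_of_left (h : IsDecaying L U κ u v) (haL : a < L) (hL : -L ≤ L) (hκ : 0 < κ)
    (h0 : u (-L) = 0) : u = 0 := by
  have hI := (h.eq_leftSol hL).1
  ext x
  rcases le_total x (-L) with hx | hx
  · rw [(h.tail_left haL hκ hx).1, h0]; simp
  · rcases le_total x L with hx' | hx'
    · rw [hI ⟨x, hx, hx'⟩, h0]; simp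
    · rw [(h.tail_right haL hκ hx').1, hI ⟨L, right_mem_Icc.2 hL⟩, h0]; simp

/-- This is the simplicity of eigenvalues in one dimension; it makes the normalized eigenfunction
unique up to sign. -/
theorem proportional (h : IsDecaying L U κ u v) (haL : a < L) (hL : -L ≤ L) (hκ : 0 < κ)
    {u' v' : ℝ → ℝ} (h' : IsDecaying L U κ u' v') (h0 : u (-L) ≠ 0) :
    ∃ r : ℝ, u' = fun x => r * u x := by
  refine ⟨u' (-L) / u (-L), ?_⟩
  have hI := (h.eq_leftSol hL).1
  have hI' := (h'.eq_leftSol hL).1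
  have hm : ∀ x : Icc (-L) L, u' x = u' (-L) / u (-L) * u x := fun x => by
    rw [hI x, hI' x]; field_simp
  ext x
  rcases le_total x (-L) with hx | hx
  · rw [(h.tail_left haL hκ hx).1, (h'.tail_left haL hκ hx).1]; field_simp
  · rcases le_total x L with hx' | hx'
    · exact hm ⟨x, hx, hx'⟩
    · rw [(h.tail_right haL hκ hx').1, (h'.tail_right haL hκ hx').1,
        hm ⟨L, right_mem_Icc.2 hL⟩]; ring

end IsDecaying

theorem solOn_rexp (κ A c : ℝ) : SolOn univ (fun _ => κ ^ 2) (fun _ => 0)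
    (fun x : ℝ => A * Real.exp (κ * (x - c))) (fun x : ℝ => κ * (A * Real.exp (κ * (x - c)))) := by
  have k : ∀ x, HasDerivAt (fun x : ℝ => A * Real.exp (κ * (x - c)))
      (κ * (A * Real.exp (κ * (x - c)))) x := fun x => by
    have h1 : HasDerivAt (fun x : ℝ => κ * (x - c)) κ x := by
      simpa using ((hasDerivAt_id x).sub_const c).const_mul κ
    convert! h1.exp.const_mul A using 1
    ring
  refine SolOn.of_hasDerivAt k (fun x => ?_) continuous_const continuous_const
  convert! (k x).const_mul κ using 1
  ring

/-- At a zero of the shooting function, `leftSol` extends to a decaying solution on the line. -/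
theorem exists_isDecaying (haL : a < L) (hL0 : 0 < L) (hL : -L ≤ L) {U : L2Icc a} {κ : ℝ}
    (hs : shoot hL (U, κ) = 0) :
    ∃ u v : ℝ → ℝ, IsDecaying L U κ u v ∧ (∀ x : Icc (-L) L, u x = leftSol hL (U, κ) x) := by
  obtain ⟨v, h1, h2, h3, h4⟩ := leftSol_solOn hL U κ
  set w := IccExtend hL (leftSol hL (U, κ))
  have sl := SolOn.of_free_left (f := fun _ => 0) haL (U := U)
    ((solOn_rexp κ 1 (-L)).mono (subset_univ (Iic (-L)))) (fun _ _ => rfl)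
  have sr := solOn_rexp (-κ) (w L) L
  rw [neg_sq] at sr
  have sr := SolOn.of_free_right (f := fun _ => 0) haL (U := U)
    (sr.mono (subset_univ (Ici L))) (fun _ _ => rfl)
  obtain ⟨u', v', g1, g2, g3, g4, g5, g6, g7⟩ := SolOn.glue hL0
    (locallyIntegrable_coef (locallyIntegrable_pot U) κ) (locallyIntegrable_const _) h1 sl sr
    (by simp [h2]) (by simp [h3]) (by simp) (by simp; linarith)
  have mL : L ∈ Icc (-L) L := right_mem_Icc.2 hL
  have mL' : -L ∈ Icc (-L) L := left_mem_Icc.2 hL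
  refine ⟨u', v', ⟨g1, ?_, ?_⟩, fun x => ?_⟩
  · rw [g2 mL, g3 mL]; linarith
  · rw [g2 mL', g3 mL', h2, h3, mul_one]
  · rw [g2 x.2]; exact IccExtend_of_mem _ _ x.2

theorem leftSol_left {𝕜 : Type*} [RCLike 𝕜] (hL : -L ≤ L) (p : L2Icc a × 𝕜) :
    leftSol hL p ⟨-L, left_mem_Icc.2 hL⟩ = 1 := by
  obtain ⟨v, -, h2, -, -⟩ := leftSol_solOn hL p.1 p.2
  rwa [IccExtend_of_mem _ _ (left_mem_Icc.2 hL)] at h2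

theorem IsBoundState.isDecaying (haL : a < L) {U : L2Icc a} {E : ℝ} (hE : E < 0) {ψ : ℝ → ℝ}
    (h : IsBoundState (pot U) E ψ) : IsDecaying L U (Real.sqrt (-E)) ψ (deriv ψ) := by
  have hκ : 0 < Real.sqrt (-E) := Real.sqrt_pos.2 (by linarith)
  have hs := (isSol_iff_solOn (locallyIntegrable_pot U) (κ := Real.sqrt (-E)) (z := E)
    (by rw [Real.sq_sqrt (by linarith)]; ring) (locallyIntegrable_const _)).1 h.eigen
  have hc := hs.ofReal
  rw [coef_ofReal] at hc
  have hm : MemLp (fun x => (ψ x : ℂ)) 2 volume := h.memLp.ofReal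
  have e1 := (SolOn.free_right haL hc (by simp)).memLp_right (by simpa using hκ) hm
  have e2 := (SolOn.free_left haL hc (by simp)).memLp_left (by simpa using hκ) hm
  exact ⟨hs, by exact_mod_cast e1, by exact_mod_cast e2⟩

theorem IsDecaying.isBoundState (haL : a < L) {U : L2Icc a} {κ : ℝ} (hκ : 0 < κ) {u v : ℝ → ℝ}
    (h : IsDecaying L U κ u v) (hn : ∫ x, u x ^ 2 = 1) : IsBoundState (pot U) (-κ ^ 2) u := by
  refine ⟨h.memLp haL hκ, hn, ?_⟩
  rw [isSol_iff_solOn (locallyIntegrable_pot U) (κ := κ) rfl (locallyIntegrable_const _),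
    h.sol.deriv_eq]
  exact h.sol

theorem IsDecaying.integral_sq_pos (haL : a < L) {U : L2Icc a} {κ : ℝ} (hκ : 0 < κ) {u v : ℝ → ℝ}
    (h : IsDecaying L U κ u v) (h0 : u (-L) ≠ 0) : 0 < ∫ x, u x ^ 2 := by
  have hc : Continuous u := continuousOn_univ.1 h.sol.cont
  rw [integral_pos_iff_support_of_nonneg (fun x => sq_nonneg _) (h.memLp haL hκ).integrable_sq]
  exact (hc.pow 2).isOpen_support.measure_pos volume ⟨-L, pow_ne_zero 2 h0⟩

/-- The negative eigenvalues are given by the zeros of the shooting function. -/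
theorem isNegEigenvalue_iff (haL : a < L) (hL0 : 0 < L) (hL : -L ≤ L) {U : L2Icc a} {κ : ℝ}
    (hκ : 0 < κ) : IsNegEigenvalue (pot U) (-κ ^ 2) ↔ shoot hL (U, κ) = 0 := by
  constructor
  · rintro ⟨hE, ψ, hψ⟩
    have hd := hψ.isDecaying haL hE
    rw [neg_neg, Real.sqrt_sq hκ.le] at hd
    -- If `ψ (-L) = 0`, then `ψ` vanishes identically, against normalization; so the other factor is
    -- zero.
    rcases mul_eq_zero.1 (hd.eq_leftSol hL).2 with h | h
    · have := hd.eq_zero_of_left haL hL hκ h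
      have hn := hψ.normalized
      rw [this] at hn
      simp at hn
    · exact h
  · intro hs
    obtain ⟨u, v, hd, hu⟩ := exists_isDecaying haL hL0 hL hs
    have h1 : u (-L) = 1 := by
      rw [hu ⟨-L, left_mem_Icc.2 hL⟩, leftSol_left]
    have hpos := hd.integral_sq_pos haL hκ (by rw [h1]; exact one_ne_zero)
    refine ⟨by nlinarith, _, (hd.const_mul (Real.sqrt (∫ x, u x ^ 2))⁻¹).isBoundState haL hκ ?_⟩
    simp_rw [mul_pow]
    rw [integral_const_mul, inv_pow, Real.sq_sqrt hpos.le, inv_mul_cancel₀ hpos.ne']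

end FermiGoldenRule
end

/-! ### Simplicity and a priori bound of the zeros; the largest zero as a smooth function of the
potential. -/

noncomputable section

namespace FermiGoldenRule

variable {a L : ℝ}

theorem norm_pot_intervalIntegral_le (hL : -L ≤ L) (U : L2Icc a) :
    ∫ t in (-L)..L, |pot U t| ≤ embedConst a * ‖U‖ := by
  refine le_trans ?_ (integral_abs_pot_le U)
  rw [intervalIntegral.integral_of_le hL]
  simp only [← Real.norm_eq_abs]
  exact setIntegral_le_integral (integrable_pot U).norm
    (by filter_upwards with t using norm_nonneg _)

/-- A priori bound on the zeros of the shooting function. -/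
theorem le_of_shoot_eq_zero (hL : -L ≤ L) {U : L2Icc a} {κ : ℝ} (hκ : 0 < κ)
    (hs : shoot hL (U, κ) = 0) : κ ≤ embedConst a * ‖U‖ := by
  obtain ⟨v, h1, h2, h3, h4⟩ := leftSol_solOn hL U κ
  set w := leftSol hL (U, κ)
  set u := IccExtend hL w with hu
  have hmL : -L ∈ Icc (-L) L := left_mem_Icc.2 hL
  have hmR : L ∈ Icc (-L) L := right_mem_Icc.2 hL
  have hv : v L = -κ * u L := by linarith
  have hq := locallyIntegrable_coef (locallyIntegrable_pot U) κ
  have hII : ∀ x ∈ Icc (-L) L, uIcc (-L) x ⊆ Icc (-L) L := fun x hx =>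
    OrdConnected.uIcc_subset inferInstance hmL hx
  have hcu : Continuous u := continuous_extend hL w
  have iv : ∀ x ∈ Icc (-L) L, IntervalIntegrable v volume (-L) x := fun x hx =>
    (h1.cont'.mono (hII x hx)).intervalIntegrable
  have iv2 : ∀ x ∈ Icc (-L) L, IntervalIntegrable (fun t => v t ^ 2 + κ ^ 2 * u t ^ 2) volume (-L) x :=
    fun x hx => (((h1.cont'.pow 2).mono (hII x hx)).add
      (continuousOn_const.mul (hcu.continuousOn.pow 2))).intervalIntegrable
  have iU : IntervalIntegrable (fun t => pot U t * u t ^ 2) volume (-L) L :=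
    (locallyIntegrable_intervalIntegrable (locallyIntegrable_pot U)).mul_continuousOn
      (hcu.pow 2).continuousOn
  -- Energy identity: `u u'` between the endpoints equals `∫ (u'² + (U + κ²) u²)`. The boundary
  -- conditions make the left side `-κ u(L)² - κ`, so `κ + κ u(L)² + ∫ (u'² + κ² u²) = -∫ U u²`.
  have E1 := mul_sub_mul_eq_integral (iv L hmR)
    (h1.intervalIntegrable hq (locallyIntegrable_const _) hmL hmR)
    (fun x hx => h1.int _ hmL x (hII L hmR hx)) (fun x hx => h1.int' _ hmL x (hII L hmR hx))
  have E1' : u L * v L - u (-L) * v (-L) =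
      (∫ t in (-L)..L, (v t ^ 2 + κ ^ 2 * u t ^ 2)) + ∫ t in (-L)..L, pot U t * u t ^ 2 := by
    rw [E1, ← intervalIntegral.integral_add (iv2 L hmR) iU]
    refine intervalIntegral.integral_congr fun t _ => ?_
    simp only [coef, RCLike.ofReal_real_eq_id, id]
    ring
  rw [hv, h2, h3] at E1'
  have hU : -∫ t in (-L)..L, pot U t * u t ^ 2 ≤ embedConst a * ‖U‖ * ‖w‖ ^ 2 := by
    rw [← intervalIntegral.integral_neg]
    have : ∫ t in (-L)..L, -(pot U t * u t ^ 2) ≤ ∫ t in (-L)..L, |pot U t| * ‖w‖ ^ 2 := by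
      refine intervalIntegral.integral_mono_on hL iU.neg
        ((locallyIntegrable_intervalIntegrable (locallyIntegrable_pot U)).norm.mul_const _) ?_
      intro t _
      have h5 : |u t| ≤ ‖w‖ := norm_IccExtend_le hL w t
      have h6 : u t ^ 2 ≤ ‖w‖ ^ 2 := sq_le_sq' (by linarith [neg_abs_le (u t)])
        ((le_abs_self _).trans h5)
      calc -(pot U t * u t ^ 2) ≤ |pot U t| * u t ^ 2 := by
            have := neg_abs_le (pot U t)
            nlinarith [sq_nonneg (u t)]
        _ ≤ _ := mul_le_mul_of_nonneg_left h6 (abs_nonneg _)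
    refine this.trans ?_
    rw [intervalIntegral.integral_mul_const]
    exact mul_le_mul_of_nonneg_right (norm_pot_intervalIntegral_le hL U) (sq_nonneg _)
  have hpt : ∀ x : Icc (-L) L, κ * w x ^ 2 ≤ embedConst a * ‖U‖ * ‖w‖ ^ 2 := by
    intro x
    have E2 := mul_sub_mul_eq_integral (iv x x.2) (iv x x.2)
      (fun y hy => h1.int _ hmL y (hII x x.2 hy)) (fun y hy => h1.int _ hmL y (hII x x.2 hy))
    have i3 : IntervalIntegrable (fun t => v t * u t + u t * v t) volume (-L) x :=
      ((iv x x.2).mul_continuousOn hcu.continuousOn).add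
        ((iv x x.2).continuousOn_mul hcu.continuousOn)
    -- From `2 κ u u' ≤ u'² + κ² u²`. Since the left side is `κ (u(x)² - 1)`, the energy identity
    -- bounds `κ u(x)²` at every point, the `1` being absorbed by the boundary term `κ`.
    have E3 : κ * ∫ t in (-L)..x, (v t * u t + u t * v t) ≤
        ∫ t in (-L)..x, (v t ^ 2 + κ ^ 2 * u t ^ 2) := by
      rw [← intervalIntegral.integral_const_mul]
      refine intervalIntegral.integral_mono_on x.2.1 (i3.const_mul κ) (iv2 x x.2) fun t _ => ?_
      nlinarith [sq_nonneg (v t - κ * u t)]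
    have E4 : ∫ t in (-L)..x, (v t ^ 2 + κ ^ 2 * u t ^ 2) ≤
        ∫ t in (-L)..L, (v t ^ 2 + κ ^ 2 * u t ^ 2) :=
      intervalIntegral.integral_mono_interval le_rfl x.2.1 x.2.2
        (by filter_upwards with t; positivity) (iv2 L hmR)
    have hx : u x = w x := IccExtend_of_mem _ _ x.2
    rw [← E2, h2, hx] at E3
    nlinarith [mul_nonneg hκ.le (sq_nonneg (u L))]
  have hw1 : 1 ≤ ‖w‖ := by
    have := w.norm_coe_le_norm ⟨-L, hmL⟩
    rwa [leftSol_left, norm_one] at this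
  -- At a maximum point of `|u|` the sup norm appears on both sides and cancels.
  obtain ⟨x, -, hx⟩ := isCompact_univ.exists_isMaxOn (s := (univ : Set (Icc (-L) L)))
    ⟨⟨-L, hmL⟩, trivial⟩ (w.continuous.norm.continuousOn)
  have hwx : ‖w‖ = |w x| :=
    le_antisymm ((ContinuousMap.norm_le _ (abs_nonneg _)).2 fun y => hx (mem_univ y))
      (w.norm_coe_le_norm x)
  have := hpt x
  rw [hwx, sq_abs] at this
  have hpos : 0 < w x ^ 2 := by rw [← sq_abs, ← hwx]; positivity
  exact le_of_mul_le_mul_right this hpos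

/-- The shooting function has a simple zero at an eigenvalue. -/
theorem deriv_shoot_ne_zero (hL : -L ≤ L) {U : L2Icc a} {κ s : ℝ} (hκ : 0 < κ)
    (hs : shoot hL (U, κ) = 0) (hd : HasDerivAt (fun k : ℝ => shoot hL (U, k)) s κ) : s ≠ 0 := by
  obtain ⟨v, h1, h2, h3, h4⟩ := leftSol_solOn hL U κ
  set w := leftSol hL (U, κ) with hw
  set u := IccExtend hL w with hu
  have hmR : L ∈ Icc (-L) L := right_mem_Icc.2 hL
  set R : Icc (-L) L := ⟨L, hmR⟩
  have hv : v L = -κ * u L := by linarith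
  have huL : u L = w R := IccExtend_of_mem _ _ hmR
  -- Lagrange's identity between the solutions for `κ` and for `k` has every term divisible by `k -
  -- κ`; `G` is the quotient.
  let G : ℝ → ℝ := fun k => 1 + w R * leftSol hL (U, k) R +
    (k + κ) * prim ℝ hL (w * leftSol hL (U, k)) R
  have key : ∀ k, w R * shoot hL (U, k) = (k - κ) * G k := by
    intro k
    obtain ⟨v', g1, g2, g3, g4⟩ := leftSol_solOn hL U k
    have gL : IccExtend hL (leftSol hL (U, k)) L = leftSol hL (U, k) R :=
      IccExtend_of_mem _ _ hmR
    have := SolOn.lagrange hL h1 g1 (locallyIntegrable_coef (locallyIntegrable_pot U) κ)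
      (locallyIntegrable_const _) (locallyIntegrable_coef (locallyIntegrable_pot U) k)
      (locallyIntegrable_const _)
    have e : ∫ t in (-L)..L, ((coef (pot U) k t - coef (pot U) κ t) * u t *
        IccExtend hL (leftSol hL (U, k)) t - u t * 0 + IccExtend hL (leftSol hL (U, k)) t * 0) =
        (k ^ 2 - κ ^ 2) * prim ℝ hL (w * leftSol hL (U, k)) R := by
      rw [prim_apply, ← intervalIntegral.integral_const_mul]
      refine intervalIntegral.integral_congr fun t _ => ?_
      simp only [coef, hu, IccExtend, Function.comp_apply, ContinuousMap.mul_apply]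
      ring
    rw [e, h2, h3, g2, g3, hv, huL, gL] at this
    rw [gL] at g4
    simp only [G]
    rw [← g4]
    linear_combination this
  have hGd : DifferentiableAt ℝ G κ := by
    have k1 : ContDiff ℝ 1 fun k : ℝ => leftSol hL (U, k) :=
      (contDiff_leftSol hL).comp (contDiff_const.prodMk contDiff_id)
    have k2 : ContDiff ℝ 1 fun k : ℝ => w * leftSol hL (U, k) := contDiff_const.mul k1
    have k3 : ContDiff ℝ 1 fun k : ℝ => prim ℝ hL (w * leftSol hL (U, k)) :=
      (prim ℝ hL).contDiff.comp k2
    have : ContDiff ℝ 1 G :=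
      (contDiff_const.add (contDiff_const.mul (contDiff_eval k1 R))).add
        ((contDiff_id.add contDiff_const).mul (contDiff_eval k3 R))
    exact this.differentiable (by norm_num) κ
  have hG : HasDerivAt (fun k => (k - κ) * G k) (G κ) κ := by
    have : HasDerivAt (fun k => (k - κ) * G k) (1 * G κ + (κ - κ) * deriv G κ) κ :=
      ((hasDerivAt_id κ).sub_const κ).mul hGd.hasDerivAt
    simpa using this
  have hG' := (hd.const_mul (w R)).congr_of_eventuallyEq
    (Eventually.of_forall fun k => (key k).symm)
  -- Both sides are the derivative at `κ` of `w(L) · shoot`. Moreover `G κ = 1 + w(L)² + 2κ ∫ w²` is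
  -- positive, which excludes `s = 0`.
  have heq : G κ = w R * s := hG.unique hG'
  have hpos : 0 < G κ := by
    have : 0 ≤ prim ℝ hL (w * w) R := by
      rw [prim_apply]
      refine intervalIntegral.integral_nonneg hL fun t _ => ?_
      simp only [IccExtend, Function.comp_apply, ContinuousMap.mul_apply]
      exact mul_self_nonneg _
    have h5 : 0 ≤ (κ + κ) * prim ℝ hL (w * w) R := by positivity
    have h6 := mul_self_nonneg (w R)
    simp only [G, ← hw]
    linarith
  rintro rfl
  rw [heq] at hpos
  simp at hpos

/-- The largest zero of the shooting function depends smoothly on the potential. -/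
theorem exists_shoot_zero (hL : -L ≤ L) {V : L2Icc a} {κ₀ : ℝ} (hκ : 0 < κ₀)
    (hs : shoot hL (V, κ₀) = 0) (hmax : ∀ κ, κ₀ < κ → shoot hL (V, κ) ≠ 0) :
    ∃ φ : L2Icc a → ℝ, φ V = κ₀ ∧ ContDiffAt ℝ 1 φ V ∧
      ∀ᶠ U in 𝓝 V, 0 < φ U ∧ shoot hL (U, φ U) = 0 ∧ ∀ κ, φ U < κ → shoot hL (U, κ) ≠ 0 := by
  have hc : ContDiff ℝ 1 (shoot hL : L2Icc a × ℝ → ℝ) := contDiff_shoot hL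
  have hdiff : DifferentiableAt ℝ (shoot hL : L2Icc a × ℝ → ℝ) (V, κ₀) :=
    hc.differentiable (by norm_num) _
  set F' := fderiv ℝ (shoot hL : L2Icc a × ℝ → ℝ) (V, κ₀) with hF'
  have hd : HasDerivAt (fun k : ℝ => shoot hL (V, k)) ((F' ∘L .inr ℝ (L2Icc a) ℝ) 1) κ₀ := by
    have h1 : HasFDerivAt (fun k : ℝ => (V, k)) (ContinuousLinearMap.inr ℝ (L2Icc a) ℝ) κ₀ :=
      hasFDerivAt_prodMk_right V κ₀
    exact (HasFDerivAt.comp κ₀ hdiff.hasFDerivAt h1).hasDerivAt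
  have hne := deriv_shoot_ne_zero hL hκ hs hd
  have hinv : (F' ∘L .inr ℝ (L2Icc a) ℝ).IsInvertible := by
    refine ⟨ContinuousLinearEquiv.unitsEquivAut ℝ (Units.mk0 _ hne), ?_⟩
    ext
    simp [ContinuousLinearEquiv.unitsEquivAut]
  set φ := hc.contDiffAt.implicitFunction one_ne_zero hinv with hφ
  have φ0 : φ V = κ₀ := hc.contDiffAt.implicitFunction_apply_self one_ne_zero hinv
  have φd : ContDiffAt ℝ 1 φ V := hc.contDiffAt.contDiffAt_implicitFunction one_ne_zero hinv
  have e1 := hc.contDiffAt.eventually_apply_eq_iff_implicitFunction one_ne_zero hinv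
  rw [hs, nhds_prod_eq] at e1
  obtain ⟨P, hP, Q, hQ, hPQ⟩ := eventually_prod_iff.1 e1
  obtain ⟨ε, hε, hball⟩ := Metric.eventually_nhds_iff.1 hQ
  refine ⟨φ, φ0, φd, ?_⟩
  -- Above `K` the a priori bound excludes zeros for every `U` with `‖U‖ < ‖V‖ + 1`. On `[κ₀ + ε /
  -- 2, K]` compactness excludes them for `U` near `V`. Below that, local uniqueness in the implicit
  -- function theorem leaves only `φ U`.
  set K := embedConst a * (‖V‖ + 1) + κ₀ + ε with hK
  have hcomp : ∀ᶠ U in 𝓝 V, ∀ κ ∈ Icc (κ₀ + ε / 2) K, shoot hL (U, κ) ≠ 0 := by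
    refine isCompact_Icc.eventually_forall_of_forall_eventually fun κ hκ' => ?_
    exact (hc.continuous.continuousAt (x := (V, κ))).eventually_ne (hmax κ (by linarith [hκ'.1]))
  have hcont : ∀ᶠ U in 𝓝 V, φ U ∈ Ioo (κ₀ - min (ε / 2) (κ₀ / 2)) (κ₀ + ε / 2) := by
    refine φd.continuousAt.eventually_mem (Ioo_mem_nhds ?_ ?_)
    · rw [φ0]; have : 0 < min (ε / 2) (κ₀ / 2) := by positivity
      linarith
    · rw [φ0]; linarith
  have hnorm : ∀ᶠ U in 𝓝 V, ‖U‖ < ‖V‖ + 1 :=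
    continuous_norm.continuousAt.eventually_lt continuousAt_const (by linarith)
  filter_upwards [hP, hcomp, hcont, hnorm] with U hU1 hU2 hU3 hU4
  have hmin1 := min_le_left (ε / 2) (κ₀ / 2)
  have hmin2 := min_le_right (ε / 2) (κ₀ / 2)
  have hpos : 0 < φ U := by linarith [hU3.1]
  have hiff : ∀ κ, |κ - κ₀| < ε → (shoot hL (U, κ) = 0 ↔ φ U = κ) := fun κ hκ' =>
    hPQ hU1 (hball hκ')
  refine ⟨hpos, (hiff _ (abs_lt.2 ⟨by linarith [hU3.1], by linarith [hU3.2]⟩)).2 rfl,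
    fun κ hκ' h0 => ?_⟩
  rcases lt_or_ge κ (κ₀ + ε / 2) with h | h
  · have := (hiff κ (abs_lt.2 ⟨by linarith [hU3.1], by linarith⟩)).1 h0
    linarith
  · rcases le_or_gt κ K with h' | h'
    · exact hU2 κ ⟨h, h'⟩ h0
    · have h5 := le_of_shoot_eq_zero hL (hpos.trans hκ') h0
      have h6 : embedConst a * ‖U‖ ≤ embedConst a * (‖V‖ + 1) :=
        mul_le_mul_of_nonneg_left hU4.le (norm_nonneg _)
      linarith

/-- A larger decay rate means a lower energy, so the largest zero gives the infimum of the negative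
eigenvalues. Other eigenvalues of `U` need not be controlled. -/
theorem groundEnergy_eq (haL : a < L) (hL0 : 0 < L) (hL : -L ≤ L) {U : L2Icc a} {κ₀ : ℝ}
    (hκ : 0 < κ₀) (hs : shoot hL (U, κ₀) = 0) (hmax : ∀ κ, κ₀ < κ → shoot hL (U, κ) ≠ 0) :
    groundEnergy (pot U) = -κ₀ ^ 2 := by
  refine IsLeast.csInf_eq ⟨(isNegEigenvalue_iff haL hL0 hL hκ).2 hs, fun E hE => ?_⟩
  have hE0 : E < 0 := hE.1
  by_contra hlt
  have hsq : Real.sqrt (-E) ^ 2 = -E := Real.sq_sqrt (by linarith)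
  have hk : 0 < Real.sqrt (-E) := Real.sqrt_pos.2 (by linarith)
  refine hmax (Real.sqrt (-E)) (by nlinarith) ?_
  rw [← isNegEigenvalue_iff haL hL0 hL hk, hsq, neg_neg]
  exact hE

end FermiGoldenRule
end

/-! ### Outgoing solutions, absence of real resonances and limiting absorption. -/

noncomputable section

namespace FermiGoldenRule

variable {a L : ℝ}

/-- `u`, with derivative `v`, solves `u'' = (U + κ²) u - f` and is outgoing at both ends. -/
structure IsOutgoing (L : ℝ) (U : L2Icc a) (κ : ℂ) (f u v : ℝ → ℂ) : Prop where
  sol : SolOn univ (coef (pot U) κ) f u v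
  right : v L = -κ * u L
  left : v (-L) = κ * u (-L)

namespace IsOutgoing

variable {U : L2Icc a} {κ : ℂ} {f g u v u' v' : ℝ → ℂ}

theorem tail_right (h : IsOutgoing L U κ f u v) (haL : a < L) (hκ : κ ≠ 0)
    (hf : ∀ x, x ∉ Icc (-L) L → f x = 0) {x : ℝ} (hx : L ≤ x) :
    u x = u L * Complex.exp (-κ * (x - L)) :=
  ((SolOn.free_right haL h.sol fun y hy => hf y fun hm => by linarith [hm.2]).tail_right_decay
    hκ h.right hx).1

theorem tail_left (h : IsOutgoing L U κ f u v) (haL : a < L) (hκ : κ ≠ 0)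
    (hf : ∀ x, x ∉ Icc (-L) L → f x = 0) {x : ℝ} (hx : x ≤ -L) :
    u x = u (-L) * Complex.exp (κ * (x + L)) := by
  have := ((SolOn.free_left haL h.sol fun y hy => hf y fun hm => by
    linarith [hm.1]).tail_left_decay hκ h.left hx).1
  rwa [Complex.ofReal_neg, sub_neg_eq_add] at this

theorem memLp (h : IsOutgoing L U κ f u v) (haL : a < L) (hκ : 0 < κ.re)
    (hf : ∀ x, x ∉ Icc (-L) L → f x = 0) : MemLp u 2 volume := by
  have hκ0 : κ ≠ 0 := fun h0 => by simp [h0] at hκ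
  refine memLp_two_of_exp_decay (continuousOn_univ.1 h.sol.cont) hκ ?_ ?_
  · refine Asymptotics.IsBigO.of_bound (‖u L‖ * Real.exp (κ.re * L)) ?_
    filter_upwards [eventually_ge_atTop L] with x hx
    rw [h.tail_right haL hκ0 hf hx, norm_norm, norm_mul, Complex.norm_exp, Real.norm_eq_abs,
      Real.abs_exp, mul_assoc, ← Real.exp_add]
    apply le_of_eq; congr 2; simp; ring
  · refine Asymptotics.IsBigO.of_bound (‖u (-L)‖ * Real.exp (κ.re * L)) ?_
    filter_upwards [eventually_ge_atTop L] with x hx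
    rw [h.tail_left haL hκ0 hf (neg_le_neg hx), norm_norm, norm_mul, Complex.norm_exp,
      Real.norm_eq_abs, Real.abs_exp, mul_assoc, ← Real.exp_add]
    apply le_of_eq; congr 2; simp; ring

/-- The difference of two outgoing solutions is a homogeneous one, hence a multiple of `leftSol`;
the condition at `L` and `shoot ≠ 0` make the multiple zero. -/
theorem unique (h : IsOutgoing L U κ f u v) (h' : IsOutgoing L U κ f u' v') (haL : a < L)
    (hL : -L ≤ L) (hκ : κ ≠ 0) (hs : shoot hL (U, κ) ≠ 0) (hf : LocallyIntegrable f volume) :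
    u = u' := by
  have hd : IsOutgoing L U κ (fun _ => 0) (fun x => u x - u' x) (fun x => v x - v' x) := by
    refine ⟨?_, by rw [h.right, h'.right]; ring, by rw [h.left, h'.left]; ring⟩
    have := h.sol.sub h'.sol (locallyIntegrable_coef (locallyIntegrable_pot U) κ) hf hf
    simpa using this
  obtain ⟨h1, h2⟩ := SolOn.eq_leftSol hL (hd.sol.mono (subset_univ _)) hd.left
  have h3 : u (-L) - u' (-L) = 0 := by
    have : (u (-L) - u' (-L)) * shoot hL (U, κ) = 0 := by rw [← h2, hd.right]; ring
    exact (mul_eq_zero.1 this).resolve_right hs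
  have hm : ∀ x : Icc (-L) L, u x - u' x = 0 := fun x => by
    have := congrArg (fun w : C(Icc (-L) L, ℂ) => w x) h1
    simp only [restrictIcc_apply, ContinuousMap.smul_apply, h3, zero_smul] at this
    exact this
  ext x
  rw [← sub_eq_zero]
  rcases le_total x (-L) with hx | hx
  · have := hd.tail_left haL hκ (fun _ _ => rfl) hx
    rw [this, h3, zero_mul]
  · rcases le_total x L with hx' | hx'
    · exact hm ⟨x, hx, hx'⟩
    · have := hd.tail_right haL hκ (fun _ _ => rfl) hx'
      rw [this, hm ⟨L, right_mem_Icc.2 hL⟩, zero_mul]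

end IsOutgoing

/-- The outgoing solution of `u'' = (U + κ²) u - f` on `[-L, L]`. -/
def outSol (hL : -L ≤ L) (f : ℝ → ℂ) (hf : LocallyIntegrable f volume) (p : L2Icc a × ℂ) :
    C(Icc (-L) L, ℂ) :=
  ivpOp hL p (-source hL f hf) -
    ((bdry hL p 0 (ivpOp hL p (-source hL f hf)) - ∫ t in (-L)..L, f t) / shoot hL p) •
      leftSol hL p

/-- The solution with zero Cauchy data at `-L` already satisfies the left condition, and so does
`leftSol`; the multiple of `leftSol` to subtract is fixed by the condition at `L`. The term `∫ f`
appears because `bdry` computes the end slope without the source. -/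
theorem outSol_solOn (hL : -L ≤ L) (U : L2Icc a) {κ : ℂ} (hs : shoot hL (U, κ) ≠ 0) {f : ℝ → ℂ}
    (hf : LocallyIntegrable f volume) :
    ∃ v : ℝ → ℂ, SolOn (Icc (-L) L) (coef (pot U) κ) f
      (IccExtend hL (outSol hL f hf (U, κ))) v ∧
      v L = -κ * IccExtend hL (outSol hL f hf (U, κ)) L ∧
      v (-L) = κ * IccExtend hL (outSol hL f hf (U, κ)) (-L) := by
  have hq := locallyIntegrable_coef (locallyIntegrable_pot U) κ
  set w := ivpOp hL (U, κ) (-source hL f hf) with hw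
  have hw' : w = ivp hL (coef (pot U) κ) hq (affine (-L) L 0 0 - source hL f hf) := by
    rw [hw, ivpOp_apply, show affine (-L) L (0 : ℂ) 0 = 0 by ext; simp [affine], zero_sub]
  obtain ⟨g1, g2, g3⟩ := ivp_solOn hL hq hf hw'
  obtain ⟨v, h1, h2, h3, h4⟩ := leftSol_solOn hL U κ
  have hmR : L ∈ Icc (-L) L := right_mem_Icc.2 hL
  have hwe : slopeOf hL (coef (pot U) κ) f 0 w L =
      endSlope hL (U, κ) 0 w - ∫ t in (-L)..L, f t := by
    rw [endSlope_eq, slopeOf, slopeOf, intervalIntegral.integral_sub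
      (locallyIntegrable_intervalIntegrable (locallyIntegrable_mul_extend hL hq w))
      (locallyIntegrable_intervalIntegrable hf)]
    simp
  set α := (bdry hL (U, κ) 0 w - ∫ t in (-L)..L, f t) / shoot hL (U, κ) with hα
  have hα' : α * shoot hL (U, κ) = bdry hL (U, κ) 0 w - ∫ t in (-L)..L, f t := by
    rw [hα, div_mul_cancel₀ _ hs]
  have hsub := g1.sub (h1.const_mul α) hq hf (by simpa using locallyIntegrable_const (0 : ℂ))
  have e : IccExtend hL (outSol hL f hf (U, κ)) = fun t => IccExtend hL w t -
      α * IccExtend hL (leftSol hL (U, κ)) t := by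
    ext t; rfl
  refine ⟨fun t => slopeOf hL (coef (pot U) κ) f 0 w t - α * v t, ?_, ?_, ?_⟩
  · rw [e]; simpa using hsub
  · simp only [e]
    rw [hwe]
    have hwL : IccExtend hL w L = w ⟨L, hmR⟩ := IccExtend_of_mem _ _ hmR
    simp only [bdry] at hα'
    rw [hwL]
    linear_combination -α * h4 - hα'
  · simp only [e]
    rw [g2, g3, h2, h3]; ring

/-- Existence of outgoing solutions on the line. -/
theorem exists_isOutgoing (haL : a < L) (hL0 : 0 < L) (hL : -L ≤ L) (U : L2Icc a) {κ : ℂ}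
    (hs : shoot hL (U, κ) ≠ 0) {f : ℝ → ℂ} (hf : LocallyIntegrable f volume)
    (hf0 : ∀ x, x ∉ Icc (-L) L → f x = 0) :
    ∃ u v : ℝ → ℂ, IsOutgoing L U κ f u v ∧ ∀ x : Icc (-L) L, u x = outSol hL f hf (U, κ) x := by
  obtain ⟨v, h1, h2, h3⟩ := outSol_solOn hL U hs hf
  set w := IccExtend hL (outSol hL f hf (U, κ))
  have sl := SolOn.of_free_left (f := f) haL (U := U)
    ((solOn_cexp κ 0 (w (-L)) (-L)).mono (subset_univ (Iic (-L))))
    (fun x hx => hf0 x fun hm => by linarith [hm.1])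
  have sr := SolOn.of_free_right (f := f) haL (U := U)
    ((solOn_cexp κ (w L) 0 L).mono (subset_univ (Ici L)))
    (fun x hx => hf0 x fun hm => by linarith [hm.2])
  obtain ⟨u', v', g1, g2, g3, g4, g5, g6, g7⟩ := SolOn.glue hL0
    (locallyIntegrable_coef (locallyIntegrable_pot U) κ) hf h1 sl sr
    (by simp) (by simp [h3]) (by simp) (by simp [h2])
  have mL : L ∈ Icc (-L) L := right_mem_Icc.2 hL
  have mL' : -L ∈ Icc (-L) L := left_mem_Icc.2 hL
  refine ⟨u', v', ⟨g1, ?_, ?_⟩, fun x => ?_⟩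
  · rw [g2 mL, g3 mL, h2]
  · rw [g2 mL', g3 mL', h3]
  · rw [g2 x.2]; exact IccExtend_of_mem _ _ x.2

theorem SolOn.conj {S : Set ℝ} {q f u v : ℝ → ℂ} (h : SolOn S q f u v) :
    SolOn S (fun x => (starRingEnd ℂ) (q x)) (fun x => (starRingEnd ℂ) (f x))
      (fun x => (starRingEnd ℂ) (u x)) (fun x => (starRingEnd ℂ) (v x)) := by
  have hi : ∀ (g : ℝ → ℂ) (x y : ℝ), ∫ t in x..y, (starRingEnd ℂ) (g t) =
      (starRingEnd ℂ) (∫ t in x..y, g t) := fun g x y => by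
    simp only [intervalIntegral, integral_conj, map_sub]
  refine ⟨Complex.continuous_conj.comp_continuousOn h.cont,
    Complex.continuous_conj.comp_continuousOn h.cont', fun x hx y hy => ?_, fun x hx y hy => ?_⟩
  · rw [hi, ← h.int x hx y hy, map_sub]
  · simp only [← map_mul, ← map_sub]
    rw [hi, ← h.int' x hx y hy]

theorem coef_conj (V : ℝ → ℝ) (k : ℝ) :
    (fun x => (starRingEnd ℂ) (coef V (-(Complex.I * k)) x)) = coef V (-(Complex.I * k)) := by
  ext x
  simp only [coef, RCLike.ofReal_eq_complex_ofReal, map_add, map_pow, map_neg, map_mul,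
    Complex.conj_ofReal, Complex.conj_I]
  ring

/-- There are no real resonances. -/
theorem shoot_ne_zero_of_real (hL : -L ≤ L) (U : L2Icc a) {k : ℝ} (hk : k ≠ 0) :
    shoot hL (U, -(Complex.I * k)) ≠ 0 := by
  intro hs
  obtain ⟨v, h1, h2, h3, h4⟩ := leftSol_solOn hL U (-(Complex.I * k) : ℂ)
  set u := IccExtend hL (leftSol hL (U, -(Complex.I * (k : ℂ))))
  have hc := h1.conj
  rw [coef_conj] at hc
  simp only [map_zero] at hc
  have hq := locallyIntegrable_coef (locallyIntegrable_pot U) (-(Complex.I * k) : ℂ)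
  -- For real `k` the conjugate solves the same equation, so the Wronskian is constant. It is `2ik`
  -- at `-L` and `-2ik |u(L)|²` at a resonance, whence `|u(L)|² + 1 = 0`.
  have := SolOn.lagrange hL h1 hc hq (locallyIntegrable_const _) hq (locallyIntegrable_const _)
  simp only [sub_self, zero_mul, mul_zero, add_zero, intervalIntegral.integral_zero] at this
  have hv : v L = Complex.I * k * u L := by rw [hs] at h4; linear_combination h4
  rw [h2, h3, hv] at this
  simp only [map_mul, map_neg, map_one, Complex.conj_I, Complex.conj_ofReal] at this
  have h5 : (2 * Complex.I * k) * ((u L * (starRingEnd ℂ) (u L)) + 1) = 0 := by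
    linear_combination -this
  rw [Complex.mul_conj] at h5
  have h6 : (2 * Complex.I * (k : ℂ)) ≠ 0 := by simp [hk]
  have h7 := (mul_eq_zero.1 h5).resolve_left h6
  have h8 : Complex.normSq (u L) + 1 = 0 := by exact_mod_cast h7
  have := Complex.normSq_nonneg (u L)
  linarith

theorem continuousAt_outSol (hL : -L ≤ L) {f : ℝ → ℂ} (hf : LocallyIntegrable f volume)
    (U : L2Icc a) {κ : ℂ} (hs : shoot hL (U, κ) ≠ 0) :
    ContinuousAt (fun z : ℂ => outSol hL f hf (U, z)) κ := by
  have c1 : Continuous fun z : ℂ => ((U, z) : L2Icc a × ℂ) := by fun_prop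
  have h1 : ContDiff ℝ 1 fun p : L2Icc a × ℂ => ivpOp hL p (-source hL f hf) :=
    (contDiff_ivpOp hL).clm_apply contDiff_const
  have h2 : ContDiff ℝ 1 fun p : L2Icc a × ℂ => bdry hL p 0 (ivpOp hL p (-source hL f hf)) :=
    contDiff_bdry hL contDiff_const h1
  have h3 : Continuous fun z : ℂ => shoot hL ((U, z) : L2Icc a × ℂ) :=
    (contDiff_shoot (n := 1) hL).continuous.comp c1
  have h4 : Continuous fun z : ℂ => leftSol hL ((U, z) : L2Icc a × ℂ) :=
    (contDiff_leftSol (n := 1) hL).continuous.comp c1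
  exact (h1.continuous.comp c1).continuousAt.sub
    ((((h2.continuous.comp c1).sub continuous_const).continuousAt.div h3.continuousAt hs).smul
      h4.continuousAt)

/-- For `Im k > 0` the outgoing solution is the resolvent on `L²`. -/
theorem resolventL2_eq (haL : a < L) {U : L2Icc a} {k : ℂ} (hL : -L ≤ L)
    (hk : 0 < k.im) (hs : shoot hL (U, -(Complex.I * k)) ≠ 0) {f u v : ℝ → ℂ}
    (hf : LocallyIntegrable f volume) (hf0 : ∀ x, x ∉ Icc (-L) L → f x = 0)
    (h : IsOutgoing L U (-(Complex.I * k)) f u v) : resolventL2 (pot U) k f = u := by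
  have hz : k ^ 2 = -(-(Complex.I * k)) ^ 2 := by
    rw [neg_sq, mul_pow, Complex.I_sq]; ring
  have hre : 0 < (-(Complex.I * k)).re := by simpa using hk
  have hex : ∃ u : ℝ → ℂ, MemLp u 2 volume ∧ IsSol (pot U) (k ^ 2) f u := by
    refine ⟨u, h.memLp haL hre hf0, ?_⟩
    rw [isSol_iff_solOn (locallyIntegrable_pot U) hz hf, h.sol.deriv_eq]
    exact h.sol
  rw [resolventL2, dif_pos hex]
  obtain ⟨g1, g2⟩ := hex.choose_spec
  rw [isSol_iff_solOn (locallyIntegrable_pot U) hz hf] at g2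
  -- For `Im k > 0` an `L²` solution has no growing exponential, so the chosen resolvent satisfies
  -- the same boundary conditions, and uniqueness applies.
  have ho : IsOutgoing L U (-(Complex.I * k)) f hex.choose (deriv hex.choose) :=
    ⟨g2, (SolOn.free_right haL g2 fun y hy => hf0 y fun hm => by
      linarith [hm.2]).memLp_right hre g1, (SolOn.free_left haL g2 fun y hy => hf0 y fun hm => by
      linarith [hm.1]).memLp_left hre g1⟩
  exact ho.unique h haL hL (fun h0 => by simp [h0] at hre) hs hf

/-- Needed for the limit that defines `outResolvent` to be determined. -/
theorem upper_half_neBot (k : ℝ) : (𝓝[{κ : ℂ | 0 < κ.im}] (k : ℂ)).NeBot := by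
  rw [← mem_closure_iff_nhdsWithin_neBot, Complex.closure_setOfPred_lt_im]
  simp

/-- The limiting absorption principle: the outgoing resolvent is the outgoing solution. -/
theorem outResolvent_isOutgoing (haL : a < L) (hL0 : 0 < L) (U : L2Icc a) {k : ℝ} (hk : k ≠ 0)
    {f : ℝ → ℂ} (hf : LocallyIntegrable f volume) (hf0 : ∀ x, x ∉ Icc (-L) L → f x = 0) :
    IsOutgoing L U (-(Complex.I * k)) f (outResolvent (pot U) k f)
      (deriv (outResolvent (pot U) k f)) := by
  have hL : -L ≤ L := by linarith
  have hs := shoot_ne_zero_of_real hL U hk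
  obtain ⟨u, v, hu, hux⟩ := exists_isOutgoing haL hL0 hL U hs hf hf0
  -- The outgoing solution exists at the real frequency itself because there is no resonance; it
  -- remains to see that it is the pointwise limit of the `L²` resolvents.
  suffices h : outResolvent (pot U) k f = u by
    rw [h, hu.sol.deriv_eq]; exact hu
  have hκ0 : ∀ z : ℂ, z ≠ 0 → -(Complex.I * z) ≠ 0 := fun z hz => by simp [hz]
  have hkC : (k : ℂ) ≠ 0 := Complex.ofReal_ne_zero.2 hk
  have cκ : Continuous fun z : ℂ => -(Complex.I * z) := by fun_prop
  have hev : ∀ᶠ z : ℂ in 𝓝[{κ : ℂ | 0 < κ.im}] (k : ℂ),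
      0 < z.im ∧ shoot hL (U, -(Complex.I * z)) ≠ 0 := by
    have h3 : Continuous fun z : ℂ => shoot hL ((U, -(Complex.I * z)) : L2Icc a × ℂ) :=
      (contDiff_shoot (n := 1) hL).continuous.comp (by fun_prop)
    filter_upwards [self_mem_nhdsWithin, nhdsWithin_le_nhds (h3.continuousAt.eventually_ne hs)]
      with z h1 h2 using ⟨h1, h2⟩
  have hcont : ContinuousAt (fun z : ℂ => outSol hL f hf (U, -(Complex.I * z))) (k : ℂ) :=
    ContinuousAt.comp (f := fun z : ℂ => -(Complex.I * z))
      (g := fun z => outSol hL f hf (U, z)) (continuousAt_outSol hL hf U hs) cκ.continuousAt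
  have heval : ∀ x : Icc (-L) L, ContinuousAt
      (fun z : ℂ => outSol hL f hf (U, -(Complex.I * z)) x) (k : ℂ) := fun x =>
    (ContinuousMap.evalCLM ℝ x : C(Icc (-L) L, ℂ) →L[ℝ] ℂ).continuous.continuousAt.comp hcont
  have mR : L ∈ Icc (-L) L := right_mem_Icc.2 hL
  have mL : -L ∈ Icc (-L) L := left_mem_Icc.2 hL
  ext x
  have := upper_half_neBot k
  refine Tendsto.limUnder_eq ?_
  -- Inside `[-L, L]` convergence is continuity of `outSol` in `κ`. On the tails the solution is its
  -- boundary value times an explicit exponential, and both factors converge.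
  rcases le_total x (-L) with hx | hx
  · rw [hu.tail_left haL (hκ0 _ hkC) hf0 hx, hux ⟨-L, mL⟩]
    have : ContinuousAt (fun z : ℂ => outSol hL f hf (U, -(Complex.I * z)) ⟨-L, mL⟩ *
      Complex.exp (-(Complex.I * z) * (x + L))) (k : ℂ) := (heval _).mul (by fun_prop)
    refine Tendsto.congr' ?_ (this.tendsto.mono_left nhdsWithin_le_nhds)
    filter_upwards [hev] with z hz
    obtain ⟨u', v', hu', hux'⟩ := exists_isOutgoing haL hL0 hL U hz.2 hf hf0
    rw [resolventL2_eq haL hL hz.1 hz.2 hf hf0 hu', hu'.tail_left haL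
      (hκ0 _ fun h0 => by simp [h0] at hz) hf0 hx, hux' ⟨-L, mL⟩]
  · rcases le_total x L with hx' | hx'
    · rw [hux ⟨x, hx, hx'⟩]
      refine Tendsto.congr' ?_ ((heval ⟨x, hx, hx'⟩).tendsto.mono_left nhdsWithin_le_nhds)
      filter_upwards [hev] with z hz
      obtain ⟨u', v', hu', hux'⟩ := exists_isOutgoing haL hL0 hL U hz.2 hf hf0
      rw [resolventL2_eq haL hL hz.1 hz.2 hf hf0 hu', hux' ⟨x, hx, hx'⟩]
    · rw [hu.tail_right haL (hκ0 _ hkC) hf0 hx', hux ⟨L, mR⟩]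
      have : ContinuousAt (fun z : ℂ => outSol hL f hf (U, -(Complex.I * z)) ⟨L, mR⟩ *
        Complex.exp (-(-(Complex.I * z)) * (x - L))) (k : ℂ) := (heval _).mul (by fun_prop)
      refine Tendsto.congr' ?_ (this.tendsto.mono_left nhdsWithin_le_nhds)
      filter_upwards [hev] with z hz
      obtain ⟨u', v', hu', hux'⟩ := exists_isOutgoing haL hL0 hL U hz.2 hf hf0
      rw [resolventL2_eq haL hL hz.1 hz.2 hf hf0 hu', hu'.tail_right haL
        (hκ0 _ fun h0 => by simp [h0] at hz) hf0 hx', hux' ⟨L, mR⟩]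

end FermiGoldenRule
end

/-! ### A differentiable branch of normalized ground states in `L²(ℝ)`. -/

noncomputable section

namespace FermiGoldenRule

variable {a L : ℝ}

theorem abs_exp_sub_one_sub_le (s : ℝ) : |Real.exp s - 1 - s| ≤ s ^ 2 * Real.exp |s| := by
  have := Complex.norm_exp_sub_sum_le_norm_mul_exp (s : ℂ) 2
  simp only [Finset.sum_range_succ, Finset.sum_range_zero, pow_zero, Nat.factorial, pow_one,
    zero_add, Nat.cast_one, div_one, mul_one] at this
  rw [Complex.norm_real, Real.norm_eq_abs, sq_abs, ← sub_sub] at this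
  rw [← Complex.ofReal_exp] at this
  exact_mod_cast this

open Classical in
/-- The function `e^{-κ g}` on `S`, extended by `0`, as an element of `L²`. -/
def expTail (S : Set ℝ) (g : ℝ → ℝ) (κ : ℝ) : Lp ℝ 2 (volume : Measure ℝ) :=
  if h : MemLp (S.indicator fun x => Real.exp (-κ * g x)) 2 volume then h.toLp else 0

theorem expTail_coe {S : Set ℝ} {g : ℝ → ℝ} {κ : ℝ}
    (h : MemLp (S.indicator fun x => Real.exp (-κ * g x)) 2 volume) :
    expTail S g κ =ᵐ[volume] S.indicator fun x => Real.exp (-κ * g x) := by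
  rw [expTail, dif_pos h]; exact h.coeFn_toLp

/-- For `|κ - κ₀| ≤ κ₀ / 4` the Taylor remainder is at most `(κ - κ₀)² g² e^{-κ₀ g} e^{κ₀ g / 4}`.
Absorbing `g²` in another `e^{κ₀ g / 4}` leaves `e^{-κ₀ g / 2}`, which is still square integrable,
so the remainder is quadratic in the `L²` norm. -/
theorem differentiableAt_expTail {S : Set ℝ} (hS : MeasurableSet S) {g : ℝ → ℝ}
    (hg : Measurable g) (hg0 : ∀ x ∈ S, 0 ≤ g x)
    (hm : ∀ κ, 0 < κ → MemLp (S.indicator fun x => Real.exp (-κ * g x)) 2 volume) {κ₀ : ℝ}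
    (hκ : 0 < κ₀) : DifferentiableAt ℝ (expTail S g) κ₀ := by
  have hdm : MemLp (S.indicator fun x => -g x * Real.exp (-κ₀ * g x)) 2 volume := by
    refine MemLp.of_le_mul (c := 2 / κ₀) (hm (κ₀ / 2) (by positivity))
      (Measurable.aestronglyMeasurable (Measurable.indicator (by fun_prop) hS)) ?_
    filter_upwards with x
    by_cases hx : x ∈ S
    · simp only [indicator_of_mem hx, norm_mul, norm_neg, Real.norm_eq_abs, Real.abs_exp]
      have h0 := hg0 x hx
      rw [abs_of_nonneg h0]
      have h1 : g x ≤ 2 / κ₀ * Real.exp (κ₀ / 2 * g x) := by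
        have := Real.add_one_le_exp (κ₀ / 2 * g x)
        have h2 : κ₀ / 2 * g x ≤ Real.exp (κ₀ / 2 * g x) := by linarith
        calc g x = 2 / κ₀ * (κ₀ / 2 * g x) := by field_simp
          _ ≤ _ := by gcongr
      calc g x * Real.exp (-κ₀ * g x) ≤
            2 / κ₀ * Real.exp (κ₀ / 2 * g x) * Real.exp (-κ₀ * g x) := by gcongr
        _ = _ := by rw [mul_assoc, ← Real.exp_add]; congr 2; ring
    · simp [indicator_of_notMem hx]
  have hC := hm (κ₀ / 2) (by positivity)
  set N := ‖hC.toLp‖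
  have hbound : ∀ κ, |κ - κ₀| ≤ κ₀ / 4 →
      ‖expTail S g κ - expTail S g κ₀ - (κ - κ₀) • hdm.toLp‖ ≤
        (32 / κ₀ ^ 2 * ‖κ - κ₀‖ ^ 2) * N := by
    intro κ hk
    have hκ' : 0 < κ := by have := abs_le.1 hk; linarith
    refine Lp.norm_le_mul_norm_of_ae_le_mul ?_
    filter_upwards [Lp.coeFn_sub (expTail S g κ - expTail S g κ₀) ((κ - κ₀) • hdm.toLp),
      Lp.coeFn_sub (expTail S g κ) (expTail S g κ₀), Lp.coeFn_smul (κ - κ₀) hdm.toLp,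
      hdm.coeFn_toLp, hC.coeFn_toLp, expTail_coe (hm κ hκ'), expTail_coe (hm κ₀ hκ)]
      with x e1 e2 e3 e4 e5 e6 e7
    rw [e1, Pi.sub_apply, e2, Pi.sub_apply, e3, Pi.smul_apply, e4, e5, e6, e7]
    by_cases hx : x ∈ S
    · simp only [indicator_of_mem hx, smul_eq_mul, Real.norm_eq_abs, Real.abs_exp, sq_abs]
      have h0 := hg0 x hx
      have hy : 0 ≤ κ₀ / 4 * g x := by positivity
      -- The constant comes from `y² / 2 ≤ e^y` at `y = κ₀ g / 4`.
      have h1 : g x ^ 2 ≤ 32 / κ₀ ^ 2 * Real.exp (κ₀ / 4 * g x) := by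
        have h2 := Real.quadratic_le_exp_of_nonneg hy
        have h3 : (κ₀ / 4 * g x) ^ 2 / 2 ≤ Real.exp (κ₀ / 4 * g x) := by linarith
        calc g x ^ 2 = 32 / κ₀ ^ 2 * ((κ₀ / 4 * g x) ^ 2 / 2) := by field_simp; ring
          _ ≤ _ := by gcongr
      have h4 := abs_exp_sub_one_sub_le (-(κ - κ₀) * g x)
      have h5 : |-(κ - κ₀) * g x| ≤ κ₀ / 4 * g x := by
        rw [abs_mul, abs_neg, abs_of_nonneg h0]
        gcongr
      have h6 : Real.exp (-κ * g x) - Real.exp (-κ₀ * g x) -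
          (κ - κ₀) * (-g x * Real.exp (-κ₀ * g x)) = Real.exp (-κ₀ * g x) *
          (Real.exp (-(κ - κ₀) * g x) - 1 - -(κ - κ₀) * g x) := by
        have : Real.exp (-κ * g x) = Real.exp (-κ₀ * g x) * Real.exp (-(κ - κ₀) * g x) := by
          rw [← Real.exp_add]; congr 1; ring
        rw [this]; ring
      rw [h6, abs_mul, Real.abs_exp]
      calc Real.exp (-κ₀ * g x) * |Real.exp (-(κ - κ₀) * g x) - 1 - -(κ - κ₀) * g x|
          ≤ Real.exp (-κ₀ * g x) * ((-(κ - κ₀) * g x) ^ 2 * Real.exp (κ₀ / 4 * g x)) := by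
            gcongr
            exact h4.trans (by gcongr)
        _ = (κ - κ₀) ^ 2 * g x ^ 2 * (Real.exp (-κ₀ * g x) * Real.exp (κ₀ / 4 * g x)) := by ring
        _ ≤ (κ - κ₀) ^ 2 * (32 / κ₀ ^ 2 * Real.exp (κ₀ / 4 * g x)) *
            (Real.exp (-κ₀ * g x) * Real.exp (κ₀ / 4 * g x)) := by gcongr
        _ = 32 / κ₀ ^ 2 * (κ - κ₀) ^ 2 * (Real.exp (κ₀ / 4 * g x) *
            (Real.exp (-κ₀ * g x) * Real.exp (κ₀ / 4 * g x))) := by ring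
        _ = _ := by
            rw [← Real.exp_add, ← Real.exp_add]; congr 2; ring
    · simp [indicator_of_notMem hx]
  have : HasDerivAt (expTail S g) hdm.toLp κ₀ := by
    rw [hasDerivAt_iff_isLittleO]
    have hO : (fun κ => expTail S g κ - expTail S g κ₀ - (κ - κ₀) • hdm.toLp) =O[𝓝 κ₀]
        fun κ => ‖κ - κ₀‖ ^ 2 := by
      refine Asymptotics.IsBigO.of_bound (32 / κ₀ ^ 2 * N) ?_
      have : ∀ᶠ κ in 𝓝 κ₀, |κ - κ₀| ≤ κ₀ / 4 :=
        (Metric.closedBall_mem_nhds κ₀ (by positivity : 0 < κ₀ / 4))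
      filter_upwards [this] with κ hk
      refine (hbound κ hk).trans (le_of_eq ?_)
      rw [norm_pow, norm_norm]; ring
    exact hO.trans_isLittleO (Asymptotics.isLittleO_pow_sub_sub κ₀ (by norm_num))
  exact this.differentiableAt

theorem memLp_expTail_right (L : ℝ) {κ : ℝ} (hκ : 0 < κ) :
    MemLp ((Ioi L).indicator fun x => Real.exp (-κ * (x - L))) 2 volume := by
  rw [memLp_indicator_iff_restrict measurableSet_Ioi, memLp_two_iff_integrable_sq
    (Continuous.aestronglyMeasurable (by fun_prop))]
  have := (exp_neg_integrableOn_Ioi L (b := 2 * κ) (by positivity)).const_mul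
    (Real.exp (2 * κ * L))
  refine this.congr (Eventually.of_forall fun x => ?_)
  simp only
  rw [← Real.exp_add, ← Real.exp_nat_mul]
  congr 1
  push_cast
  ring

theorem memLp_expTail_left (L : ℝ) {κ : ℝ} (hκ : 0 < κ) :
    MemLp ((Iio (-L)).indicator fun x => Real.exp (-κ * (-x - L))) 2 volume := by
  have := (memLp_expTail_right L hκ).comp_measurePreserving (Measure.measurePreserving_neg volume)
  convert this using 1
  ext x
  by_cases hx : x < -L
  · have h1 : -x ∈ Ioi L := by simp only [mem_Ioi]; linarith
    have h2 : x ∈ Iio (-L) := hx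
    rw [Function.comp_apply, indicator_of_mem h2, indicator_of_mem h1]
  · have h1 : -x ∉ Ioi L := by simp only [mem_Ioi]; linarith
    have h2 : x ∉ Iio (-L) := hx
    rw [Function.comp_apply, indicator_of_notMem h2, indicator_of_notMem h1]

theorem memLp_mul_extend (hL : -L ≤ L) {b : ℝ → ℝ} (hb : MemLp b 2 volume)
    (w : C(Icc (-L) L, ℝ)) : MemLp (fun x => b x * IccExtend hL w x) 2 volume := by
  refine hb.of_le_mul (c := ‖w‖)
    (hb.aestronglyMeasurable.mul (continuous_extend hL w).aestronglyMeasurable) ?_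
  filter_upwards with x
  rw [norm_mul, mul_comm]
  gcongr
  exact norm_IccExtend_le hL w x

/-- Multiplication by `b ∈ L²(ℝ)`, from `C([-L, L])` to `L²(ℝ)`. -/
def mulExtend (hL : -L ≤ L) {b : ℝ → ℝ} (hb : MemLp b 2 volume) :
    C(Icc (-L) L, ℝ) →L[ℝ] Lp ℝ 2 (volume : Measure ℝ) :=
  LinearMap.mkContinuous
    { toFun := fun w => (memLp_mul_extend hL hb w).toLp
      map_add' := fun w₁ w₂ => by
        rw [← MemLp.toLp_add]
        congr 1
        ext x
        simp [IccExtend, mul_add]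
      map_smul' := fun r w => by
        rw [RingHom.id_apply, ← MemLp.toLp_const_smul]
        congr 1
        ext x
        simp [IccExtend, mul_left_comm] }
    ‖hb.toLp‖ fun w => by
      rw [mul_comm]
      refine Lp.norm_le_mul_norm_of_ae_le_mul ?_
      filter_upwards [(memLp_mul_extend hL hb w).coeFn_toLp, hb.coeFn_toLp] with x h1 h2
      simp only [LinearMap.coe_mk, AddHom.coe_mk]
      rw [h1, h2, norm_mul, mul_comm]
      gcongr
      exact norm_IccExtend_le hL w x

theorem mulExtend_coe (hL : -L ≤ L) {b : ℝ → ℝ} (hb : MemLp b 2 volume) (w : C(Icc (-L) L, ℝ)) :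
    mulExtend hL hb w =ᵐ[volume] fun x => b x * IccExtend hL w x :=
  (memLp_mul_extend hL hb w).coeFn_toLp

/-- Extension by zero, from `C([-L, L])` to `L²(ℝ)`. -/
def extL2 (hL : -L ≤ L) : C(Icc (-L) L, ℝ) →L[ℝ] Lp ℝ 2 (volume : Measure ℝ) :=
  mulExtend hL (memLp_indicator_const 2 (measurableSet_Icc (a := -L) (b := L)) (1 : ℝ)
    (Or.inr measure_Icc_lt_top.ne))

theorem extL2_coe (hL : -L ≤ L) (w : C(Icc (-L) L, ℝ)) :
    extL2 hL w =ᵐ[volume] (Icc (-L) L).indicator (IccExtend hL w) := by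
  filter_upwards [mulExtend_coe hL (memLp_indicator_const 2 (measurableSet_Icc (a := -L) (b := L))
    (1 : ℝ) (Or.inr measure_Icc_lt_top.ne)) w] with x hx
  rw [extL2, hx]
  by_cases hm : x ∈ Icc (-L) L
  · simp [indicator_of_mem hm]
  · simp [indicator_of_notMem hm]

/-- The extension of `leftSol` to the line by decaying exponentials, as an element of `L²`. -/
def profile (hL : -L ≤ L) (p : L2Icc a × ℝ) : Lp ℝ 2 (volume : Measure ℝ) :=
  expTail (Iio (-L)) (fun x => -x - L) p.2 + extL2 hL (leftSol hL p) +
    leftSol hL p ⟨L, right_mem_Icc.2 hL⟩ • expTail (Ioi L) (fun x => x - L) p.2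

theorem differentiableAt_profile (hL : -L ≤ L) {p : L2Icc a × ℝ} (hp : 0 < p.2) :
    DifferentiableAt ℝ (profile hL) p := by
  have t1 := differentiableAt_expTail (S := Iio (-L)) measurableSet_Iio (g := fun x => -x - L)
    (by fun_prop) (fun x hx => by have : x < -L := hx; linarith)
    (fun κ hκ => memLp_expTail_left L hκ) hp
  have t2 := differentiableAt_expTail (S := Ioi L) measurableSet_Ioi (g := fun x => x - L)
    (by fun_prop) (fun x hx => by have : L < x := hx; linarith)
    (fun κ hκ => memLp_expTail_right L hκ) hp
  have t3 : DifferentiableAt ℝ (leftSol hL : L2Icc a × ℝ → _) p :=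
    (contDiff_leftSol (n := 1) hL).differentiable (by norm_num) p
  have t4 : DifferentiableAt ℝ (fun p : L2Icc a × ℝ => leftSol hL p ⟨L, right_mem_Icc.2 hL⟩) p :=
    (contDiff_eval (contDiff_leftSol (n := 1) hL) _).differentiable (by norm_num) p
  exact ((t1.comp p differentiableAt_snd).add ((extL2 hL).differentiableAt.comp p t3)).add
    (t4.smul (t2.comp p differentiableAt_snd))

/-- The two open tails and the closed interval partition the line, so exactly one of the three
summands contributes at each point. -/
theorem profile_coe (haL : a < L) (hL : -L ≤ L) {U : L2Icc a} {κ : ℝ} (hκ : 0 < κ)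
    {u v : ℝ → ℝ} (h : IsDecaying L U κ u v)
    (hu : ∀ x : Icc (-L) L, u x = leftSol hL (U, κ) x) : profile hL (U, κ) =ᵐ[volume] u := by
  set A := expTail (Iio (-L)) (fun x => -x - L) κ with hA
  set B := extL2 hL (leftSol hL (U, κ)) with hB
  set C := expTail (Ioi L) (fun x => x - L) κ with hC
  set r := leftSol hL (U, κ) ⟨L, right_mem_Icc.2 hL⟩ with hr
  have e0 : profile hL (U, κ) = A + B + r • C := rfl
  rw [e0]
  filter_upwards [Lp.coeFn_add (A + B) (r • C), Lp.coeFn_add A B, Lp.coeFn_smul r C,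
    expTail_coe (memLp_expTail_left L hκ), expTail_coe (memLp_expTail_right L hκ),
    extL2_coe hL (leftSol hL (U, κ))] with x e1 e2 e3 e4 e5 e6
  rw [e1, Pi.add_apply, e2, Pi.add_apply, e3, Pi.smul_apply, e4, e5, hB, e6]
  have uL : u L = r := hu ⟨L, right_mem_Icc.2 hL⟩
  have uL' : u (-L) = 1 := by rw [hu ⟨-L, left_mem_Icc.2 hL⟩, leftSol_left]
  rcases lt_or_ge x (-L) with hx | hx
  · rw [indicator_of_mem (show x ∈ Iio (-L) from hx), indicator_of_notMem (show x ∉ Icc (-L) L from fun hm => by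
      linarith [hm.1]), indicator_of_notMem (show x ∉ Ioi L from fun hm => by
        have := mem_Ioi.1 hm; linarith),
      (h.tail_left haL hκ hx.le).1, uL', smul_zero, add_zero, add_zero, one_mul]
    congr 1; ring
  · rcases le_or_gt x L with hx' | hx'
    · rw [indicator_of_notMem (show x ∉ Iio (-L) from fun hm => by
        have := mem_Iio.1 hm; linarith),
        indicator_of_mem (show x ∈ Icc (-L) L from ⟨hx, hx'⟩),
        indicator_of_notMem (show x ∉ Ioi L from fun hm => by
        have := mem_Ioi.1 hm; linarith), IccExtend_of_mem _ _ ⟨hx, hx'⟩,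
        hu ⟨x, hx, hx'⟩, smul_zero, add_zero, zero_add]
    · rw [indicator_of_notMem (show x ∉ Iio (-L) from fun hm => by
        have := mem_Iio.1 hm; linarith), indicator_of_notMem (show x ∉ Icc (-L) L from fun hm => by
        linarith [hm.2]), indicator_of_mem (show x ∈ Ioi L from hx'),
        (h.tail_right haL hκ hx'.le).1, uL, add_zero, zero_add, smul_eq_mul]

theorem norm_sq_eq_integral {f : Lp ℝ 2 (volume : Measure ℝ)} {u : ℝ → ℝ} (h : f =ᵐ[volume] u) :
    ‖f‖ ^ 2 = ∫ x, u x ^ 2 := by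
  rw [← real_inner_self_eq_norm_sq, L2.inner_def]
  refine integral_congr_ae ?_
  filter_upwards [h] with x hx
  rw [hx, real_inner_self_eq_norm_sq, Real.norm_eq_abs, sq_abs]

/-- A normalized decaying solution agrees with the ground state up to a sign. -/
theorem groundState_eq (haL : a < L) (hL : -L ≤ L) {U : L2Icc a} {κ : ℝ} (hκ : 0 < κ)
    (hE : groundEnergy (pot U) = -κ ^ 2) {u v : ℝ → ℝ} (h : IsDecaying L U κ u v)
    (hn : ∫ x, u x ^ 2 = 1) :
    IsBoundState (pot U) (groundEnergy (pot U)) (groundState (pot U)) ∧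
      ∃ s : ℝ, s ^ 2 = 1 ∧ groundState (pot U) = fun x => s * u x := by
  have hex : ∃ ψ : ℝ → ℝ, IsBoundState (pot U) (groundEnergy (pot U)) ψ := by
    rw [hE]; exact ⟨u, h.isBoundState haL hκ hn⟩
  have hgs : IsBoundState (pot U) (groundEnergy (pot U)) (groundState (pot U)) := by
    rw [groundState, dif_pos hex]; exact hex.choose_spec
  refine ⟨hgs, ?_⟩
  have hd := hgs.isDecaying haL (by rw [hE]; nlinarith)
  rw [hE, neg_neg, Real.sqrt_sq hκ.le] at hd
  have h0 : u (-L) ≠ 0 := fun h0 => by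
    rw [h.eq_zero_of_left haL hL hκ h0] at hn; simp at hn
  obtain ⟨r, hr⟩ := h.proportional haL hL hκ hd h0
  refine ⟨r, ?_, hr⟩
  have := hgs.normalized
  rw [hr] at this
  simp_rw [mul_pow] at this
  rwa [integral_const_mul, hn, mul_one] at this

/-- `φ`, `Ψ`, `w` is a differentiable branch at `V` of decay rates and normalized ground states;
`w` is the restriction to `[-L, L]`. -/
structure IsBranch (L : ℝ) (V : L2Icc a) (φ : L2Icc a → ℝ)
    (Ψ : L2Icc a → Lp ℝ 2 (volume : Measure ℝ)) (w : L2Icc a → C(Icc (-L) L, ℝ)) : Prop where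
  diff_rate : DifferentiableAt ℝ φ V
  diff_state : DifferentiableAt ℝ Ψ V
  diff_restrict : DifferentiableAt ℝ w V
  state_eq : Ψ V =ᵐ[volume] groundState (pot V)
  restrict_eq : ∀ x : Icc (-L) L, w V x = groundState (pot V) x
  eventually : ∀ᶠ U in 𝓝 V, 0 < φ U ∧ groundEnergy (pot U) = -φ U ^ 2 ∧
    ∃ ψ v : ℝ → ℝ, IsDecaying L U (φ U) ψ v ∧ ∫ x, ψ x ^ 2 = 1 ∧ Ψ U =ᵐ[volume] ψ ∧
      ∀ x : Icc (-L) L, ψ x = w U x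

/-- Smooth branch of ground states near `V`. -/
theorem exists_branch (haL : a < L) (hL0 : 0 < L) (hL : -L ≤ L) {V : L2Icc a}
    (hV : ∃! E : ℝ, IsNegEigenvalue (pot V) E) :
    ∃ (φ : L2Icc a → ℝ) (Ψ : L2Icc a → Lp ℝ 2 (volume : Measure ℝ))
      (w : L2Icc a → C(Icc (-L) L, ℝ)), IsBranch L V φ Ψ w := by
  obtain ⟨E, hE, huniq⟩ := hV
  have hE0 : E < 0 := hE.1
  set κ₀ := Real.sqrt (-E) with hκ₀
  have hκ : 0 < κ₀ := Real.sqrt_pos.2 (by linarith)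
  have hEκ : -κ₀ ^ 2 = E := by rw [hκ₀, Real.sq_sqrt (by linarith)]; ring
  have hs : shoot hL (V, κ₀) = 0 := by
    rw [← isNegEigenvalue_iff haL hL0 hL hκ, hEκ]; exact hE
  have hmax : ∀ κ, κ₀ < κ → shoot hL (V, κ) ≠ 0 := fun κ hlt h0 => by
    rw [← isNegEigenvalue_iff haL hL0 hL (hκ.trans hlt)] at h0
    have h1 : -κ ^ 2 = E := huniq _ h0
    nlinarith
  obtain ⟨φ, φ0, φd, hev⟩ := exists_shoot_zero hL hκ hs hmax
  have hφd : DifferentiableAt ℝ φ V := φd.differentiableAt (by norm_num)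
  have hp : DifferentiableAt ℝ (fun U => ((U, φ U) : L2Icc a × ℝ)) V :=
    differentiableAt_id.prodMk hφd
  have hP : DifferentiableAt ℝ (fun U => profile hL (U, φ U)) V :=
    DifferentiableAt.comp (f := fun U => ((U, φ U) : L2Icc a × ℝ)) V
      (differentiableAt_profile hL (by rw [φ0]; exact hκ)) hp
  have hw : DifferentiableAt ℝ (fun U => leftSol hL (U, φ U)) V :=
    DifferentiableAt.comp (g := (leftSol hL : L2Icc a × ℝ → _))
      (f := fun U => ((U, φ U) : L2Icc a × ℝ)) V
      ((contDiff_leftSol (n := 1) hL).differentiable (by norm_num) _) hp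
  -- normalization, for a fixed sign `s`
  have key : ∀ s : ℝ, s ^ 2 = 1 → ∀ U, 0 < φ U → shoot hL (U, φ U) = 0 →
      profile hL (U, φ U) ≠ 0 ∧ ∃ ψ v : ℝ → ℝ, IsDecaying L U (φ U) ψ v ∧ ∫ x, ψ x ^ 2 = 1 ∧
        ((s * ‖profile hL (U, φ U)‖⁻¹) • profile hL (U, φ U) : Lp ℝ 2 volume) =ᵐ[volume] ψ ∧
        ∀ x : Icc (-L) L, ψ x = s * ‖profile hL (U, φ U)‖⁻¹ * leftSol hL (U, φ U) x := by
    intro s hs2 U hpos hsU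
    obtain ⟨u, v, hd, hu⟩ := exists_isDecaying haL hL0 hL hsU
    have hcoe := profile_coe haL hL hpos hd hu
    have hnorm := norm_sq_eq_integral hcoe
    have h1 : u (-L) ≠ 0 := by
      rw [hu ⟨-L, left_mem_Icc.2 hL⟩, leftSol_left]; exact one_ne_zero
    have hint := hd.integral_sq_pos haL hpos h1
    have hne : ‖profile hL (U, φ U)‖ ≠ 0 := fun h0 => by
      rw [h0] at hnorm; norm_num at hnorm; linarith
    refine ⟨norm_ne_zero_iff.1 hne, _, _, hd.const_mul (s * ‖profile hL (U, φ U)‖⁻¹), ?_, ?_, ?_⟩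
    · simp_rw [mul_pow]
      rw [integral_const_mul, ← hnorm, hs2, one_mul, ← mul_pow, inv_mul_cancel₀ hne, one_pow]
    · filter_upwards [Lp.coeFn_smul (s * ‖profile hL (U, φ U)‖⁻¹) (profile hL (U, φ U)), hcoe]
        with x e1 e2
      rw [e1, Pi.smul_apply, e2, smul_eq_mul]
    · intro x
      rw [hu x]
  have hposV : 0 < φ V := by rw [φ0]; exact hκ
  have hsV : shoot hL (V, φ V) = 0 := by rw [φ0]; exact hs
  have hgV : groundEnergy (pot V) = -φ V ^ 2 :=
    groundEnergy_eq haL hL0 hL hposV hsV (by rw [φ0]; exact hmax)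
  -- The sign `s` is read off at `V`, where it matches the arbitrary choice made by `groundState`,
  -- and is then kept for all nearby `U` so that the branch is differentiable.
  obtain ⟨hne, ψ₁, v₁, d1, d2, d3, d4⟩ := key 1 (one_pow 2) V hposV hsV
  obtain ⟨-, s, hs2, hgs⟩ := groundState_eq haL hL hposV hgV d1 d2
  have hN : DifferentiableAt ℝ (fun U => s * ‖profile hL (U, φ U)‖⁻¹) V :=
    (differentiableAt_const s).mul ((hP.norm ℝ hne).inv (norm_ne_zero_iff.2 hne))
  refine ⟨φ, fun U => (s * ‖profile hL (U, φ U)‖⁻¹) • profile hL (U, φ U),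
    fun U => (s * ‖profile hL (U, φ U)‖⁻¹) • leftSol hL (U, φ U), hφd, hN.smul hP,
    hN.smul hw, ?_, ?_, ?_⟩
  · rw [hgs]
    filter_upwards [Lp.coeFn_smul (s * ‖profile hL (V, φ V)‖⁻¹) (profile hL (V, φ V)), d3,
      Lp.coeFn_smul (1 * ‖profile hL (V, φ V)‖⁻¹) (profile hL (V, φ V))] with x e1 e2 e3
    rw [e1, Pi.smul_apply, ← e2, e3, Pi.smul_apply, smul_eq_mul, smul_eq_mul]
    ring
  · intro x
    simp only [hgs, d4 x, ContinuousMap.smul_apply, smul_eq_mul]; ring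
  · filter_upwards [hev] with U hU
    obtain ⟨-, ψ, v, g1, g2, g3, g4⟩ := key s hs2 U hU.1 hU.2.1
    exact ⟨hU.1, groundEnergy_eq haL hL0 hL hU.1 hU.2.1 hU.2.2, ψ, v, g1, g2, g3, fun x => g4 x⟩

end FermiGoldenRule
end

/-! ### Distorted plane waves as solutions of a Robin problem; the equation for `A_±`. -/

noncomputable section

namespace FermiGoldenRule

variable {a L : ℝ}

theorem sign_sq (σ : ℤˣ) : (((σ : ℤ) : ℂ)) ^ 2 = 1 := by
  rcases Int.units_eq_one_or σ with h | h <;> simp [h]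

theorem hasDerivAt_planeWave (σ : ℤˣ) (k x : ℝ) :
    HasDerivAt (planeWave σ k) (((σ : ℤ) : ℂ) * Complex.I * k * planeWave σ k x) x := by
  simpa using! hasDerivAt_cexp_mul (((σ : ℤ) : ℂ) * Complex.I * k) 0 x

theorem continuous_planeWave (σ : ℤˣ) (k : ℝ) : Continuous (planeWave σ k) :=
  continuous_iff_continuousAt.2 fun x => (hasDerivAt_planeWave σ k x).continuousAt

theorem solOn_planeWave (σ : ℤˣ) (k : ℝ) :
    SolOn univ (fun _ => (-(Complex.I * k)) ^ 2) (fun _ => 0) (planeWave σ k)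
      (fun x => ((σ : ℤ) : ℂ) * Complex.I * k * planeWave σ k x) := by
  refine SolOn.of_hasDerivAt (hasDerivAt_planeWave σ k) (fun x => ?_) continuous_const
    continuous_const
  convert! (hasDerivAt_planeWave σ k x).const_mul (((σ : ℤ) : ℂ) * Complex.I * k) using 1
  linear_combination (-(Complex.I * k) ^ 2 * planeWave σ k x) * sign_sq σ

/-- The equation for `± i x e^{± i k x}`, the derivative of the plane wave in `k`. -/
theorem solOn_mul_planeWave (σ : ℤˣ) (k : ℝ) :
    SolOn univ (fun _ => (-(Complex.I * k)) ^ 2) (fun x => 2 * k * planeWave σ k x)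
      (fun x => ((σ : ℤ) : ℂ) * Complex.I * x * planeWave σ k x)
      (fun x => ((σ : ℤ) : ℂ) * Complex.I * planeWave σ k x +
        ((σ : ℤ) : ℂ) * Complex.I * x * (((σ : ℤ) : ℂ) * Complex.I * k * planeWave σ k x)) := by
  have hx : ∀ x : ℝ, HasDerivAt (fun x : ℝ => ((σ : ℤ) : ℂ) * Complex.I * x)
      (((σ : ℤ) : ℂ) * Complex.I) x := fun x => by
    simpa using (Complex.ofRealCLM.hasDerivAt (x := x)).const_mul (((σ : ℤ) : ℂ) * Complex.I)
  refine SolOn.of_hasDerivAt (fun x => (hx x).mul (hasDerivAt_planeWave σ k x)) (fun x => ?_)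
    continuous_const (continuous_const.mul (continuous_planeWave σ k))
  convert! ((hasDerivAt_planeWave σ k x).const_mul (((σ : ℤ) : ℂ) * Complex.I)).add
    ((hx x).mul ((hasDerivAt_planeWave σ k x).const_mul (((σ : ℤ) : ℂ) * Complex.I * k))) using 1
  have h1 := sign_sq σ
  have h2 := Complex.I_sq
  linear_combination (-2 * k * planeWave σ k x * Complex.I ^ 2 -
    ((σ : ℤ) : ℂ) * Complex.I ^ 3 * x * k ^ 2 * planeWave σ k x) * h1
      - 2 * k * planeWave σ k x * h2

theorem locallyIntegrable_pot_mul (U : L2Icc a) {w : ℝ → ℂ} (hw : Continuous w) :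
    LocallyIntegrable (fun y => (pot U y : ℂ) * w y) volume := by
  rw [← locallyIntegrableOn_univ]
  exact ((locallyIntegrable_ofReal (locallyIntegrable_pot U)).locallyIntegrableOn
    univ).mul_continuousOn hw.continuousOn isClosed_univ.isLocallyClosed

theorem pot_eq_zero_of_notMem (haL : a < L) (U : L2Icc a) {x : ℝ} (hx : x ∉ Icc (-L) L) :
    pot U x = 0 :=
  pot_eq_zero fun h => hx ⟨by linarith [h.1], by linarith [h.2]⟩

/-- `u`, with derivative `v`, solves `u'' = (U + κ²) u - f` on `[-L, L]` with the boundary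
conditions `u' (-L) - κ u (-L) = p` and `u' (L) + κ u (L) = r`. -/
structure IsRobin (L : ℝ) (U : L2Icc a) (κ : ℂ) (f : ℝ → ℂ) (p r : ℂ) (u v : ℝ → ℂ) : Prop where
  sol : SolOn (Icc (-L) L) (coef (pot U) κ) f u v
  left : v (-L) - κ * u (-L) = p
  right : v L + κ * u L = r

theorem IsOutgoing.isRobin {U : L2Icc a} {κ : ℂ} {f u v : ℝ → ℂ} (h : IsOutgoing L U κ f u v) :
    IsRobin L U κ f 0 0 u v :=
  ⟨h.sol.mono (subset_univ _), by rw [h.left]; ring, by rw [h.right]; ring⟩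

namespace IsRobin

variable {U : L2Icc a} {κ : ℂ} {f f₁ f₂ u v u₁ v₁ u₂ v₂ : ℝ → ℂ} {p r p₁ r₁ p₂ r₂ : ℂ}

theorem sub (h₁ : IsRobin L U κ f₁ p₁ r₁ u₁ v₁) (h₂ : IsRobin L U κ f₂ p₂ r₂ u₂ v₂)
    (hf₁ : LocallyIntegrable f₁ volume) (hf₂ : LocallyIntegrable f₂ volume) :
    IsRobin L U κ (fun x => f₁ x - f₂ x) (p₁ - p₂) (r₁ - r₂) (fun x => u₁ x - u₂ x)
      (fun x => v₁ x - v₂ x) :=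
  ⟨h₁.sol.sub h₂.sol (locallyIntegrable_coef (locallyIntegrable_pot U) κ) hf₁ hf₂,
    by rw [← h₁.left, ← h₂.left]; ring, by rw [← h₁.right, ← h₂.right]; ring⟩

theorem add (h₁ : IsRobin L U κ f₁ p₁ r₁ u₁ v₁) (h₂ : IsRobin L U κ f₂ p₂ r₂ u₂ v₂)
    (hf₁ : LocallyIntegrable f₁ volume) (hf₂ : LocallyIntegrable f₂ volume) :
    IsRobin L U κ (fun x => f₁ x + f₂ x) (p₁ + p₂) (r₁ + r₂) (fun x => u₁ x + u₂ x)
      (fun x => v₁ x + v₂ x) :=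
  ⟨h₁.sol.add h₂.sol (locallyIntegrable_coef (locallyIntegrable_pot U) κ) hf₁ hf₂,
    by rw [← h₁.left, ← h₂.left]; ring, by rw [← h₁.right, ← h₂.right]; ring⟩

theorem congr (h : IsRobin L U κ f₁ p₁ r₁ u v) (hf : ∀ x ∈ Icc (-L) L, f₂ x = f₁ x)
    (hp : p₁ = p₂) (hr : r₁ = r₂) : IsRobin L U κ f₂ p₂ r₂ u v :=
  ⟨h.sol.congr_coeff (Eventually.of_forall fun x hx => by rw [hf x hx]), h.left.trans hp,
    h.right.trans hr⟩

theorem const_mul (h : IsRobin L U κ f p r u v) (c : ℂ) :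
    IsRobin L U κ (fun x => c * f x) (c * p) (c * r) (fun x => c * u x) (fun x => c * v x) :=
  ⟨h.sol.const_mul c, by rw [← h.left]; ring, by rw [← h.right]; ring⟩

/-- `sineSol` has left data `1`, so subtracting `p` times it leaves a solution with zero left data,
a multiple of `leftSol`; the condition at `L` gives the multiple. The formula is explicit enough to
be differentiated in the potential and the frequency. -/
theorem eq_sineSol_add_leftSol (h : IsRobin L U κ (fun _ => 0) p r u v) (hL : -L ≤ L)
    (hs : shoot hL (U, κ) ≠ 0) (x : Icc (-L) L) :
    u x = p * sineSol hL (U, κ) x +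
      (r - p * bdry hL (U, κ) 1 (sineSol hL (U, κ))) / shoot hL (U, κ) * leftSol hL (U, κ) x := by
  obtain ⟨g1, g2, g3⟩ := solOn_ivpOp hL U κ (0 : ℂ) 1
  set w := ivpOp hL (U, κ) (affine (-L) L (0 : ℂ) 1) with hw
  set w' := slopeOf hL (coef (pot U) κ) (fun _ => 0) 1 w with hw'
  have hd : SolOn (Icc (-L) L) (coef (pot U) κ) (fun _ => 0)
      (fun t => u t - p * IccExtend hL w t) (fun t => v t - p * w' t) := by
    have := h.sol.sub (g1.const_mul p) (locallyIntegrable_coef (locallyIntegrable_pot U) κ)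
      (locallyIntegrable_const _) (by simpa using locallyIntegrable_const (0 : ℂ))
    simpa using this
  obtain ⟨e1, e2⟩ := SolOn.eq_leftSol hL hd (by
    simp only [g2, g3]; linear_combination h.left)
  have e3 : u x - p * w x = u (-L) * leftSol hL (U, κ) x := by
    have := congrArg (fun z : C(Icc (-L) L, ℂ) => z x) e1
    simpa only [restrictIcc_apply, ContinuousMap.smul_apply, smul_eq_mul, g2, mul_zero, sub_zero,
      IccExtend_val] using this
  have e4 : bdry hL (U, κ) 1 (sineSol hL (U, κ)) = w' L + κ * IccExtend hL w L := by
    rw [bdry, endSlope_eq, IccExtend_of_mem _ _ (right_mem_Icc.2 hL)]; rfl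
  have e5 : (r - p * bdry hL (U, κ) 1 (sineSol hL (U, κ))) / shoot hL (U, κ) = u (-L) := by
    rw [div_eq_iff hs, e4, ← h.right]
    simp only [g2, mul_zero, sub_zero] at e2
    rw [← e2]; ring
  rw [e5, ← e3, sineSol, ← hw]; ring

/-- Green's identity against an outgoing solution. -/
theorem integral_mul (h : IsRobin L U κ f p r u v) (hL : -L ≤ L) {b g g' : ℝ → ℂ}
    (hg : IsOutgoing L U κ b g g') (hf : LocallyIntegrable f volume)
    (hb : LocallyIntegrable b volume) :
    ∫ t in (-L)..L, b t * u t = (∫ t in (-L)..L, g t * f t) + g L * r - g (-L) * p := by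
  have hq := locallyIntegrable_coef (locallyIntegrable_pot U) κ
  have hgI := hg.sol.mono (subset_univ (Icc (-L) L))
  have := SolOn.lagrange hL hgI h.sol hq hb hq hf
  simp only [sub_self, zero_mul, zero_sub] at this
  have i1 : IntervalIntegrable (fun t => b t * u t) volume (-L) L :=
    (locallyIntegrable_intervalIntegrable hb).mul_continuousOn (by
      rw [uIcc_of_le hL]; exact h.sol.cont)
  have i2 : IntervalIntegrable (fun t => g t * f t) volume (-L) L :=
    (locallyIntegrable_intervalIntegrable hf).continuousOn_mul (by
      rw [uIcc_of_le hL]; exact hgI.cont)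
  have e : ∫ t in (-L)..L, (-(g t * f t) + u t * b t) =
      -(∫ t in (-L)..L, g t * f t) + ∫ t in (-L)..L, b t * u t := by
    have i3 : IntervalIntegrable (fun t => -(g t * f t)) volume (-L) L := i2.neg
    rw [← intervalIntegral.integral_neg, ← intervalIntegral.integral_add i3 i1]
    exact intervalIntegral.integral_congr fun t _ => by ring
  rw [e, hg.right, hg.left] at this
  rw [← h.right, ← h.left]
  linear_combination -this

/-- A solution for the potential `W` and `κ'`, as a solution for `U` and `κ`. -/
theorem change {W : L2Icc a} {κ' : ℂ} (h : IsRobin L W κ' (fun _ => 0) p r u v) :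
    IsRobin L U κ (fun x => -((pot W x : ℂ) - pot U x) * u x - (κ' ^ 2 - κ ^ 2) * u x)
      (p + (κ' - κ) * u (-L)) (r - (κ' - κ) * u L) u v := by
  refine ⟨h.sol.congr_coeff ?_, by linear_combination h.left, by linear_combination h.right⟩
  filter_upwards with x _
  simp only [coef, RCLike.ofReal_eq_complex_ofReal]
  ring

end IsRobin

/-- The incoming boundary data of the plane wave at `-L`. -/
def dataLeft (L : ℝ) (σ : ℤˣ) (k : ℝ) : ℂ :=
  (((σ : ℤ) : ℂ) + 1) * (Complex.I * k) * planeWave σ k (-L)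

/-- The incoming boundary data of the plane wave at `L`. -/
def dataRight (L : ℝ) (σ : ℤˣ) (k : ℝ) : ℂ :=
  (((σ : ℤ) : ℂ) - 1) * (Complex.I * k) * planeWave σ k L

theorem hasDerivAt_planeWave_freq (σ : ℤˣ) (k x : ℝ) :
    HasDerivAt (fun k => planeWave σ k x) (((σ : ℤ) : ℂ) * Complex.I * x * planeWave σ k x) k := by
  have := hasDerivAt_planeWave σ x k
  refine this.congr_of_eventuallyEq (Eventually.of_forall fun k => ?_) |>.congr_deriv ?_
  · simp only [planeWave]; congr 1; ring
  · simp only [planeWave]; congr 2; ring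

theorem contDiff_planeWave_freq (σ : ℤˣ) (x : ℝ) {n : WithTop ℕ∞} :
    ContDiff ℝ n fun k => planeWave σ k x := by
  unfold planeWave
  have : ContDiff ℝ n fun k : ℝ => (k : ℂ) := Complex.ofRealCLM.contDiff
  fun_prop

theorem hasDerivAt_dataLeft (L : ℝ) (σ : ℤˣ) (k : ℝ) :
    HasDerivAt (dataLeft L σ) ((((σ : ℤ) : ℂ) + 1) * (Complex.I + k * L) * planeWave σ k (-L))
      k := by
  have h1 : HasDerivAt (fun k : ℝ => (((σ : ℤ) : ℂ) + 1) * (Complex.I * k))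
      ((((σ : ℤ) : ℂ) + 1) * Complex.I) k := by
    simpa using ((Complex.ofRealCLM.hasDerivAt (x := k)).const_mul Complex.I).const_mul
      (((σ : ℤ) : ℂ) + 1)
  refine (h1.mul (hasDerivAt_planeWave_freq σ k (-L))).congr_deriv ?_
  push_cast
  linear_combination (-k * L * planeWave σ k (-L) * Complex.I ^ 2) * sign_sq σ -
    (((σ : ℤ) : ℂ) + 1) * k * L * planeWave σ k (-L) * Complex.I_sq

theorem hasDerivAt_dataRight (L : ℝ) (σ : ℤˣ) (k : ℝ) :
    HasDerivAt (dataRight L σ) ((((σ : ℤ) : ℂ) - 1) * (Complex.I + k * L) * planeWave σ k L)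
      k := by
  have h1 : HasDerivAt (fun k : ℝ => (((σ : ℤ) : ℂ) - 1) * (Complex.I * k))
      ((((σ : ℤ) : ℂ) - 1) * Complex.I) k := by
    simpa using ((Complex.ofRealCLM.hasDerivAt (x := k)).const_mul Complex.I).const_mul
      (((σ : ℤ) : ℂ) - 1)
  refine (h1.mul (hasDerivAt_planeWave_freq σ k L)).congr_deriv ?_
  linear_combination (k * L * planeWave σ k L * Complex.I ^ 2) * sign_sq σ -
    (((σ : ℤ) : ℂ) - 1) * k * L * planeWave σ k L * Complex.I_sq

/-- Adding `U u` to the coefficient is compensated in the source, so that free waves can be compared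
with outgoing solutions for `U`. -/
theorem SolOn.coef_of_free {U : L2Icc a} {κ : ℂ} {f u v : ℝ → ℂ}
    (h : SolOn univ (fun _ => κ ^ 2) f u v) :
    SolOn univ (coef (pot U) κ) (fun x => f x + pot U x * u x) u v := by
  refine h.congr_coeff (Eventually.of_forall fun x _ => ?_)
  simp only [coef, RCLike.ofReal_eq_complex_ofReal]
  ring

/-- The distorted plane waves solve the homogeneous equation with incoming plane wave data. -/
theorem distorted_solOn (haL : a < L) (hL0 : 0 < L) (U : L2Icc a) (σ : ℤˣ) {k : ℝ} (hk : k ≠ 0) :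
    ∃ v, SolOn univ (coef (pot U) (-(Complex.I * k))) (fun _ => 0) (distorted (pot U) σ k) v ∧
      IsRobin L U (-(Complex.I * k)) (fun _ => 0) (dataLeft L σ k) (dataRight L σ k)
        (distorted (pot U) σ k) v := by
  have hf := locallyIntegrable_pot_mul U (continuous_planeWave σ k)
  have ho := outResolvent_isOutgoing haL hL0 U hk hf fun x hx => by
    rw [pot_eq_zero_of_notMem haL U hx]; simp
  have hs := ((solOn_planeWave σ k).coef_of_free (U := U)).sub ho.sol
    (locallyIntegrable_coef (locallyIntegrable_pot U) _) (by simpa using hf) hf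
  simp only [zero_add, sub_self] at hs
  refine ⟨_, hs, hs.mono (subset_univ _), ?_, ?_⟩
  · rw [ho.left, dataLeft, distorted]; ring
  · rw [ho.right, dataRight, distorted]; ring

/-- The distorted plane wave on `[-L, L]`, as a function of the potential and the frequency. -/
def waveSol (hL : -L ≤ L) (σ : ℤˣ) (q : L2Icc a × ℝ) : C(Icc (-L) L, ℂ) :=
  dataLeft L σ q.2 • sineSol hL (q.1, -(Complex.I * q.2)) +
    ((dataRight L σ q.2 - dataLeft L σ q.2 *
      bdry hL (q.1, -(Complex.I * q.2)) 1 (sineSol hL (q.1, -(Complex.I * q.2)))) /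
        shoot hL (q.1, -(Complex.I * q.2))) • leftSol hL (q.1, -(Complex.I * q.2))

/-- This passes from the resolvent definition of the waves, a pointwise limit, to a formula that is
visibly differentiable. -/
theorem distorted_eq_waveSol (haL : a < L) (hL0 : 0 < L) (hL : -L ≤ L) (U : L2Icc a) (σ : ℤˣ)
    {k : ℝ} (hk : k ≠ 0) (x : Icc (-L) L) : distorted (pot U) σ k x = waveSol hL σ (U, k) x := by
  obtain ⟨v, -, h⟩ := distorted_solOn haL hL0 U σ hk
  exact h.eq_sineSol_add_leftSol hL (shoot_ne_zero_of_real hL U hk) x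

/-- All ingredients are smooth, and the denominator does not vanish at nonzero frequency because
there are no real resonances. -/
theorem differentiableAt_waveSol (hL : -L ≤ L) (σ : ℤˣ) {q : L2Icc a × ℝ} (hq : q.2 ≠ 0) :
    DifferentiableAt ℝ (waveSol hL σ) q := by
  have hm : ContDiff ℝ 1 fun q : L2Icc a × ℝ => ((q.1, -(Complex.I * q.2)) : L2Icc a × ℂ) := by
    have : ContDiff ℝ 1 fun q : L2Icc a × ℝ => (q.2 : ℂ) :=
      Complex.ofRealCLM.contDiff.comp contDiff_snd
    fun_prop
  have hR : ContDiff ℝ 1 fun q : L2Icc a × ℝ => (q.2 : ℂ) :=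
    Complex.ofRealCLM.contDiff.comp contDiff_snd
  have hl : ContDiff ℝ 1 fun q : L2Icc a × ℝ => dataLeft L σ q.2 :=
    (contDiff_const.mul (contDiff_const.mul hR)).mul
      ((contDiff_planeWave_freq σ (-L)).comp contDiff_snd)
  have hr : ContDiff ℝ 1 fun q : L2Icc a × ℝ => dataRight L σ q.2 :=
    (contDiff_const.mul (contDiff_const.mul hR)).mul
      ((contDiff_planeWave_freq σ L).comp contDiff_snd)
  have h1 : ContDiff ℝ 1 fun q : L2Icc a × ℝ => sineSol hL (q.1, -(Complex.I * (q.2 : ℂ))) :=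
    (contDiff_sineSol hL).comp hm
  have h2 : ContDiff ℝ 1 fun q : L2Icc a × ℝ => leftSol hL (q.1, -(Complex.I * (q.2 : ℂ))) :=
    (contDiff_leftSol hL).comp hm
  have h3 : ContDiff ℝ 1 fun q : L2Icc a × ℝ => shoot hL (q.1, -(Complex.I * (q.2 : ℂ))) :=
    (contDiff_shoot hL).comp hm
  have h4 : ContDiff ℝ 1 fun q : L2Icc a × ℝ => bdry hL (q.1, -(Complex.I * (q.2 : ℂ))) 1
      (sineSol hL (q.1, -(Complex.I * (q.2 : ℂ)))) :=
    ContDiff.comp (g := fun p : L2Icc a × ℂ => bdry hL p 1 (sineSol hL p))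
      (contDiff_bdry hL contDiff_const (contDiff_sineSol hL)) hm
  have hd : ∀ {F : Type _} [NormedAddCommGroup F] [NormedSpace ℝ F] {f : L2Icc a × ℝ → F},
      ContDiff ℝ 1 f → DifferentiableAt ℝ f q := fun h => h.differentiable (by norm_num) q
  have hi : DifferentiableAt ℝ
      (fun q : L2Icc a × ℝ => (shoot hL (q.1, -(Complex.I * (q.2 : ℂ))))⁻¹) q :=
    (hd h3).fun_inv (shoot_ne_zero_of_real hL q.1 hq)
  have := ((hd hl).smul (hd h1)).add ((((hd hr).sub ((hd hl).mul (hd h4))).mul hi).smul (hd h2))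
  exact this

/-- The boundary value problem solved by the auxiliary function `A_±`. -/
theorem auxA_isRobin (haL : a < L) (hL0 : 0 < L) (μ : ℝ) (V : L2Icc a) (σ : ℤˣ)
    (hk : resFreq μ (pot V) ≠ 0) :
    ∃ v, IsRobin L V (-(Complex.I * resFreq μ (pot V)))
      (fun x => 2 * resFreq μ (pot V) * resWave μ (pot V) σ x)
      ((((σ : ℤ) : ℂ) + 1) * (Complex.I + resFreq μ (pot V) * L) *
        planeWave σ (resFreq μ (pot V)) (-L) - Complex.I * resWave μ (pot V) σ (-L))
      ((((σ : ℤ) : ℂ) - 1) * (Complex.I + resFreq μ (pot V) * L) *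
        planeWave σ (resFreq μ (pot V)) L + Complex.I * resWave μ (pot V) σ L)
      (auxA L μ (pot V) σ) v := by
  set k := resFreq μ (pot V) with hkdef
  have hkC : (k : ℂ) ≠ 0 := Complex.ofReal_ne_zero.2 hk
  have hL : -L ≤ L := by linarith
  have ew : ∀ τ x, resWave μ (pot V) τ x = distorted (pot V) τ k x := fun _ _ => rfl
  have ep : ∀ τ x, resPhi μ (pot V) τ x = planeWave τ k x - distorted (pot V) τ k x :=
    fun _ _ => rfl
  obtain ⟨v₁, t₁, h₁⟩ := distorted_solOn haL hL0 V 1 hk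
  obtain ⟨v₂, t₂, h₂⟩ := distorted_solOn haL hL0 V (-1) hk
  obtain ⟨v₃, t₃, h₃⟩ := distorted_solOn haL hL0 V σ hk
  have hq := locallyIntegrable_coef (locallyIntegrable_pot V) (-(Complex.I * (k : ℂ)))
  have cphi : Continuous (resPhi μ (pot V) σ) :=
    (continuous_planeWave σ k).sub (continuousOn_univ.1 t₃.cont)
  have hx : Continuous fun y : ℝ => ((σ : ℤ) : ℂ) * Complex.I * y * planeWave σ k y :=
    (continuous_const.mul Complex.continuous_ofReal).mul (continuous_planeWave σ k)
  have hf1 : LocallyIntegrable (fun y => (Icc (-L) L).indicator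
      (fun y => 2 * (k : ℂ) * resPhi μ (pot V) σ y) y) volume :=
    (((continuous_const.mul cphi).continuousOn.integrableOn_compact
      isCompact_Icc).integrable_indicator measurableSet_Icc).locallyIntegrable
  have hf2 : LocallyIntegrable
      (fun y : ℝ => ((σ : ℤ) : ℂ) * Complex.I * y * pot V y * planeWave σ k y) volume := by
    refine (locallyIntegrable_pot_mul V hx).congr (Eventually.of_forall fun y => ?_)
    simp only; ring
  have hf12 : LocallyIntegrable (fun y => (Icc (-L) L).indicator
      (fun y => 2 * (k : ℂ) * resPhi μ (pot V) σ y) y +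
        ((σ : ℤ) : ℂ) * Complex.I * y * pot V y * planeWave σ k y) volume := hf1.add hf2
  have ho := outResolvent_isOutgoing haL hL0 V hk hf12 fun x hx => by
    rw [indicator_of_notMem hx, pot_eq_zero_of_notMem haL V hx]; simp
  have hm := (solOn_mul_planeWave σ k).coef_of_free (U := V)
  have hmf : LocallyIntegrable (fun x : ℝ => 2 * (k : ℂ) * planeWave σ k x +
      pot V x * (((σ : ℤ) : ℂ) * Complex.I * x * planeWave σ k x)) volume :=
    (continuous_const.mul (continuous_planeWave σ k)).locallyIntegrable.add
      (locallyIntegrable_pot_mul V hx)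
  have h0 : LocallyIntegrable (fun _ : ℝ => (0 : ℂ)) volume := locallyIntegrable_const _
  set c := Complex.exp (Complex.I * k * L) / (2 * k) with hc
  have hmR : IsRobin L V (-(Complex.I * k)) _ _ _ _ _ := ⟨hm.mono (subset_univ _), rfl, rfl⟩
  have e12 := (((h₁.const_mul (resPhi μ (pot V) σ (-L))).add
    (h₂.const_mul (resPhi μ (pot V) σ L)) (by simpa using h0) (by simpa using h0)).const_mul c)
  have hall := (hmR.sub ho.isRobin hmf hf12).add e12 (hmf.sub hf12)
    (by simpa using h0)
  have pw : planeWave 1 k (-L) * Complex.exp (Complex.I * k * L) = 1 := by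
    rw [planeWave, ← Complex.exp_add]
    simp
  have pw' : planeWave (-1) k L * Complex.exp (Complex.I * k * L) = 1 := by
    rw [planeWave, ← Complex.exp_add]
    simp
  -- Differentiating the outgoing conditions of `φ` in `k` produces the extra boundary terms
  -- `iφ(±L)`, which the truncated source `2kφ` on `[-L, L]` misses. The factor `c` is normalized so
  -- that `c e_+` has left data `i` and `c e_-` has right data `-i`, which supplies exactly these
  -- terms.
  have hc1 : c * dataLeft L 1 k = Complex.I := by
    rw [hc, dataLeft]; field_simp
    simp only [Units.val_one, Int.cast_one]
    linear_combination 2 * pw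
  have hc2 : c * dataRight L (-1) k = -Complex.I := by
    rw [hc, dataRight]; field_simp
    simp only [Units.val_neg, Units.val_one, Int.cast_neg, Int.cast_one]
    linear_combination -2 * pw'
  have eA : auxA L μ (pot V) σ = fun x : ℝ => ((σ : ℤ) : ℂ) * Complex.I * x * planeWave σ k x -
      outResolvent (pot V) k (fun y => (Icc (-L) L).indicator
        (fun y => 2 * (k : ℂ) * resPhi μ (pot V) σ y) y +
          ((σ : ℤ) : ℂ) * Complex.I * y * pot V y * planeWave σ k y) x +
      c * (resPhi μ (pot V) σ (-L) * distorted (pot V) 1 k x +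
        resPhi μ (pot V) σ L * distorted (pot V) (-1) k x) := rfl
  rw [eA]
  refine ⟨_, hall.congr (fun x hx => ?_) ?_ ?_⟩
  · simp only [indicator_of_mem hx, ep, ew, mul_zero, add_zero]
    ring
  · have e1 : dataLeft L (-1) k = 0 := by simp [dataLeft]
    rw [e1]
    simp only [ep, ew]
    push_cast
    linear_combination (planeWave σ k (-L) - distorted (pot V) σ k (-L)) * hc1 -
      ((((σ : ℤ) : ℂ) + 1) * (planeWave σ k (-L) * L * k)) * Complex.I_sq -
      (planeWave σ k (-L) * L * k * Complex.I ^ 2) * sign_sq σ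
  · have e1 : dataRight L 1 k = 0 := by simp [dataRight]
    rw [e1]
    simp only [ep, ew]
    linear_combination (planeWave σ k L - distorted (pot V) σ k L) * hc2 +
      ((1 - ((σ : ℤ) : ℂ)) * (planeWave σ k L * L * k)) * Complex.I_sq +
      (planeWave σ k L * L * k * Complex.I ^ 2) * sign_sq σ

end FermiGoldenRule
end

/-! ### First variation of the distorted plane waves. -/

noncomputable section

namespace FermiGoldenRule

variable {a L : ℝ}

/-- The first order perturbation identity for distorted plane waves, in integrated form. -/
theorem integral_distorted_sub (haL : a < L) (hL0 : 0 < L) (hL : -L ≤ L) (σ : ℤˣ) {U V : L2Icc a}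
    {k k₁ : ℝ} (hk : k ≠ 0) (hk₁ : k₁ ≠ 0) {h g g' : ℝ → ℂ} (hh : LocallyIntegrable h volume)
    (hg : IsOutgoing L V (-(Complex.I * k)) h g g') (G : C(Icc (-L) L, ℂ))
    (hG : ∀ x : Icc (-L) L, G x = g x) :
    primMul hL h hh (waveSol hL σ (U, k₁)) ⟨L, right_mem_Icc.2 hL⟩ -
        primMul hL h hh (waveSol hL σ (V, k)) ⟨L, right_mem_Icc.2 hL⟩ =
      -potMul ℂ a hL (U - V) (G * waveSol hL σ (U, k₁)) ⟨L, right_mem_Icc.2 hL⟩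
      - ((-(Complex.I * k₁)) ^ 2 - (-(Complex.I * k)) ^ 2) *
          prim ℂ hL (G * waveSol hL σ (U, k₁)) ⟨L, right_mem_Icc.2 hL⟩
      + g L * (dataRight L σ k₁ + Complex.I * (k₁ - k) *
          waveSol hL σ (U, k₁) ⟨L, right_mem_Icc.2 hL⟩ - dataRight L σ k)
      - g (-L) * (dataLeft L σ k₁ - Complex.I * (k₁ - k) *
          waveSol hL σ (U, k₁) ⟨-L, left_mem_Icc.2 hL⟩ - dataLeft L σ k) := by
  obtain ⟨v₁, t₁, h₁⟩ := distorted_solOn haL hL0 U σ hk₁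
  obtain ⟨v, t, h₀⟩ := distorted_solOn haL hL0 V σ hk
  have e₁ := distorted_eq_waveSol haL hL0 hL U σ hk₁
  have e₀ := distorted_eq_waveSol haL hL0 hL V σ hk
  set d₁ := distorted (pot U) σ k₁
  set d := distorted (pot V) σ k
  set w₁ := waveSol hL σ (U, k₁)
  set w := waveSol hL σ (V, k)
  have cd₁ : Continuous d₁ := continuousOn_univ.1 t₁.cont
  have h0 : LocallyIntegrable (fun _ : ℝ => (0 : ℂ)) volume := locallyIntegrable_const _
  have hf : LocallyIntegrable (fun x => -((pot U x : ℂ) - pot V x) * d₁ x -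
      ((-(Complex.I * k₁)) ^ 2 - (-(Complex.I * k)) ^ 2) * d₁ x) volume := by
    refine (((locallyIntegrable_pot_mul V cd₁).sub (locallyIntegrable_pot_mul U cd₁)).sub
      ((continuous_const (y := (-(Complex.I * (k₁ : ℂ))) ^ 2 - (-(Complex.I * k)) ^ 2)).mul
        cd₁).locallyIntegrable).congr (Eventually.of_forall fun x => ?_)
    simp only [Pi.sub_apply, Pi.mul_apply]; ring
  -- The wave for `(U, k₁)` is viewed as a solution for `(V, k)` with the perturbation as source,
  -- and Green's identity tests the difference of the two waves against `g`. The identity is exact,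
  -- with no smallness of `U - V`.
  have key := ((h₁.change (U := V) (κ := -(Complex.I * k))).sub h₀ hf h0).integral_mul hL hg
    (by simpa using hf) hh
  have x₁ : ∀ t ∈ uIcc (-L) L, d₁ t = IccExtend hL w₁ t := fun t ht => by
    rw [uIcc_of_le hL] at ht; rw [IccExtend_of_mem _ _ ht]; exact e₁ ⟨t, ht⟩
  have x₀ : ∀ t ∈ uIcc (-L) L, d t = IccExtend hL w t := fun t ht => by
    rw [uIcc_of_le hL] at ht; rw [IccExtend_of_mem _ _ ht]; exact e₀ ⟨t, ht⟩
  have xG : ∀ t ∈ uIcc (-L) L, g t * d₁ t = IccExtend hL (G * w₁) t := fun t ht => by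
    rw [uIcc_of_le hL] at ht
    rw [IccExtend_of_mem _ _ ht, ContinuousMap.mul_apply, hG ⟨t, ht⟩, ← e₁ ⟨t, ht⟩]
  have E1 : ∫ t in (-L)..L, h t * (d₁ t - d t) =
      primMul hL h hh w₁ ⟨L, right_mem_Icc.2 hL⟩ - primMul hL h hh w ⟨L, right_mem_Icc.2 hL⟩ := by
    rw [primMul_apply, primMul_apply, ← intervalIntegral.integral_sub
      (locallyIntegrable_intervalIntegrable (locallyIntegrable_mul_extend hL hh w₁))
      (locallyIntegrable_intervalIntegrable (locallyIntegrable_mul_extend hL hh w))]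
    exact intervalIntegral.integral_congr fun t ht => by
      simp only [x₁ t ht, x₀ t ht]; ring
  have E2 : ∫ t in (-L)..L, g t * (-((pot U t : ℂ) - pot V t) * d₁ t -
      ((-(Complex.I * k₁)) ^ 2 - (-(Complex.I * k)) ^ 2) * d₁ t - 0) =
      -potMul ℂ a hL (U - V) (G * w₁) ⟨L, right_mem_Icc.2 hL⟩
      - ((-(Complex.I * k₁)) ^ 2 - (-(Complex.I * k)) ^ 2) *
          prim ℂ hL (G * w₁) ⟨L, right_mem_Icc.2 hL⟩ := by
    rw [map_sub, sub_apply, ContinuousMap.sub_apply, potMul_apply, potMul_apply, prim_apply,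
      ← intervalIntegral.integral_const_mul]
    have i1 := locallyIntegrable_intervalIntegrable (x := -L) (y := L) (locallyIntegrable_mul_extend
      hL (locallyIntegrable_ofReal (𝕜 := ℂ) (locallyIntegrable_pot U)) (G * w₁))
    have i2 := locallyIntegrable_intervalIntegrable (x := -L) (y := L) (locallyIntegrable_mul_extend
      hL (locallyIntegrable_ofReal (𝕜 := ℂ) (locallyIntegrable_pot V)) (G * w₁))
    have i3 : IntervalIntegrable (fun t => ((-(Complex.I * k₁)) ^ 2 - (-(Complex.I * k)) ^ 2) *
        IccExtend hL (G * w₁) t) volume (-L) L :=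
      (continuous_const.mul (continuous_extend hL (G * w₁))).intervalIntegrable _ _
    have i4 : IntervalIntegrable (fun t => -(((pot U t : ℝ) : ℂ) * IccExtend hL (G * w₁) t -
        ((pot V t : ℝ) : ℂ) * IccExtend hL (G * w₁) t)) volume (-L) L := (i1.sub i2).neg
    rw [← intervalIntegral.integral_sub i1 i2, ← intervalIntegral.integral_neg]
    refine Eq.trans ?_ (intervalIntegral.integral_sub i4 i3)
    refine intervalIntegral.integral_congr fun t ht => ?_
    simp only [← xG t ht, RCLike.ofReal_eq_complex_ofReal]
    ring
  rw [E1, E2, e₁ ⟨L, right_mem_Icc.2 hL⟩, e₁ ⟨-L, left_mem_Icc.2 hL⟩] at key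
  linear_combination key

/-- The derivative of the distorted plane waves, tested against `h`. -/
theorem integral_fderiv_waveSol (haL : a < L) (hL0 : 0 < L) (hL : -L ≤ L) (σ : ℤˣ) (μ : ℝ)
    {V : L2Icc a} (hk : resFreq μ (pot V) ≠ 0) {K : L2Icc a → ℝ} {K' : L2Icc a →L[ℝ] ℝ}
    (hKV : K V = resFreq μ (pot V)) (hK : HasFDerivAt K K' V)
    {De : L2Icc a →L[ℝ] C(Icc (-L) L, ℂ)}
    (hDe : HasFDerivAt (fun U => waveSol hL σ (U, K U)) De V) {h : ℝ → ℂ}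
    (hh : LocallyIntegrable h volume) (hh0 : ∀ x, x ∉ Icc (-L) L → h x = 0) (δ : L2Icc a) :
    ∫ t in (-L)..L, h t * IccExtend hL (De δ) t =
      -(∫ t in (-L)..L, (pot δ t : ℂ) *
        (outResolvent (pot V) (resFreq μ (pot V)) h t * resWave μ (pot V) σ t)) +
      K' δ * ∫ t in (-L)..L, h t * auxA L μ (pot V) σ t := by
  set k := resFreq μ (pot V) with hkdef
  have hg := outResolvent_isOutgoing haL hL0 V hk hh hh0
  set g := outResolvent (pot V) k h
  have cg : ContinuousOn g (Icc (-L) L) := hg.sol.cont.mono (subset_univ _)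
  set G := restrictIcc g cg
  have mR : L ∈ Icc (-L) L := right_mem_Icc.2 hL
  have mL : -L ∈ Icc (-L) L := left_mem_Icc.2 hL
  -- restriction to the line `V + t δ`
  have hc : HasDerivAt (fun t : ℝ => V + t • δ) δ 0 := by
    simpa using ((hasDerivAt_id (0 : ℝ)).smul_const δ).const_add V
  have hV0 : V + (0 : ℝ) • δ = V := by simp
  have hKt : HasDerivAt (fun t : ℝ => K (V + t • δ)) (K' δ) 0 :=
    HasFDerivAt.comp_hasDerivAt (f := fun t : ℝ => V + t • δ) 0 (by rw [hV0]; exact hK) hc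
  set e : ℝ → C(Icc (-L) L, ℂ) := fun t => waveSol hL σ (V + t • δ, K (V + t • δ)) with he
  have het : HasDerivAt e (De δ) 0 :=
    HasFDerivAt.comp_hasDerivAt (l := fun U => waveSol hL σ (U, K U))
      (f := fun t : ℝ => V + t • δ) 0 (by rw [hV0]; exact hDe) hc
  have he0 : e 0 = waveSol hL σ (V, k) := by simp only [he, hV0, hKV]
  have hCLM : ∀ T : C(Icc (-L) L, ℂ) →L[ℝ] ℂ, HasDerivAt (fun t => T (e t)) (T (De δ)) 0 :=
    fun T => T.hasFDerivAt.comp_hasDerivAt 0 het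
  have hKc := hKt.ofReal_comp
  have hK0 : K (V + (0 : ℝ) • δ) = k := by rw [hV0, hKV]
  set evR : C(Icc (-L) L, ℂ) →L[ℝ] ℂ := ContinuousMap.evalCLM ℝ ⟨L, mR⟩
  set evL : C(Icc (-L) L, ℂ) →L[ℝ] ℂ := ContinuousMap.evalCLM ℝ ⟨-L, mL⟩
  set mG := ContinuousLinearMap.mul ℝ C(Icc (-L) L, ℂ) G
  set J := evR ∘L primMul hL h hh
  set M := evR ∘L (potMul ℂ a hL δ) ∘L mG
  set N := evR ∘L (prim ℂ hL) ∘L mG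
  have d1 : HasDerivAt (fun t => J (e t) - J (e 0)) (J (De δ)) 0 := (hCLM J).sub_const _
  have dp : HasDerivAt (fun t : ℝ => dataLeft L σ (K (V + t • δ))) _ 0 :=
    HasDerivAt.scomp (g₁ := dataLeft L σ) (h := fun t : ℝ => K (V + t • δ)) 0
      (by rw [hK0]; exact hasDerivAt_dataLeft L σ k) hKt
  have dr : HasDerivAt (fun t : ℝ => dataRight L σ (K (V + t • δ))) _ 0 :=
    HasDerivAt.scomp (g₁ := dataRight L σ) (h := fun t : ℝ => K (V + t • δ)) 0
      (by rw [hK0]; exact hasDerivAt_dataRight L σ k) hKt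
  -- Derivative at `t = 0` of the right side of the exact identity along `V + t δ`. Factors that
  -- vanish at `t = 0` leave only the unperturbed wave in the limit.
  have d2 := ((((hasDerivAt_id (0 : ℝ)).ofReal_comp.mul (hCLM M)).neg.sub
    ((((hKc.const_mul Complex.I).neg.pow 2).sub_const ((-(Complex.I * k)) ^ 2)).mul
      (hCLM N))).add
    (((dr.add (((hKc.sub_const (k : ℂ)).const_mul Complex.I).mul (hCLM evR))).sub_const
      (dataRight L σ k)).const_mul (g L))).sub
    (((dp.sub (((hKc.sub_const (k : ℂ)).const_mul Complex.I).mul (hCLM evL))).sub_const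
      (dataLeft L σ k)).const_mul (g (-L)))
  have hev : ∀ᶠ t : ℝ in 𝓝 0, K (V + t • δ) ≠ 0 :=
    hKt.continuousAt.eventually_ne (by rw [hK0]; exact hk)
  have hfin := (d1.congr_of_eventuallyEq (f₁ := _) ?_).unique d2
  rotate_left
  · filter_upwards [hev] with t ht
    have := integral_distorted_sub haL hL0 hL σ (U := V + t • δ) hk ht hh hg G fun x => rfl
    rw [add_sub_cancel_left, map_smul] at this
    rw [he0]
    refine Eq.trans ?_ this.symm
    simp only [Pi.add_apply, Pi.sub_apply, Pi.neg_apply, Pi.mul_apply, Pi.pow_apply, id]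
    rfl
  -- The terms proportional to `K' δ` are those of Green's identity for `A_±` against the same `g`:
  -- its source `2k e_±` and boundary data are the `k`-derivatives just found.
  obtain ⟨v, hA⟩ := auxA_isRobin haL hL0 μ V σ hk
  rw [← hkdef] at hA
  obtain ⟨v', t', h'⟩ := distorted_solOn haL hL0 V σ hk
  have cw : Continuous (resWave μ (pot V) σ) := continuousOn_univ.1 t'.cont
  have hAi := hA.integral_mul hL hg (continuous_const.mul cw).locallyIntegrable hh
  have ew := distorted_eq_waveSol haL hL0 hL V σ hk
  have xw : ∀ t ∈ uIcc (-L) L, IccExtend hL (G * e 0) t = g t * resWave μ (pot V) σ t :=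
    fun t ht => by
      rw [uIcc_of_le hL] at ht
      rw [IccExtend_of_mem _ _ ht, ContinuousMap.mul_apply, he0, ← ew ⟨t, ht⟩]; rfl
  have eM : M (e 0) = ∫ t in (-L)..L, (pot δ t : ℂ) * (g t * resWave μ (pot V) σ t) := by
    change potMul ℂ a hL δ (G * e 0) ⟨L, mR⟩ = _
    rw [potMul_apply]
    exact intervalIntegral.integral_congr fun t ht => by simp only [xw t ht]; rfl
  have eN : ∫ t in (-L)..L, g t * (2 * k * resWave μ (pot V) σ t) = 2 * k * N (e 0) := by
    change _ = 2 * k * prim ℂ hL (G * e 0) ⟨L, mR⟩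
    rw [prim_apply, ← intervalIntegral.integral_const_mul]
    exact intervalIntegral.integral_congr fun t ht => by simp only [xw t ht]; ring
  have eR : evR (e 0) = resWave μ (pot V) σ L := by rw [he0]; exact (ew ⟨L, mR⟩).symm
  have eL : evL (e 0) = resWave μ (pot V) σ (-L) := by rw [he0]; exact (ew ⟨-L, mL⟩).symm
  change J (De δ) = _
  rw [hfin, hAi, eN, ← eM, ← eR, ← eL, hK0]
  simp only [Pi.neg_apply, Pi.pow_apply, hK0, id, Complex.real_smul, Complex.ofReal_zero, Complex.ofReal_one]
  linear_combination (-2 * k * K' δ * N (e 0)) * Complex.I_sq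

end FermiGoldenRule
end

/-! ### The reduced resolvent at the bound state energy. -/

noncomputable section

namespace FermiGoldenRule

variable {a L : ℝ}

theorem tendsto_affine_mul_exp (A s : ℝ) {κ : ℝ} (hκ : 0 < κ) :
    Tendsto (fun y : ℝ => (A + s * y) * Real.exp (-κ * y)) atTop (𝓝 0) := by
  have h0 : Tendsto (fun y : ℝ => κ * y) atTop atTop := tendsto_id.const_mul_atTop hκ
  have h1 := (Real.tendsto_pow_mul_exp_neg_atTop_nhds_zero 1).comp h0
  have h2 := (Real.tendsto_pow_mul_exp_neg_atTop_nhds_zero 0).comp h0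
  have := (h2.const_mul A).add (h1.const_mul (s / κ))
  simp only [mul_zero, add_zero] at this
  refine this.congr fun y => ?_
  simp only [Function.comp_apply, pow_zero, pow_one, one_mul, neg_mul]
  field_simp

theorem abs_affine_mul_exp_le (A s : ℝ) {κ y : ℝ} (hκ : 0 < κ) (hy : 0 ≤ y) :
    |(A + s * y) * Real.exp (-κ * y)| ≤ (|A| + |s| * (2 / κ)) * Real.exp (-(κ / 2) * y) := by
  have h1 : y ≤ 2 / κ * Real.exp (κ / 2 * y) := by
    have := Real.add_one_le_exp (κ / 2 * y)
    calc y = 2 / κ * (κ / 2 * y) := by field_simp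
      _ ≤ _ := by gcongr; linarith
  have h2 : 1 ≤ Real.exp (κ / 2 * y) := Real.one_le_exp (by positivity)
  have h3 : |A + s * y| ≤ (|A| + |s| * (2 / κ)) * Real.exp (κ / 2 * y) := by
    calc |A + s * y| ≤ |A| + |s| * y := by
          refine (abs_add_le _ _).trans ?_
          rw [abs_mul, abs_of_nonneg hy]
      _ ≤ |A| * Real.exp (κ / 2 * y) + |s| * (2 / κ * Real.exp (κ / 2 * y)) := by
          gcongr
          exact le_mul_of_one_le_right (abs_nonneg _) h2
      _ = _ := by ring
  rw [abs_mul, Real.abs_exp]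
  calc _ ≤ (|A| + |s| * (2 / κ)) * Real.exp (κ / 2 * y) * Real.exp (-κ * y) := by gcongr
    _ = _ := by rw [mul_assoc, ← Real.exp_add]; congr 2; ring

/-- A source proportional to `e^{-κx}` is itself a homogeneous solution, hence the linear factor in
the particular solution. Such sources arise on the tails from the projection onto the bound state.
-/
theorem solOn_affine_exp (κ A s c : ℝ) : SolOn univ (fun _ => κ ^ 2)
    (fun x => 2 * κ * s * Real.exp (-κ * (x - c)))
    (fun x => (A + s * (x - c)) * Real.exp (-κ * (x - c)))
    (fun x => (s - κ * A + -κ * s * (x - c)) * Real.exp (-κ * (x - c))) := by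
  have k : ∀ A s x : ℝ, HasDerivAt (fun x : ℝ => (A + s * (x - c)) * Real.exp (-κ * (x - c)))
      ((s - κ * A + -κ * s * (x - c)) * Real.exp (-κ * (x - c))) x := fun A s x => by
    have h0 : HasDerivAt (fun x : ℝ => x - c) 1 x := (hasDerivAt_id x).sub_const c
    convert! ((h0.const_mul s).const_add A).mul (h0.const_mul (-κ)).exp using 1
    ring
  refine SolOn.of_hasDerivAt (k A s) (fun x => ?_) continuous_const (by fun_prop)
  convert! k (s - κ * A) (-κ * s) x using 1
  ring

/-- Lagrange's identity on the line. -/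
theorem SolOn.integral_lagrange_eq_zero {q₁ q₂ f₁ f₂ u₁ v₁ u₂ v₂ : ℝ → ℝ}
    (h₁ : SolOn univ q₁ f₁ u₁ v₁) (h₂ : SolOn univ q₂ f₂ u₂ v₂)
    (hq₁ : LocallyIntegrable q₁ volume) (hf₁ : LocallyIntegrable f₁ volume)
    (hq₂ : LocallyIntegrable q₂ volume) (hf₂ : LocallyIntegrable f₂ volume)
    (hu₁ : Tendsto u₁ (cocompact ℝ) (𝓝 0)) (hv₁ : Tendsto v₁ (cocompact ℝ) (𝓝 0))
    (hu₂ : Tendsto u₂ (cocompact ℝ) (𝓝 0)) (hv₂ : Tendsto v₂ (cocompact ℝ) (𝓝 0))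
    (hi : Integrable (fun t => (q₂ t - q₁ t) * u₁ t * u₂ t - u₁ t * f₂ t + u₂ t * f₁ t) volume) :
    ∫ t, ((q₂ t - q₁ t) * u₁ t * u₂ t - u₁ t * f₂ t + u₂ t * f₁ t) = 0 := by
  have hW : Tendsto (fun x => u₁ x * v₂ x - v₁ x * u₂ x) (cocompact ℝ) (𝓝 0) := by
    simpa using (hu₁.mul hv₂).sub (hv₁.mul hu₂)
  rw [cocompact_eq_atBot_atTop, tendsto_sup] at hW
  have h3 := intervalIntegral_tendsto_integral hi tendsto_neg_atTop_atBot tendsto_id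
  have h4 := hW.2.sub (hW.1.comp tendsto_neg_atTop_atBot)
  rw [sub_zero] at h4
  refine tendsto_nhds_unique h3 (h4.congr' ?_)
  filter_upwards [eventually_ge_atTop 0] with M hM
  exact SolOn.lagrange (c := -M) (d := M) (by linarith) (h₁.mono (subset_univ _))
    (h₂.mono (subset_univ _)) hq₁ hf₁ hq₂ hf₂

theorem tendsto_cocompact_of_tails {u : ℝ → ℝ} {κ A s A' s' : ℝ} (hκ : 0 < κ)
    (hr : ∀ x, L ≤ x → u x = (A + s * (x - L)) * Real.exp (-κ * (x - L)))
    (hl : ∀ x, x ≤ -L → u x = (A' + s' * (-x - L)) * Real.exp (-κ * (-x - L))) :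
    Tendsto u (cocompact ℝ) (𝓝 0) := by
  have hsub : Tendsto (fun x : ℝ => x - L) atTop atTop := tendsto_atTop_add_const_right _ _ tendsto_id
  rw [cocompact_eq_atBot_atTop, tendsto_sup]
  constructor
  · refine ((tendsto_affine_mul_exp A' s' hκ).comp (hsub.comp tendsto_neg_atBot_atTop)).congr' ?_
    filter_upwards [eventually_le_atBot (-L)] with x hx using (hl x hx).symm
  · refine ((tendsto_affine_mul_exp A s hκ).comp hsub).congr' ?_
    filter_upwards [eventually_ge_atTop L] with x hx using (hr x hx).symm

theorem memLp_of_tails {u : ℝ → ℝ} {κ A s A' s' : ℝ} (hκ : 0 < κ) (hu : Continuous u)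
    (hr : ∀ x, L ≤ x → u x = (A + s * (x - L)) * Real.exp (-κ * (x - L)))
    (hl : ∀ x, x ≤ -L → u x = (A' + s' * (-x - L)) * Real.exp (-κ * (-x - L))) :
    MemLp u 2 volume := by
  have k : ∀ A s x : ℝ, L ≤ x → |(A + s * (x - L)) * Real.exp (-κ * (x - L))| ≤
      (|A| + |s| * (2 / κ)) * Real.exp (κ / 2 * L) * |Real.exp (-(κ / 2) * x)| := by
    intro A s x hx
    refine (abs_affine_mul_exp_le A s hκ (sub_nonneg.2 hx)).trans (le_of_eq ?_)
    rw [Real.abs_exp, mul_assoc, ← Real.exp_add]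
    congr 2; ring
  refine memLp_two_of_exp_decay hu (half_pos hκ)
    (Asymptotics.IsBigO.of_bound ((|A| + |s| * (2 / κ)) * Real.exp (κ / 2 * L)) ?_)
    (Asymptotics.IsBigO.of_bound ((|A'| + |s'| * (2 / κ)) * Real.exp (κ / 2 * L)) ?_)
  · filter_upwards [eventually_ge_atTop L] with x hx
    rw [norm_norm, hr x hx]
    exact k A s x hx
  · filter_upwards [eventually_ge_atTop L] with x hx
    rw [norm_norm, hl (-x) (neg_le_neg hx), neg_neg]
    exact k A' s' x hx

namespace IsDecaying

variable {U V : L2Icc a} {κ : ℝ} {u v ψ ψ' : ℝ → ℝ}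

theorem tendsto_zero (h : IsDecaying L U κ u v) (haL : a < L) (hκ : 0 < κ) :
    Tendsto u (cocompact ℝ) (𝓝 0) ∧ Tendsto v (cocompact ℝ) (𝓝 0) := by
  constructor
  · refine tendsto_cocompact_of_tails (L := L) (A := u L) (s := 0) (A' := u (-L)) (s' := 0) hκ
      (fun x hx => ?_) (fun x hx => ?_)
    · rw [(h.tail_right haL hκ hx).1]; ring_nf
    · rw [(h.tail_left haL hκ hx).1]; ring_nf
  · refine tendsto_cocompact_of_tails (L := L) (A := -κ * u L) (s := 0) (A' := κ * u (-L)) (s' := 0) hκ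
      (fun x hx => ?_) (fun x hx => ?_)
    · rw [(h.tail_right haL hκ hx).2, (h.tail_right haL hκ hx).1]; ring_nf
    · rw [(h.tail_left haL hκ hx).2, (h.tail_left haL hκ hx).1]; ring_nf

theorem of_memLp (haL : a < L) (hκ : 0 < κ) (hs : SolOn univ (coef (pot U) κ) (fun _ => 0) u v)
    (hm : MemLp u 2 volume) : IsDecaying L U κ u v := by
  have hc := hs.ofReal
  rw [coef_ofReal] at hc
  have hm : MemLp (fun x => (u x : ℂ)) 2 volume := hm.ofReal
  have e1 := (SolOn.free_right haL hc (by simp)).memLp_right (by simpa using hκ) hm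
  have e2 := (SolOn.free_left haL hc (by simp)).memLp_left (by simpa using hκ) hm
  exact ⟨hs, by exact_mod_cast e1, by exact_mod_cast e2⟩

/-- If `ψ (L) = 0`, the decay condition makes all Cauchy data at `L` vanish; reflection turns this
into an initial value problem and forces `ψ (-L) = 0`. -/
theorem ne_zero_right (h : IsDecaying L V κ ψ ψ') (hL : -L ≤ L) (h0 : ψ (-L) ≠ 0) : ψ L ≠ 0 := by
  intro hR
  have hq : LocallyIntegrable (fun t => coef (pot V) κ (-t)) volume := by
    have := (integrable_pot V).comp_neg
    exact this.locallyIntegrable.add (locallyIntegrable_const _)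
  have hr := h.sol.reflect
  simp only [neg_univ] at hr
  have hz : SolOn univ (fun t => coef (pot V) κ (-t)) (fun _ => 0) (fun _ => (0 : ℝ))
      (fun _ => 0) := ⟨continuousOn_const, continuousOn_const, by simp, by simp⟩
  have := (SolOn.unique hL hq (locallyIntegrable_const _) (hr.mono (subset_univ _))
    (hz.mono (subset_univ _)) (by simp [hR]) (by simp [h.right, hR])).1 (right_mem_Icc.2 hL)
  exact h0 this

/-- The exponential tails integrate exactly. This expresses the normalization by data on `[-L, L]`,
as needed for the solvability condition in the reduced resolvent. -/
theorem integral_sq_eq (h : IsDecaying L V κ ψ ψ') (haL : a < L) (hκ : 0 < κ) :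
    ∫ x, ψ x ^ 2 = (∫ x in (-L)..L, ψ x ^ 2) + ψ L ^ 2 / (2 * κ) + ψ (-L) ^ 2 / (2 * κ) := by
  have hi : Integrable (fun x => ψ x ^ 2) volume := (h.memLp haL hκ).integrable_sq
  have h1 : ∫ x in Ioi L, ψ x ^ 2 = ψ L ^ 2 / (2 * κ) := by
    have : ∫ x in Ioi L, ψ x ^ 2 =
        ∫ x in Ioi L, ψ L ^ 2 * Real.exp (2 * κ * L) * Real.exp (-(2 * κ) * x) := by
      refine setIntegral_congr_fun measurableSet_Ioi fun x hx => ?_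
      rw [(h.tail_right haL hκ (le_of_lt hx)).1, mul_pow, ← Real.exp_nat_mul, mul_assoc,
        ← Real.exp_add]
      congr 2; push_cast; ring
    rw [this, integral_const_mul, integral_exp_mul_Ioi (by linarith), mul_assoc, neg_div,
      mul_neg, mul_div_assoc', ← Real.exp_add]
    rw [show 2 * κ * L + -(2 * κ) * L = 0 by ring, Real.exp_zero]
    field_simp
  have h2 : ∫ x in Iic (-L), ψ x ^ 2 = ψ (-L) ^ 2 / (2 * κ) := by
    have : ∫ x in Iic (-L), ψ x ^ 2 =
        ∫ x in Iic (-L), ψ (-L) ^ 2 * Real.exp (2 * κ * L) * Real.exp ((2 * κ) * x) := by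
      refine setIntegral_congr_fun measurableSet_Iic fun x hx => ?_
      rw [(h.tail_left haL hκ hx).1, mul_pow, ← Real.exp_nat_mul, mul_assoc,
        ← Real.exp_add]
      congr 2; push_cast; ring
    rw [this, integral_const_mul, integral_exp_mul_Iic (by linarith), mul_assoc,
      mul_div_assoc', ← Real.exp_add]
    rw [show 2 * κ * L + (2 * κ) * -L = 0 by ring, Real.exp_zero]
    field_simp
  rw [← h1, ← h2, ← intervalIntegral.integral_Iic_add_Ioi hi.integrableOn hi.integrableOn (b := L),
    ← intervalIntegral.integral_Iic_sub_Iic (a := -L) (b := L) hi.integrableOn hi.integrableOn]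
  ring

/-- The reduced resolvent at the bound state energy. -/
theorem exists_reduced (hd : IsDecaying L V κ ψ ψ') (haL : a < L) (hL0 : 0 < L) (hL : -L ≤ L)
    (hκ : 0 < κ) (hn : ∫ x, ψ x ^ 2 = 1) {h : ℝ → ℝ} (hh : LocallyIntegrable h volume)
    (hh0 : ∀ x, x ∉ Icc (-L) L → h x = 0) :
    ∃ u v : ℝ → ℝ, SolOn univ (coef (pot V) κ) (fun x => h x - (∫ y, ψ y * h y) * ψ x) u v ∧
      MemLp u 2 volume ∧ Tendsto u (cocompact ℝ) (𝓝 0) ∧ Tendsto v (cocompact ℝ) (𝓝 0) ∧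
      ∫ x, ψ x * u x = 0 := by
  set c := ∫ y, ψ y * h y with hc
  have hq := locallyIntegrable_coef (locallyIntegrable_pot V) κ
  have cψ : Continuous ψ := continuousOn_univ.1 hd.sol.cont
  have hf : LocallyIntegrable (fun x => h x - c * ψ x) volume :=
    hh.sub (continuous_const.mul cψ).locallyIntegrable
  set f := fun x => h x - c * ψ x with hfdef
  have hψL : ψ (-L) ≠ 0 := fun h0 => by
    rw [hd.eq_zero_of_left haL hL hκ h0] at hn; simp at hn
  have hψR := hd.ne_zero_right hL hψL
  -- `sl` and `sr` are the coefficients of the linear factors of the particular solutions on the two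
  -- tails, where the source is `-c ψ`. The value `0` at `-L` is a free choice, corrected at the end
  -- by a multiple of `ψ`.
  set sl := c * ψ (-L) / (2 * κ) with hsl
  set sr := -(c * ψ L / (2 * κ)) with hsr
  obtain ⟨g1, g2, g3⟩ := ivp_solOn hL hq hf (α := 0) (β := sl) rfl
  set w := IccExtend hL (ivp hL (coef (pot V) κ) hq (affine (-L) L 0 sl - source hL f hf))
  set w' := slopeOf hL (coef (pot V) κ) f sl
    (ivp hL (coef (pot V) κ) hq (affine (-L) L 0 sl - source hL f hf))
  have hI : ∫ t in (-L)..L, ψ t * h t = c := by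
    rw [hc, intervalIntegral.integral_of_le hL, ← integral_Icc_eq_integral_Ioc]
    exact setIntegral_eq_integral_of_forall_compl_eq_zero fun x hx => by rw [hh0 x hx, mul_zero]
  -- Solvability condition: the solution started on the left also matches the right tail. Lagrange's
  -- identity against `ψ` turns this into the orthogonality of the source to `ψ`, which holds since
  -- `∫ ψ² = 1`; the factor `ψ (L) ≠ 0` is then cancelled.
  have hbc : w' L + κ * w L = sr := by
    have lag := SolOn.lagrange hL g1 (hd.sol.mono (subset_univ _)) hq hf hq
      (locallyIntegrable_const _)
    simp only [sub_self, zero_mul, mul_zero, zero_add, g2, g3, hd.right] at lag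
    have hsq := hd.integral_sq_eq haL hκ
    rw [hn] at hsq
    have i1 : IntervalIntegrable (fun t => ψ t * h t) volume (-L) L :=
      (locallyIntegrable_intervalIntegrable hh).continuousOn_mul cψ.continuousOn
    have i2 : IntervalIntegrable (fun t => c * ψ t ^ 2) volume (-L) L :=
      (continuous_const.mul (cψ.pow 2)).intervalIntegrable _ _
    have hint : ∫ t in (-L)..L, ψ t * f t = c - c * ∫ t in (-L)..L, ψ t ^ 2 := by
      rw [← intervalIntegral.integral_const_mul]
      conv_rhs => rw [← hI]
      rw [hI, ← hI, ← intervalIntegral.integral_sub i1]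
      · refine intervalIntegral.integral_congr fun t _ => ?_
        simp only [hfdef]
        rw [hI]; ring
      · rw [hI]; exact i2
    rw [hint] at lag
    have h3 : ψ L * (w' L + κ * w L) = ψ L * sr := by
      rw [hsr]
      have e2 : sl * ψ (-L) = c * (ψ (-L) ^ 2 / (2 * κ)) := by rw [hsl]; ring
      linear_combination -lag + e2 - c * hsq
    exact mul_left_cancel₀ hψR h3
  have tr := SolOn.of_free_right (f := f) haL (U := V)
    ((solOn_affine_exp κ (w L) sr L).mono (subset_univ (Ici L))) (fun x hx => by
      rw [hfdef]; simp only
      rw [hh0 x (fun hm => by linarith [hm.2]), (hd.tail_right haL hκ hx.le).1, hsr]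
      field_simp; ring)
  have tl := solOn_affine_exp (-κ) 0 sl (-L)
  rw [neg_sq] at tl
  have tl := SolOn.of_free_left (f := f) haL (U := V)
    (tl.mono (subset_univ (Iic (-L)))) (fun x hx => by
      rw [hfdef]; simp only
      rw [hh0 x (fun hm => by linarith [hm.1]), (hd.tail_left haL hκ hx.le).1, hsl, neg_neg,
        sub_neg_eq_add]
      field_simp; ring)
  obtain ⟨u, v, t1, t2, t3, t4, t5, t6, t7⟩ := SolOn.glue hL0 hq hf g1 tl tr
    (by simp [g2]) (by simp [g3]) (by simp) (by simp; linarith)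
  have cu : Continuous u := continuousOn_univ.1 t1.cont
  have ur : ∀ x, L ≤ x → u x = (w L + sr * (x - L)) * Real.exp (-κ * (x - L)) := fun x hx => t6 hx
  have ul : ∀ x, x ≤ -L → u x = (0 + -sl * (-x - L)) * Real.exp (-κ * (-x - L)) := fun x hx => by
    rw [t4 hx]; ring_nf
  have mu : MemLp u 2 volume := memLp_of_tails hκ cu ur ul
  have tu := tendsto_cocompact_of_tails hκ ur ul
  have tv : Tendsto v (cocompact ℝ) (𝓝 0) := by
    refine tendsto_cocompact_of_tails (A := sr - κ * w L) (s := -κ * sr) (A' := sl)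
      (s' := -κ * sl) (L := L) hκ (fun x hx => t7 hx) (fun x hx => ?_)
    rw [t5 hx]; ring_nf
  have mψ := hd.memLp haL hκ
  obtain ⟨z1, z2⟩ := hd.tendsto_zero haL hκ
  -- Solutions are determined up to multiples of `ψ`; subtracting `r ψ` makes the solution
  -- orthogonal to `ψ`.
  set r := ∫ x, ψ x * u x with hr
  refine ⟨fun x => u x - r * ψ x, fun x => v x - r * ψ' x, ?_, mu.sub (mψ.const_mul r), ?_, ?_, ?_⟩
  · simpa using t1.sub (hd.sol.const_mul r) hq hf (by simpa using locallyIntegrable_const (0 : ℝ))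
  · simpa using tu.sub (z1.const_mul r)
  · simpa using tv.sub (z2.const_mul r)
  · have i1 : Integrable (fun x => ψ x * u x) volume := mψ.integrable_mul mu
    have i2 : Integrable (fun x => r * ψ x ^ 2) volume := mψ.integrable_sq.const_mul r
    have : ∀ x, ψ x * (u x - r * ψ x) = ψ x * u x - r * ψ x ^ 2 := fun x => by ring
    simp_rw [this]
    rw [integral_sub i1 i2, integral_const_mul, hn, ← hr]; ring

end IsDecaying

/-- The function `R_V(√λ_V) P_c h` is the decaying solution orthogonal to the ground state. -/
theorem resolventPc_solOn (haL : a < L) (hL0 : 0 < L) (hL : -L ≤ L) {V : L2Icc a} {κ : ℝ}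
    (hκ : 0 < κ) (hE : groundEnergy (pot V) = -κ ^ 2) {ψ' : ℝ → ℝ}
    (hd : IsDecaying L V κ (groundState (pot V)) ψ') (hn : ∫ x, groundState (pot V) x ^ 2 = 1)
    {h : ℝ → ℝ} (hh : LocallyIntegrable h volume) (hh0 : ∀ x, x ∉ Icc (-L) L → h x = 0) :
    ∃ v, SolOn univ (coef (pot V) κ) (projCont (pot V) h) (resolventPc (pot V) h) v ∧
      MemLp (resolventPc (pot V) h) 2 volume ∧
      Tendsto (resolventPc (pot V) h) (cocompact ℝ) (𝓝 0) ∧ Tendsto v (cocompact ℝ) (𝓝 0) ∧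
      ∫ x, groundState (pot V) x * resolventPc (pot V) h x = 0 := by
  set ψ := groundState (pot V)
  obtain ⟨u, v, g1, g2, g3, g4, g5⟩ := hd.exists_reduced haL hL0 hL hκ hn hh hh0
  change SolOn univ (coef (pot V) κ) (projCont (pot V) h) u v at g1
  suffices hu : resolventPc (pot V) h = u by
    rw [hu]; exact ⟨v, g1, g2, g3, g4, g5⟩
  have hq := locallyIntegrable_coef (locallyIntegrable_pot V) κ
  have cψ : Continuous ψ := continuousOn_univ.1 hd.sol.cont
  have hf : LocallyIntegrable (projCont (pot V) h) volume :=
    hh.sub (continuous_const.mul cψ).locallyIntegrable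
  have hex : ∃ u : ℝ → ℝ, MemLp u 2 volume ∧
      IsSol (pot V) (groundEnergy (pot V)) (projCont (pot V) h) u ∧ ∫ x, ψ x * u x = 0 := by
    refine ⟨u, g2, ?_, g5⟩
    rw [isSol_iff_solOn (locallyIntegrable_pot V) hE hf, g1.deriv_eq]
    exact g1
  rw [resolventPc, dif_pos hex]
  obtain ⟨w1, w2, w3⟩ := hex.choose_spec
  set w := hex.choose
  rw [isSol_iff_solOn (locallyIntegrable_pot V) hE hf] at w2
  have hs := w2.sub g1 hq hf hf
  simp only [sub_self] at hs
  -- The chosen and the constructed solution differ by an `L²` homogeneous solution, a multiple of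
  -- `ψ`; both are orthogonal to `ψ`, so the multiple is zero.
  have hdd := IsDecaying.of_memLp haL hκ hs (w1.sub g2)
  have hψL : ψ (-L) ≠ 0 := fun h0 => by
    rw [hd.eq_zero_of_left haL hL hκ h0] at hn; simp at hn
  obtain ⟨r, hr⟩ := hd.proportional haL hL hκ hdd hψL
  have mψ := hd.memLp haL hκ
  have h0 : ∫ x, ψ x * (w x - u x) = 0 := by
    have i1 : Integrable (fun x => ψ x * w x) volume := mψ.integrable_mul w1
    have i2 : Integrable (fun x => ψ x * u x) volume := mψ.integrable_mul g2
    simp_rw [mul_sub]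
    rw [integral_sub i1 i2, w3, g5, sub_zero]
  have h1 : ∀ x, w x - u x = r * ψ x := fun x => congrFun hr x
  simp_rw [h1] at h0
  have h2 : ∀ x, ψ x * (r * ψ x) = r * ψ x ^ 2 := fun x => by ring
  simp_rw [h2] at h0
  rw [integral_const_mul, hn, mul_one] at h0
  ext x
  have := h1 x
  rw [h0, zero_mul, sub_eq_zero] at this
  exact this

end FermiGoldenRule
end

/-! ### First order perturbation theory of the ground state. -/

noncomputable section

namespace FermiGoldenRule

variable {a L : ℝ}

theorem inner_toLp {u ψ : ℝ → ℝ} (hu : MemLp u 2 volume) {P : Lp ℝ 2 (volume : Measure ℝ)}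
    (hP : P =ᵐ[volume] ψ) : inner ℝ hu.toLp P = ∫ x, u x * ψ x := by
  rw [L2.inner_def]
  refine integral_congr_ae ?_
  filter_upwards [hP, hu.coeFn_toLp] with x h1 h2
  rw [h1, h2, RCLike.inner_apply, conj_trivial, mul_comm]

theorem integrable_pot_mul (haL : a < L) (hL : -L ≤ L) (U : L2Icc a) {w : ℝ → ℝ} (hw : Continuous w) :
    Integrable (fun x => pot U x * w x) volume ∧
      ∫ x, pot U x * w x = ∫ x in (-L)..L, pot U x * w x := by
  constructor
  · have : LocallyIntegrable (fun x => pot U x * w x) volume := by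
      rw [← locallyIntegrableOn_univ]
      exact ((locallyIntegrable_pot U).locallyIntegrableOn univ).mul_continuousOn hw.continuousOn
        isClosed_univ.isLocallyClosed
    refine (this.integrableOn_isCompact (isCompact_Icc (a := -L) (b := L))
      ).integrable_of_forall_notMem_eq_zero fun x hx => ?_
    rw [pot_eq_zero_of_notMem haL U hx, zero_mul]
  · rw [intervalIntegral.integral_of_le hL, ← integral_Icc_eq_integral_Ioc]
    exact (setIntegral_eq_integral_of_forall_compl_eq_zero fun x hx => by
      rw [pot_eq_zero_of_notMem haL U hx, zero_mul]).symm

/-- Green's identity between a decaying solution with source `f` for `V` and a bound state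
for `U`. -/
theorem lagrange_pairing (haL : a < L) (hL : -L ≤ L) {U V : L2Icc a} {κ k : ℝ}
    {f u v ψ ψ' : ℝ → ℝ} (hs : SolOn univ (coef (pot V) κ) f u v) (mu : MemLp u 2 volume)
    (tu : Tendsto u (cocompact ℝ) (𝓝 0)) (tv : Tendsto v (cocompact ℝ) (𝓝 0))
    (mf : MemLp f 2 volume) (hk : 0 < k) (hd : IsDecaying L U k ψ ψ')
    {P : Lp ℝ 2 (volume : Measure ℝ)} (hP : P =ᵐ[volume] ψ) {w G : C(Icc (-L) L, ℝ)}
    (hw : ∀ x : Icc (-L) L, ψ x = w x) (hG : ∀ x : Icc (-L) L, G x = u x) :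
    potMul ℝ a hL (U - V) (G * w) ⟨L, right_mem_Icc.2 hL⟩ +
      (k ^ 2 - κ ^ 2) * inner ℝ mu.toLp P + inner ℝ mf.toLp P = 0 := by
  have mψ := hd.memLp haL hk
  have cu : Continuous u := continuousOn_univ.1 hs.cont
  have cψ : Continuous ψ := continuousOn_univ.1 hd.sol.cont
  obtain ⟨z1, z2⟩ := hd.tendsto_zero haL hk
  obtain ⟨i1, e1⟩ := integrable_pot_mul haL hL (U - V) (w := fun x => u x * ψ x) (cu.mul cψ)
  have i2 : Integrable (fun x => u x * ψ x) volume := mu.integrable_mul mψ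
  have i3 : Integrable (fun x => f x * ψ x) volume := mf.integrable_mul mψ
  have hae : (fun t => (coef (pot U) k t - coef (pot V) κ t) * u t * ψ t - u t * 0 + ψ t * f t)
      =ᵐ[volume] fun t => pot (U - V) t * (u t * ψ t) + (k ^ 2 - κ ^ 2) * (u t * ψ t) +
        f t * ψ t := by
    filter_upwards [pot_sub U V] with t ht
    rw [ht]
    simp only [coef, RCLike.ofReal_real_eq_id, id]
    ring
  have i12 : Integrable (fun t => pot (U - V) t * (u t * ψ t) +
      (k ^ 2 - κ ^ 2) * (u t * ψ t)) volume := i1.add (i2.const_mul _)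
  have key := SolOn.integral_lagrange_eq_zero hs hd.sol
    (locallyIntegrable_coef (locallyIntegrable_pot V) κ) (mf.locallyIntegrable (by norm_num))
    (locallyIntegrable_coef (locallyIntegrable_pot U) k) (locallyIntegrable_const _) tu tv z1 z2
    ((i12.add i3).congr hae.symm)
  rw [integral_congr_ae hae, integral_add i12 i3, integral_add i1 (i2.const_mul _),
    integral_const_mul, e1] at key
  rw [inner_toLp mu hP, inner_toLp mf hP, potMul_apply, ← key]
  congr 2
  refine intervalIntegral.integral_congr fun t ht => ?_
  rw [uIcc_of_le hL] at ht
  simp only [RCLike.ofReal_real_eq_id, id]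
  rw [IccExtend_of_mem _ _ ht, ContinuousMap.mul_apply, hG ⟨t, ht⟩, ← hw ⟨t, ht⟩]

namespace IsBranch

variable {V : L2Icc a} {φ : L2Icc a → ℝ} {Ψ : L2Icc a → Lp ℝ 2 (volume : Measure ℝ)}
  {w : L2Icc a → C(Icc (-L) L, ℝ)}

theorem base (h : IsBranch L V φ Ψ w) (haL : a < L) (hL : -L ≤ L) :
    0 < φ V ∧ groundEnergy (pot V) = -φ V ^ 2 ∧
      IsBoundState (pot V) (groundEnergy (pot V)) (groundState (pot V)) ∧
      IsDecaying L V (φ V) (groundState (pot V)) (deriv (groundState (pot V))) := by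
  obtain ⟨h1, h2, ψ, v, h3, h4, -, -⟩ := h.eventually.self_of_nhds
  obtain ⟨h5, -⟩ := groundState_eq haL hL h1 h2 h3 h4
  have hd := h5.isDecaying haL (by rw [h2]; nlinarith)
  rw [h2, neg_neg, Real.sqrt_sq h1.le] at hd
  exact ⟨h1, h2, h5, hd⟩

/-- First order perturbation theory of the ground state, tested against a decaying solution. -/
theorem deriv_pairing (h : IsBranch L V φ Ψ w) (haL : a < L) (hL : -L ≤ L)
    {f u v : ℝ → ℝ} (hs : SolOn univ (coef (pot V) (φ V)) f u v) (mu : MemLp u 2 volume)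
    (tu : Tendsto u (cocompact ℝ) (𝓝 0)) (tv : Tendsto v (cocompact ℝ) (𝓝 0))
    (mf : MemLp f 2 volume) (δ : L2Icc a) :
    (∫ t in (-L)..L, pot δ t * (u t * groundState (pot V) t)) +
      2 * φ V * fderiv ℝ φ V δ * (∫ x, u x * groundState (pot V) x) +
      inner ℝ mf.toLp (fderiv ℝ Ψ V δ) = 0 := by
  have cu : ContinuousOn u (Icc (-L) L) := hs.cont.mono (subset_univ _)
  set G := restrictIcc u cu
  have hc : HasDerivAt (fun t : ℝ => V + t • δ) δ 0 := by
    simpa using ((hasDerivAt_id (0 : ℝ)).smul_const δ).const_add V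
  have hV0 : V + (0 : ℝ) • δ = V := by simp
  have dφ : HasDerivAt (fun t : ℝ => φ (V + t • δ)) (fderiv ℝ φ V δ) 0 :=
    HasFDerivAt.comp_hasDerivAt (f := fun t : ℝ => V + t • δ) 0
      (by rw [hV0]; exact h.diff_rate.hasFDerivAt) hc
  have dΨ : HasDerivAt (fun t : ℝ => Ψ (V + t • δ)) (fderiv ℝ Ψ V δ) 0 :=
    HasFDerivAt.comp_hasDerivAt (f := fun t : ℝ => V + t • δ) 0
      (by rw [hV0]; exact h.diff_state.hasFDerivAt) hc
  have dw : HasDerivAt (fun t : ℝ => w (V + t • δ)) (fderiv ℝ w V δ) 0 :=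
    HasFDerivAt.comp_hasDerivAt (f := fun t : ℝ => V + t • δ) 0
      (by rw [hV0]; exact h.diff_restrict.hasFDerivAt) hc
  set M : C(Icc (-L) L, ℝ) →L[ℝ] ℝ := (ContinuousMap.evalCLM ℝ ⟨L, right_mem_Icc.2 hL⟩ :
    C(Icc (-L) L, ℝ) →L[ℝ] ℝ) ∘L (potMul ℝ a hL δ) ∘L
      ContinuousLinearMap.mul ℝ C(Icc (-L) L, ℝ) G
  have dM := M.hasFDerivAt.comp_hasDerivAt (0 : ℝ) dw
  have di : ∀ x : Lp ℝ 2 (volume : Measure ℝ), HasDerivAt (fun t : ℝ => inner ℝ x (Ψ (V + t • δ)))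
      (inner ℝ x (fderiv ℝ Ψ V δ)) 0 := fun x => (innerSL ℝ x).hasFDerivAt.comp_hasDerivAt 0 dΨ
  have d := (((hasDerivAt_id (0 : ℝ)).mul dM).add
    (((dφ.pow 2).sub_const (φ V ^ 2)).mul (di mu.toLp))).add (di mf.toLp)
  -- The exact pairing identity holds along the whole segment near `0`, so its derivative vanishes.
  -- No equation for the derivative of the ground state is required.
  have hev : ∀ᶠ t : ℝ in 𝓝 0, t * M (w (V + t • δ)) +
      (φ (V + t • δ) ^ 2 - φ V ^ 2) * inner ℝ mu.toLp (Ψ (V + t • δ)) +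
      inner ℝ mf.toLp (Ψ (V + t • δ)) = 0 := by
    have hcont : Tendsto (fun t : ℝ => V + t • δ) (𝓝 0) (𝓝 V) := by
      have := hc.continuousAt.tendsto
      rwa [hV0] at this
    filter_upwards [hcont.eventually h.eventually] with t ht
    obtain ⟨h1, -, ψ, v', h3, -, h5, h6⟩ := ht
    have := lagrange_pairing haL hL hs mu tu tv mf h1 h3 h5 h6 (G := G) fun x => rfl
    rw [add_sub_cancel_left, map_smul] at this
    exact this
  have hz := (d.congr_of_eventuallyEq (f₁ := fun _ : ℝ => (0 : ℝ))
    (hev.mono fun t ht => by simpa using ht.symm)).unique (hasDerivAt_const (0 : ℝ) (0 : ℝ))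
  have eM : M (w V) = ∫ t in (-L)..L, pot δ t * (u t * groundState (pot V) t) := by
    change potMul ℝ a hL δ (G * w V) ⟨L, right_mem_Icc.2 hL⟩ = _
    rw [potMul_apply]
    refine intervalIntegral.integral_congr fun t ht => ?_
    rw [uIcc_of_le hL] at ht
    simp only [RCLike.ofReal_real_eq_id, id]
    rw [IccExtend_of_mem _ _ ht, ContinuousMap.mul_apply, h.restrict_eq ⟨t, ht⟩]
    rfl
  rw [← eM, ← inner_toLp mu h.state_eq, ← hz]
  simp only [hV0, id, Function.comp_apply]
  simp

/-- Differentiate `‖Ψ U‖² = 1`, which holds for all `U` near `V`. -/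
theorem inner_deriv_state (h : IsBranch L V φ Ψ w) (δ : L2Icc a) :
    inner ℝ (Ψ V) (fderiv ℝ Ψ V δ) = 0 := by
  have h1 := (h.diff_state.hasFDerivAt.inner ℝ h.diff_state.hasFDerivAt)
  have h2 : (fun U => (inner ℝ (Ψ U) (Ψ U) : ℝ)) =ᶠ[𝓝 V] fun _ => 1 := by
    filter_upwards [h.eventually] with U hU
    obtain ⟨-, -, ψ, v, -, h3, h4, -⟩ := hU
    rw [real_inner_self_eq_norm_sq, norm_sq_eq_integral h4, h3]
  have h3 := (h1.congr_of_eventuallyEq h2.symm).unique (hasFDerivAt_const (1 : ℝ) V)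
  have := congrArg (fun T : L2Icc a →L[ℝ] ℝ => T δ) h3
  simp [real_inner_comm] at this
  linarith [this]

/-- The first variation of the ground state energy. -/
theorem deriv_rate (h : IsBranch L V φ Ψ w) (haL : a < L) (hL : -L ≤ L) (δ : L2Icc a) :
    2 * φ V * fderiv ℝ φ V δ = -∫ t in (-L)..L, pot δ t * groundState (pot V) t ^ 2 := by
  obtain ⟨h1, h2, h3, h4⟩ := h.base haL hL
  obtain ⟨z1, z2⟩ := h4.tendsto_zero haL h1
  have m0 : MemLp (fun _ : ℝ => (0 : ℝ)) 2 volume := MemLp.zero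
  have e0 : m0.toLp = 0 := MemLp.toLp_zero m0
  -- The test function is the ground state itself, with zero source.
  have := h.deriv_pairing haL hL h4.sol h3.memLp z1 z2 m0 δ
  simp_rw [← sq] at this
  rw [h3.normalized, e0, inner_zero_left] at this
  linarith

/-- The first variation of the ground state. -/
theorem inner_deriv (h : IsBranch L V φ Ψ w) (haL : a < L) (hL0 : 0 < L) (hL : -L ≤ L)
    {b : ℝ → ℝ} (mb : MemLp b 2 volume) (hb : ∀ x, x ∉ Icc (-L) L → b x = 0) (δ : L2Icc a) :
    inner ℝ mb.toLp (fderiv ℝ Ψ V δ) =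
      -∫ t in (-L)..L, pot δ t * (resolventPc (pot V) b t * groundState (pot V) t) := by
  obtain ⟨h1, h2, h3, h4⟩ := h.base haL hL
  obtain ⟨v, g1, g2, g3, g4, g5⟩ := resolventPc_solOn haL hL0 hL h1 h2 h4 h3.normalized
    (mb.locallyIntegrable (by norm_num)) hb
  have mf : MemLp (projCont (pot V) b) 2 volume := mb.sub (h3.memLp.const_mul _)
  have := h.deriv_pairing haL hL g1 g2 g3 g4 mf δ
  simp_rw [mul_comm (resolventPc _ _ _) (groundState _ _)] at this
  rw [g5, mul_zero, add_zero] at this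
  -- Here the test function is the reduced resolvent of `b`, with source `P_c b`. Orthogonality to
  -- the ground state removes the energy term, and `inner_deriv_state` allows `P_c b` to be replaced
  -- by `b`.
  have e : mf.toLp = mb.toLp - (∫ y, groundState (pot V) y * b y) • Ψ V := by
    apply Lp.ext
    filter_upwards [mf.coeFn_toLp, mb.coeFn_toLp, Lp.coeFn_sub mb.toLp
      ((∫ y, groundState (pot V) y * b y) • Ψ V),
      Lp.coeFn_smul (∫ y, groundState (pot V) y * b y) (Ψ V), h.state_eq] with x e1 e2 e3 e4 e5
    rw [e1, e3, Pi.sub_apply, e2, e4, Pi.smul_apply, e5, smul_eq_mul]; rfl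
  rw [e, inner_sub_left, inner_smul_left, h.inner_deriv_state, mul_zero, sub_zero] at this
  simp_rw [mul_comm (resolventPc _ _ _) (groundState _ _)]
  linarith

end IsBranch

end FermiGoldenRule
end

/-! ### The sign of `L`, the equation of `φ_±`, and the pairings `∫ β ψ e` as real bilinear maps. -/

noncomputable section

namespace FermiGoldenRule

variable {a L : ℝ}

/-- If `L ≤ 0`, then `a < 0`, the potential is identically zero, and the free operator has no bound
state. -/
theorem IsNegEigenvalue.pos (haL : a < L) {U : L2Icc a} {E : ℝ} (h : IsNegEigenvalue (pot U) E) :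
    0 < L := by
  by_contra hL
  have ha : a < 0 := by linarith
  obtain ⟨hE, ψ, hψ⟩ := h
  have hκ : 0 < Real.sqrt (-E) := Real.sqrt_pos.2 (by linarith)
  -- Applied with half-width `0`: both decay conditions hold at the origin, so `ψ 0 = 0`.
  have hd := hψ.isDecaying ha hE
  have h1 := hd.right
  have h2 := hd.left
  rw [neg_zero] at h2
  have h0 : ψ 0 = 0 := by
    have : 2 * Real.sqrt (-E) * ψ 0 = 0 := by linarith
    exact (mul_eq_zero.1 this).resolve_left (by positivity)
  have hz := hd.eq_zero_of_left ha (by simp) hκ (by rw [neg_zero, h0])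
  have := hψ.normalized
  rw [hz] at this
  simp at this

/-- The boundary value problem of `φ_±`. -/
theorem resPhi_isSol (haL : a < L) (hL0 : 0 < L) {μ : ℝ} {V : L2Icc a}
    (hk : resFreq μ (pot V) ≠ 0) (σ : ℤˣ) :
    IsSol (pot V) ((resFreq μ (pot V) : ℂ) ^ 2)
        (fun y => (pot V y : ℂ) * planeWave σ (resFreq μ (pot V)) y) (resPhi μ (pot V) σ) ∧
      deriv (resPhi μ (pot V) σ) L =
        Complex.I * resFreq μ (pot V) * resPhi μ (pot V) σ L ∧
      -deriv (resPhi μ (pot V) σ) (-L) =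
        Complex.I * resFreq μ (pot V) * resPhi μ (pot V) σ (-L) := by
  set k := resFreq μ (pot V) with hkdef
  have hf := locallyIntegrable_pot_mul V (continuous_planeWave σ k)
  have ho := outResolvent_isOutgoing haL hL0 V hk hf fun x hx => by
    rw [pot_eq_zero_of_notMem haL V hx]; simp
  have e : resPhi μ (pot V) σ =
      outResolvent (pot V) k (fun y => (pot V y : ℂ) * planeWave σ k y) := by
    ext x; exact sub_sub_cancel _ _
  rw [e]
  refine ⟨?_, by rw [ho.right]; ring, by rw [ho.left]; ring⟩
  rw [isSol_iff_solOn (locallyIntegrable_pot V) (κ := -(Complex.I * k))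
    (by linear_combination (k : ℂ) ^ 2 * Complex.I_sq) hf]
  exact ho.sol

/-- The real part of a continuous function. -/
def reC (L : ℝ) : C(Icc (-L) L, ℂ) →L[ℝ] C(Icc (-L) L, ℝ) :=
  Complex.reCLM.compLeftContinuous ℝ (Icc (-L) L)

/-- The imaginary part of a continuous function. -/
def imC (L : ℝ) : C(Icc (-L) L, ℂ) →L[ℝ] C(Icc (-L) L, ℝ) :=
  Complex.imCLM.compLeftContinuous ℝ (Icc (-L) L)

section Pairing

variable {β : ℝ → ℝ} (hL : -L ≤ L) (hβ : MemLp β 2 volume)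

/-- The real part of `∫ β ψ e`. -/
def pairRe (P : Lp ℝ 2 (volume : Measure ℝ)) (e : C(Icc (-L) L, ℂ)) : ℝ :=
  inner ℝ (mulExtend hL hβ (reC L e)) P

/-- The imaginary part of `∫ β ψ e`. -/
def pairIm (P : Lp ℝ 2 (volume : Measure ℝ)) (e : C(Icc (-L) L, ℂ)) : ℝ :=
  inner ℝ (mulExtend hL hβ (imC L e)) P

theorem inner_mulExtend {P : Lp ℝ 2 (volume : Measure ℝ)} {ψ : ℝ → ℝ} (hP : P =ᵐ[volume] ψ)
    (w : C(Icc (-L) L, ℝ)) : inner ℝ (mulExtend hL hβ w) P = ∫ x, β x * IccExtend hL w x * ψ x :=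
  inner_toLp (memLp_mul_extend hL hβ w) hP

/-- `β` vanishes outside `[-L, L]`, so only the restriction of the wave matters. Separating real and
imaginary parts gives bounded real bilinear maps, which are differentiable over `ℝ` although the
squared modulus is not complex differentiable. -/
theorem integral_eq_pair (hβL : ∀ x, x ∉ Icc (-L) L → β x = 0)
    {P : Lp ℝ 2 (volume : Measure ℝ)} {ψ : ℝ → ℝ} (hP : P =ᵐ[volume] ψ) {f : ℝ → ℂ}
    {e : C(Icc (-L) L, ℂ)} (he : ∀ x : Icc (-L) L, f x = e x) :
    ∫ x, ((β x * ψ x : ℝ) : ℂ) * f x = pairRe hL hβ P e + pairIm hL hβ P e * Complex.I := by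
  have mψ : MemLp ψ 2 volume := (memLp_congr_ae hP).1 (Lp.memLp P)
  have i1 : Integrable (fun x => β x * IccExtend hL (reC L e) x * ψ x) volume :=
    (memLp_mul_extend hL hβ (reC L e)).integrable_mul mψ
  have i2 : Integrable (fun x => β x * IccExtend hL (imC L e) x * ψ x) volume :=
    (memLp_mul_extend hL hβ (imC L e)).integrable_mul mψ
  have j1 : Integrable (fun x => ((β x * IccExtend hL (reC L e) x * ψ x : ℝ) : ℂ)) volume :=
    i1.ofReal
  have j2 : Integrable (fun x => ((β x * IccExtend hL (imC L e) x * ψ x : ℝ) : ℂ)) volume :=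
    i2.ofReal
  rw [pairRe, pairIm, inner_mulExtend hL hβ hP, inner_mulExtend hL hβ hP,
    ← integral_complex_ofReal, ← integral_complex_ofReal, ← integral_mul_const,
    ← integral_add j1 (j2.mul_const _)]
  congr 1
  ext x
  by_cases hx : x ∈ Icc (-L) L
  · have h1 : IccExtend hL (reC L e) x = (f x).re := by
      rw [IccExtend_of_mem _ _ hx, he ⟨x, hx⟩]; rfl
    have h2 : IccExtend hL (imC L e) x = (f x).im := by
      rw [IccExtend_of_mem _ _ hx, he ⟨x, hx⟩]; rfl
    rw [h1, h2]
    conv_lhs => rw [← Complex.re_add_im (f x)]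
    push_cast; ring
  · simp [hβL x hx]

theorem goldenRule_eq (hβL : ∀ x, x ∉ Icc (-L) L → β x = 0) (k : ℝ)
    {P : Lp ℝ 2 (volume : Measure ℝ)} {ψ : ℝ → ℝ} (hP : P =ᵐ[volume] ψ) {f : ℤˣ → ℝ → ℂ}
    {e : ℤˣ → C(Icc (-L) L, ℂ)} (he : ∀ σ, ∀ x : Icc (-L) L, f σ x = e σ x) :
    goldenRule β k ψ f =
      1 / (16 * k) * ∑ σ : ℤˣ, (pairRe hL hβ P (e σ) ^ 2 + pairIm hL hβ P (e σ) ^ 2) := by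
  rw [goldenRule]
  congr 1
  refine Finset.sum_congr rfl fun σ _ => ?_
  rw [integral_eq_pair hL hβ hβL hP (he σ), ← Complex.normSq_eq_norm_sq, Complex.normSq_add_mul_I]

theorem hasFDerivAt_pairRe {E : Type*} [NormedAddCommGroup E] [NormedSpace ℝ E] {x : E}
    {P : E → Lp ℝ 2 (volume : Measure ℝ)} {P' : E →L[ℝ] Lp ℝ 2 (volume : Measure ℝ)}
    {e : E → C(Icc (-L) L, ℂ)} {e' : E →L[ℝ] C(Icc (-L) L, ℂ)} (hP : HasFDerivAt P P' x)
    (he : HasFDerivAt e e' x) :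
    ∃ D : E →L[ℝ] ℝ, HasFDerivAt (fun y => pairRe hL hβ (P y) (e y)) D x ∧
      ∀ δ, D δ = pairRe hL hβ (P' δ) (e x) + pairRe hL hβ (P x) (e' δ) := by
  refine ⟨_, HasFDerivAt.inner ℝ
    ((mulExtend hL hβ ∘L reC L).hasFDerivAt.comp x he) hP, fun δ => ?_⟩
  simp [pairRe, fderivInnerCLM_apply]

theorem hasFDerivAt_pairIm {E : Type*} [NormedAddCommGroup E] [NormedSpace ℝ E] {x : E}
    {P : E → Lp ℝ 2 (volume : Measure ℝ)} {P' : E →L[ℝ] Lp ℝ 2 (volume : Measure ℝ)}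
    {e : E → C(Icc (-L) L, ℂ)} {e' : E →L[ℝ] C(Icc (-L) L, ℂ)} (hP : HasFDerivAt P P' x)
    (he : HasFDerivAt e e' x) :
    ∃ D : E →L[ℝ] ℝ, HasFDerivAt (fun y => pairIm hL hβ (P y) (e y)) D x ∧
      ∀ δ, D δ = pairIm hL hβ (P' δ) (e x) + pairIm hL hβ (P x) (e' δ) := by
  refine ⟨_, HasFDerivAt.inner ℝ
    ((mulExtend hL hβ ∘L imC L).hasFDerivAt.comp x he) hP, fun δ => ?_⟩
  simp [pairIm, fderivInnerCLM_apply]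

/-- The derivative of `|∫ β ψ e|²`. -/
theorem hasFDerivAt_pair_sq {E : Type*} [NormedAddCommGroup E] [NormedSpace ℝ E] {x : E}
    {P : E → Lp ℝ 2 (volume : Measure ℝ)} {P' : E →L[ℝ] Lp ℝ 2 (volume : Measure ℝ)}
    {e : E → C(Icc (-L) L, ℂ)} {e' : E →L[ℝ] C(Icc (-L) L, ℂ)} (hP : HasFDerivAt P P' x)
    (he : HasFDerivAt e e' x) :
    ∃ D : E →L[ℝ] ℝ,
      HasFDerivAt (fun y => pairRe hL hβ (P y) (e y) ^ 2 + pairIm hL hβ (P y) (e y) ^ 2) D x ∧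
      ∀ δ, D δ =
        2 * (pairRe hL hβ (P x) (e x) * pairRe hL hβ (P' δ) (e x) +
          pairIm hL hβ (P x) (e x) * pairIm hL hβ (P' δ) (e x)) +
        2 * (pairRe hL hβ (P x) (e x) * pairRe hL hβ (P x) (e' δ) +
          pairIm hL hβ (P x) (e x) * pairIm hL hβ (P x) (e' δ)) := by
  obtain ⟨D₁, h₁, f₁⟩ := hasFDerivAt_pairRe hL hβ hP he
  obtain ⟨D₂, h₂, f₂⟩ := hasFDerivAt_pairIm hL hβ hP he
  refine ⟨_, (h₁.pow 2).add (h₂.pow 2), fun δ => ?_⟩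
  simp [f₁, f₂]
  ring

/-- A change of sign of the eigenfunction leaves `Γ` unchanged; hence the arbitrary signs in
`groundState` do no harm. -/
theorem pair_smul_sq {s : ℝ} (hs : s ^ 2 = 1) (P : Lp ℝ 2 (volume : Measure ℝ))
    (e : C(Icc (-L) L, ℂ)) : pairRe hL hβ (s • P) e ^ 2 + pairIm hL hβ (s • P) e ^ 2 =
      pairRe hL hβ P e ^ 2 + pairIm hL hβ P e ^ 2 := by
  simp only [pairRe, pairIm, inner_smul_right, mul_pow, hs, one_mul]

theorem pair_zero_left (e : C(Icc (-L) L, ℂ)) :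
    pairRe hL hβ 0 e = 0 ∧ pairIm hL hβ 0 e = 0 := by simp [pairRe, pairIm]

theorem pair_zero_right (P : Lp ℝ 2 (volume : Measure ℝ)) :
    pairRe hL hβ P 0 = 0 ∧ pairIm hL hβ P 0 = 0 := by simp [pairRe, pairIm]

end Pairing

end FermiGoldenRule
end

/-! ### Variations of the frequency and of the pairings. -/

noncomputable section

namespace FermiGoldenRule

variable {a L : ℝ}

/-- The first variation of the resonant frequency. -/
theorem IsBranch.exists_freq {V : L2Icc a} {φ : L2Icc a → ℝ}
    {Ψ : L2Icc a → Lp ℝ 2 (volume : Measure ℝ)} {w : L2Icc a → C(Icc (-L) L, ℝ)}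
    (h : IsBranch L V φ Ψ w) (haL : a < L) (hL : -L ≤ L) {μ : ℝ}
    (hk : 0 < groundEnergy (pot V) + μ) :
    ∃ (K : L2Icc a → ℝ) (K' : L2Icc a →L[ℝ] ℝ), K V = resFreq μ (pot V) ∧
      (∀ᶠ U in 𝓝 V, resFreq μ (pot U) = K U) ∧ HasFDerivAt K K' V ∧
      ∀ δ, K' δ = 1 / (2 * resFreq μ (pot V)) *
        ∫ t in (-L)..L, pot δ t * groundState (pot V) t ^ 2 := by
  obtain ⟨h1, h2, -, -⟩ := h.base haL hL
  have hpos : -φ V ^ 2 + μ ≠ 0 := by rw [← h2]; exact hk.ne'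
  have hd := (((h.diff_rate.hasFDerivAt.pow 2).neg).add_const μ).sqrt hpos
  refine ⟨fun U => Real.sqrt (-φ U ^ 2 + μ), _, by rw [resFreq, h2], ?_, hd, fun δ => ?_⟩
  · filter_upwards [h.eventually] with U hU
    rw [resFreq, hU.2.1]
  -- From `k² = μ - φ²`, so that `2 k k' = -2 φ φ' = ∫ δ ψ²`.
  · have := h.deriv_rate haL hL δ
    rw [resFreq, h2]
    simp
    linear_combination (-(1 / 2) * (√(-φ V ^ 2 + μ))⁻¹) * this

theorem intervalIntegral_eq_integral (hL : -L ≤ L) {E : Type*} [NormedAddCommGroup E]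
    [NormedSpace ℝ E] {f : ℝ → E} (hf : ∀ x, x ∉ Icc (-L) L → f x = 0) :
    ∫ t in (-L)..L, f t = ∫ t, f t := by
  rw [intervalIntegral.integral_of_le hL, ← integral_Icc_eq_integral_Ioc]
  exact setIntegral_eq_integral_of_forall_compl_eq_zero hf

theorem intervalIntegral_mul_re {q : ℝ → ℝ} (hq : LocallyIntegrable q volume) {f : ℝ → ℂ}
    (hf : Continuous f) (c : ℂ) (x y : ℝ) :
    ∫ t in x..y, q t * (c * f t).re = (c * ∫ t in x..y, (q t : ℂ) * f t).re := by
  have hi : IntervalIntegrable (fun t => c * ((q t : ℂ) * f t)) volume x y :=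
    ((locallyIntegrable_intervalIntegrable (locallyIntegrable_ofReal (𝕜 := ℂ) hq)
      ).mul_continuousOn hf.continuousOn).const_mul c
  rw [← intervalIntegral.integral_const_mul]
  have := Complex.reCLM.intervalIntegral_comp_comm hi
  simp only [Complex.reCLM_apply] at this
  rw [← this]
  refine intervalIntegral.integral_congr fun t _ => ?_
  rw [show c * ((q t : ℂ) * f t) = (q t : ℂ) * (c * f t) by ring, Complex.re_ofReal_mul]

/-- Integration of the explicit gradient against `q`, by linearity. It is stated for arbitrary
continuous functions and constants so that the resolvents can be inserted afterwards. -/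
theorem intervalIntegral_gradient {q R ψ : ℝ → ℝ} {g : ℝ → ℂ} {e : ℤˣ → ℝ → ℂ}
    (hq : LocallyIntegrable q volume) (hR : Continuous R) (hψ : Continuous ψ) (hg : Continuous g)
    (he : ∀ σ, Continuous (e σ)) (A B D : ℝ) (c m : ℤˣ → ℂ) (x y : ℝ) :
    ∫ t in x..y, q t * (A * ψ t * R t - B * ψ t ^ 2 +
        ∑ σ : ℤˣ, D * (c σ * (m σ * ((ψ t ^ 2 : ℝ) : ℂ) - e σ t * g t)).re) =
      A * (∫ t in x..y, q t * (R t * ψ t)) - B * (∫ t in x..y, q t * ψ t ^ 2) +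
        ∑ σ : ℤˣ, D * (c σ * (m σ * ((∫ t in x..y, q t * ψ t ^ 2 : ℝ) : ℂ) -
          ∫ t in x..y, (q t : ℂ) * (g t * e σ t))).re := by
  have hi : ∀ {f : ℝ → ℝ}, Continuous f → IntervalIntegrable (fun t => q t * f t) volume x y :=
    fun hf => (locallyIntegrable_intervalIntegrable hq).mul_continuousOn hf.continuousOn
  have hre : ∀ σ, Continuous fun t => (c σ * (g t * e σ t)).re := fun σ =>
    Complex.continuous_re.comp (continuous_const.mul (hg.mul (he σ)))
  have hz : ∀ (c m z : ℂ) (r : ℝ), (c * (m * r - z)).re = (c * m).re * r - (c * z).re := by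
    intro c m z r
    rw [mul_sub, ← mul_assoc, Complex.sub_re, Complex.re_mul_ofReal]
  have i1 : IntervalIntegrable (fun t => A * (q t * (R t * ψ t))) volume x y :=
    (hi (hR.mul hψ)).const_mul A
  have i0 : IntervalIntegrable (fun t => q t * ψ t ^ 2) volume x y := hi (hψ.pow 2)
  have i2 : IntervalIntegrable (fun t => B * (q t * ψ t ^ 2)) volume x y := i0.const_mul B
  have i3 : ∀ σ : ℤˣ, IntervalIntegrable (fun t => D * ((c σ * m σ).re * (q t * ψ t ^ 2)) -
      D * (q t * (c σ * (g t * e σ t)).re)) volume x y := fun σ =>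
    ((i0.const_mul _).const_mul D).sub ((hi (hre σ)).const_mul D)
  have i4 : IntervalIntegrable (fun t => ∑ σ : ℤˣ, (D * ((c σ * m σ).re * (q t * ψ t ^ 2)) -
      D * (q t * (c σ * (g t * e σ t)).re))) volume x y := by
    refine (IntervalIntegrable.sum Finset.univ fun σ _ => i3 σ).congr fun t _ => ?_
    rw [Finset.sum_apply]
  have e1 : ∀ t, q t * (A * ψ t * R t - B * ψ t ^ 2 +
        ∑ σ : ℤˣ, D * (c σ * (m σ * ((ψ t ^ 2 : ℝ) : ℂ) - e σ t * g t)).re) =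
      A * (q t * (R t * ψ t)) - B * (q t * ψ t ^ 2) +
        ∑ σ : ℤˣ, (D * ((c σ * m σ).re * (q t * ψ t ^ 2)) -
          D * (q t * (c σ * (g t * e σ t)).re)) := fun t => by
    rw [mul_add, Finset.mul_sum]
    congr 1
    · ring
    · refine Finset.sum_congr rfl fun σ _ => ?_
      rw [hz, mul_comm (e σ t)]
      ring
  simp_rw [e1]
  rw [intervalIntegral.integral_add (i1.sub i2) i4,
    intervalIntegral.integral_sub i1 i2, intervalIntegral.integral_const_mul,
    intervalIntegral.integral_const_mul, intervalIntegral.integral_finsetSum fun σ _ => i3 σ]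
  congr 1
  refine Finset.sum_congr rfl fun σ _ => ?_
  rw [intervalIntegral.integral_sub ((i0.const_mul _).const_mul D)
    ((hi (hre σ)).const_mul D), intervalIntegral.integral_const_mul,
    intervalIntegral.integral_const_mul, intervalIntegral.integral_const_mul,
    intervalIntegral_mul_re hq (f := fun t => g t * e σ t) (hg.mul (he σ)), hz]
  ring

section Variation

variable {β : ℝ → ℝ} {μ : ℝ} {V : L2Icc a} (hL : -L ≤ L) (hβ : MemLp β 2 volume)

/-- The coupling is the complex conjugate of `∫ β ψ e`, the wave standing in the conjugate linear
slot. -/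
theorem coupling_eq (hβL : ∀ x, x ∉ Icc (-L) L → β x = 0)
    {P : Lp ℝ 2 (volume : Measure ℝ)} (hP : P =ᵐ[volume] groundState (pot V)) (σ : ℤˣ)
    {e : C(Icc (-L) L, ℂ)} (he : ∀ x : Icc (-L) L, resWave μ (pot V) σ x = e x) :
    coupling β μ (pot V) σ = pairRe hL hβ P e - pairIm hL hβ P e * Complex.I := by
  have h1 : coupling β μ (pot V) σ = (starRingEnd ℂ)
      (∫ x, ((β x * groundState (pot V) x : ℝ) : ℂ) * resWave μ (pot V) σ x) := by
    rw [coupling, ← integral_conj]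
    congr 1
    ext x
    rw [map_mul, Complex.conj_ofReal, mul_comm]
  rw [h1, integral_eq_pair hL hβ hβL hP he]
  simp [sub_eq_add_neg]

/-- The first variation of the pairings in the ground state. -/
theorem sum_pair_deriv_state (haL : a < L) (hL0 : 0 < L)
    (hβL : ∀ x, x ∉ Icc (-L) L → β x = 0) {φ : L2Icc a → ℝ}
    {Ψ : L2Icc a → Lp ℝ 2 (volume : Measure ℝ)} {w : L2Icc a → C(Icc (-L) L, ℝ)}
    (h : IsBranch L V φ Ψ w) {e : ℤˣ → C(Icc (-L) L, ℂ)}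
    (he : ∀ σ, ∀ x : Icc (-L) L, resWave μ (pot V) σ x = e σ x) (δ : L2Icc a) :
    ∑ σ : ℤˣ, (pairRe hL hβ (Ψ V) (e σ) * pairRe hL hβ (fderiv ℝ Ψ V δ) (e σ) +
        pairIm hL hβ (Ψ V) (e σ) * pairIm hL hβ (fderiv ℝ Ψ V δ) (e σ)) =
      -∫ t in (-L)..L, pot δ t * (resolventPc (pot V)
        (fun y => (∑ σ : ℤˣ, coupling β μ (pot V) σ * β y * resWave μ (pot V) σ y).re) t *
          groundState (pot V) t) := by
  set X := fun σ => pairRe hL hβ (Ψ V) (e σ) with hX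
  set Y := fun σ => pairIm hL hβ (Ψ V) (e σ) with hY
  set H : ℝ → ℝ := fun y =>
    (∑ σ : ℤˣ, coupling β μ (pot V) σ * β y * resWave μ (pot V) σ y).re with hH
  -- With `X`, `Y` the real and imaginary pairings, `Re (conj(X + iY) e) = X Re e + Y Im e`. The sum
  -- to be computed is thus the inner product of this single function `H` with the derivative of the
  -- ground state.
  have hHe : H = fun y => ∑ σ : ℤˣ, (X σ * (β y * IccExtend hL (reC L (e σ)) y) +
      Y σ * (β y * IccExtend hL (imC L (e σ)) y)) := by
    ext y
    rw [hH]
    simp only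
    rw [Complex.re_sum]
    refine Finset.sum_congr rfl fun σ _ => ?_
    by_cases hy : y ∈ Icc (-L) L
    · have h1 : IccExtend hL (reC L (e σ)) y = (resWave μ (pot V) σ y).re := by
        rw [IccExtend_of_mem _ _ hy, he σ ⟨y, hy⟩]; rfl
      have h2 : IccExtend hL (imC L (e σ)) y = (resWave μ (pot V) σ y).im := by
        rw [IccExtend_of_mem _ _ hy, he σ ⟨y, hy⟩]; rfl
      rw [h1, h2, coupling_eq hL hβ hβL h.state_eq σ (he σ)]
      simp [hX, hY]
      ring
    · simp [hβL y hy]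
  have hterm : ∀ σ, MemLp (fun y => X σ * (β y * IccExtend hL (reC L (e σ)) y) +
      Y σ * (β y * IccExtend hL (imC L (e σ)) y)) 2 volume := fun σ =>
    ((memLp_mul_extend hL hβ _).const_mul (X σ)).add ((memLp_mul_extend hL hβ _).const_mul (Y σ))
  have mH : MemLp H 2 volume := by
    rw [hHe]; exact memLp_finsetSum _ fun σ _ => hterm σ
  have hH0 : ∀ x, x ∉ Icc (-L) L → H x = 0 := fun x hx => by
    rw [hH]; simp [hβL x hx]
  rw [← h.inner_deriv haL hL0 hL mH hH0 δ, inner_toLp mH (EventuallyEq.refl _ _), hHe]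
  simp_rw [Finset.sum_mul]
  have hint : ∀ σ, Integrable (fun y => (X σ * (β y * IccExtend hL (reC L (e σ)) y) +
      Y σ * (β y * IccExtend hL (imC L (e σ)) y)) * fderiv ℝ Ψ V δ y) volume := fun σ =>
    (hterm σ).integrable_mul (Lp.memLp _)
  rw [integral_finsetSum _ fun σ _ => hint σ]
  refine Finset.sum_congr rfl fun σ _ => ?_
  have i1 : Integrable (fun x => β x * IccExtend hL (reC L (e σ)) x * fderiv ℝ Ψ V δ x) volume :=
    (memLp_mul_extend hL hβ _).integrable_mul (Lp.memLp _)
  have i2 : Integrable (fun x => β x * IccExtend hL (imC L (e σ)) x * fderiv ℝ Ψ V δ x) volume :=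
    (memLp_mul_extend hL hβ _).integrable_mul (Lp.memLp _)
  have p1 : pairRe hL hβ (fderiv ℝ Ψ V δ) (e σ) = _ :=
    inner_mulExtend hL hβ (EventuallyEq.refl _ _) _
  have p2 : pairIm hL hβ (fderiv ℝ Ψ V δ) (e σ) = _ :=
    inner_mulExtend hL hβ (EventuallyEq.refl _ _) _
  change X σ * _ + Y σ * _ = _
  rw [p1, p2, ← integral_const_mul, ← integral_const_mul,
    ← integral_add (i1.const_mul _) (i2.const_mul _)]
  congr 1
  ext x
  ring

/-- The first variation of the pairings in the distorted plane waves. -/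
theorem pair_deriv_wave (haL : a < L) (hL0 : 0 < L)
    (hβL : ∀ x, x ∉ Icc (-L) L → β x = 0) {P : Lp ℝ 2 (volume : Measure ℝ)}
    (hP : P =ᵐ[volume] groundState (pot V)) (cψ : Continuous (groundState (pot V)))
    (hk : resFreq μ (pot V) ≠ 0) {K : L2Icc a → ℝ} {K' : L2Icc a →L[ℝ] ℝ}
    (hKV : K V = resFreq μ (pot V)) (hK : HasFDerivAt K K' V) (σ : ℤˣ)
    {De : L2Icc a →L[ℝ] C(Icc (-L) L, ℂ)}
    (hDe : HasFDerivAt (fun U => waveSol hL σ (U, K U)) De V)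
    {e : C(Icc (-L) L, ℂ)} (he : ∀ x : Icc (-L) L, resWave μ (pot V) σ x = e x) (δ : L2Icc a) :
    pairRe hL hβ P e * pairRe hL hβ P (De δ) + pairIm hL hβ P e * pairIm hL hβ P (De δ) =
      (coupling β μ (pot V) σ *
        (K' δ * (∫ y, ((β y * groundState (pot V) y : ℝ) : ℂ) * auxA L μ (pot V) σ y) -
          ∫ t in (-L)..L, (pot δ t : ℂ) * (outResolvent (pot V) (resFreq μ (pot V))
            (fun y => ((β y * groundState (pot V) y : ℝ) : ℂ)) t * resWave μ (pot V) σ t))).re := by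
  have hh : LocallyIntegrable (fun y => ((β y * groundState (pot V) y : ℝ) : ℂ)) volume := by
    refine locallyIntegrable_ofReal (𝕜 := ℂ) ?_
    rw [← locallyIntegrableOn_univ]
    exact ((hβ.locallyIntegrable (by norm_num)).locallyIntegrableOn univ).mul_continuousOn
      cψ.continuousOn isClosed_univ.isLocallyClosed
  have h1 := integral_fderiv_waveSol haL hL0 hL σ μ hk hKV hK hDe hh
    (fun x hx => by simp [hβL x hx]) δ
  rw [intervalIntegral_eq_integral hL (fun x hx => by simp [hβL x hx]),
    integral_eq_pair hL hβ hβL hP (fun x => IccExtend_val hL (De δ) x),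
    intervalIntegral_eq_integral hL
      (f := fun t => ((β t * groundState (pot V) t : ℝ) : ℂ) * auxA L μ (pot V) σ t)
      (fun x hx => by simp [hβL x hx])] at h1
  rw [neg_add_eq_sub] at h1
  -- Uses `X X' + Y Y' = Re ((X - iY)(X' + iY'))`.
  rw [coupling_eq hL hβ hβL hP σ he, ← h1]
  simp

end Variation

end FermiGoldenRule
end

/-! ### Partial derivatives of the golden rule expression. -/

noncomputable section

namespace FermiGoldenRule

variable {a L : ℝ}

theorem inner_toLp_eq_intervalIntegral (haL : a < L) (hL : -L ≤ L) {G : ℝ → ℝ}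
    (hG : MemLp G 2 (volume.restrict (Icc (-a) a))) (δ : L2Icc a) :
    inner ℝ hG.toLp δ = ∫ t in (-L)..L, pot δ t * G t := by
  rw [intervalIntegral_eq_integral hL fun x hx => by
    rw [pot_eq_zero_of_notMem haL δ hx, zero_mul], L2.inner_def]
  have : ∀ t, pot δ t * G t = (Icc (-a) a).indicator (fun t => δ t * G t) t := fun t => by
    rw [pot, indicator_mul_left]
  simp_rw [this]
  rw [integral_indicator measurableSet_Icc]
  refine integral_congr_ae ?_
  filter_upwards [hG.coeFn_toLp] with x h1
  rw [h1, RCLike.inner_apply, conj_trivial]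

theorem _root_.Continuous.memLp_Icc {G : ℝ → ℝ} (hG : Continuous G) (c d : ℝ) :
    MemLp G 2 (volume.restrict (Icc c d)) := by
  obtain ⟨C, hC⟩ := isCompact_Icc.exists_bound_of_continuousOn (hG.continuousOn (s := Icc c d))
  refine MemLp.of_bound hG.aestronglyMeasurable C ?_
  filter_upwards [ae_restrict_mem measurableSet_Icc] with x hx using hC x hx

theorem extendZero_apply {e : C(Icc (-L) L, ℂ)} (x : Icc (-L) L) : extendZero e x = e x :=
  Subtype.val_injective.extend_apply _ _ _

section

variable {β : ℝ → ℝ} (hL : -L ≤ L) (hβ : MemLp β 2 volume)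

/-- The partial derivative of the golden rule in the bound state. -/
theorem hasFDerivAt_goldenRule_state (hβL : ∀ x, x ∉ Icc (-L) L → β x = 0) (k : ℝ)
    {f : ℤˣ → ℝ → ℂ} {e : ℤˣ → C(Icc (-L) L, ℂ)} (he : ∀ σ, ∀ x : Icc (-L) L, f σ x = e σ x)
    (P : Lp ℝ 2 (volume : Measure ℝ)) :
    ∃ D : Lp ℝ 2 (volume : Measure ℝ) →L[ℝ] ℝ,
      HasFDerivAt (fun ψ : Lp ℝ 2 (volume : Measure ℝ) => goldenRule β k ψ f) D P ∧
      ∀ δ, D δ = 1 / (16 * k) * ∑ σ : ℤˣ, 2 * (pairRe hL hβ P (e σ) * pairRe hL hβ δ (e σ) +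
          pairIm hL hβ P (e σ) * pairIm hL hβ δ (e σ)) := by
  choose D h1 h2 using fun σ => hasFDerivAt_pair_sq hL hβ (hasFDerivAt_id P)
    (hasFDerivAt_const (e σ) P)
  have hs := (HasFDerivAt.fun_sum (u := Finset.univ) fun σ _ => h1 σ).const_mul (1 / (16 * k))
  refine ⟨_, hs.congr_of_eventuallyEq (Eventually.of_forall fun ψ => ?_), fun δ => ?_⟩
  · exact goldenRule_eq hL hβ hβL k (EventuallyEq.refl _ _) he
  · simp only [smul_apply, sum_apply, smul_eq_mul, h2]
    congr 1
    refine Finset.sum_congr rfl fun σ _ => ?_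
    simp [(pair_zero_right hL hβ P).1, (pair_zero_right hL hβ P).2]

/-- The partial derivatives of the golden rule in the distorted plane waves. -/
theorem hasFDerivAt_goldenRule_wave (hβL : ∀ x, x ∉ Icc (-L) L → β x = 0) (k : ℝ)
    {f : ℤˣ → ℝ → ℂ} {e : ℤˣ → C(Icc (-L) L, ℂ)} (he : ∀ σ, ∀ x : Icc (-L) L, f σ x = e σ x)
    {P : Lp ℝ 2 (volume : Measure ℝ)} {ψ : ℝ → ℝ} (hP : P =ᵐ[volume] ψ) (σ : ℤˣ) :
    ∃ D : C(Icc (-L) L, ℂ) →L[ℝ] ℝ,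
      HasFDerivAt (fun w : C(Icc (-L) L, ℂ) =>
        goldenRule β k ψ (Function.update f σ (extendZero w))) D (e σ) ∧
      ∀ δ, D δ = 1 / (16 * k) * (2 * (pairRe hL hβ P (e σ) * pairRe hL hβ P δ +
          pairIm hL hβ P (e σ) * pairIm hL hβ P δ)) := by
  obtain ⟨D, h1, h2⟩ := hasFDerivAt_pair_sq hL hβ (hasFDerivAt_const P (e σ))
    (hasFDerivAt_id (e σ))
  -- Only the wave of sign `σ` varies; the other summand is a constant.
  have hs := (h1.add_const (∑ τ ∈ Finset.univ \ {σ},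
    (pairRe hL hβ P (e τ) ^ 2 + pairIm hL hβ P (e τ) ^ 2))).const_mul (1 / (16 * k))
  refine ⟨_, hs.congr_of_eventuallyEq (Eventually.of_forall fun w => ?_), fun δ => ?_⟩
  · have hu : ∀ τ, ∀ x : Icc (-L) L, Function.update f σ (extendZero w) τ x =
        Function.update e σ w τ x := by
      intro τ x
      rcases eq_or_ne τ σ with h | h
      · rw [h, Function.update_self, Function.update_self, extendZero_apply]
      · rw [Function.update_of_ne h, Function.update_of_ne h, he]
    simp only
    rw [goldenRule_eq hL hβ hβL k hP hu]
    congr 1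
    rw [← Finset.sum_sdiff (Finset.subset_univ {σ}), add_comm, Finset.sum_singleton,
      Function.update_self]
    congr 1
    refine Finset.sum_congr rfl fun τ hτ => ?_
    rw [Function.update_of_ne (by simpa using (Finset.mem_sdiff.1 hτ).2)]
  · simp only [smul_apply, smul_eq_mul, h2]
    simp [(pair_zero_left hL hβ (e σ)).1, (pair_zero_left hL hβ (e σ)).2]

end


end FermiGoldenRule

end

/-! ### The derivative of `Γ` and its explicit gradient. -/

noncomputable section

namespace FermiGoldenRule

variable {a L : ℝ}

theorem continuous_resWave (haL : a < L) (hL0 : 0 < L) {μ : ℝ} {V : L2Icc a}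
    (hk : resFreq μ (pot V) ≠ 0) (σ : ℤˣ) : Continuous (resWave μ (pot V) σ) := by
  obtain ⟨v, h, -⟩ := distorted_solOn haL hL0 V σ hk
  exact continuousOn_univ.1 h.cont

theorem locallyIntegrable_mul_continuous {β f : ℝ → ℝ} (hβ : LocallyIntegrable β volume)
    (hf : Continuous f) : LocallyIntegrable (fun x => β x * f x) volume := by
  rw [← locallyIntegrableOn_univ]
  exact (hβ.locallyIntegrableOn univ).mul_continuousOn hf.continuousOn isClosed_univ.isLocallyClosed

variable {β : ℝ → ℝ} {μ : ℝ} {V : L2Icc a}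

/-- Continuity puts the gradient in `L²([-a, a])` and allows it to be integrated term by term
against a potential. -/
theorem continuous_gradGam (haL : a < L) (hL0 : 0 < L) (hL : -L ≤ L) (hβ : MemLp β 2 volume)
    (hβL : ∀ x, x ∉ Icc (-L) L → β x = 0) (hk : resFreq μ (pot V) ≠ 0) {φ : L2Icc a → ℝ}
    {Ψ : L2Icc a → Lp ℝ 2 (volume : Measure ℝ)} {w : L2Icc a → C(Icc (-L) L, ℝ)}
    (h : IsBranch L V φ Ψ w) :
    Continuous (groundState (pot V)) ∧
    Continuous (resolventPc (pot V)
      (fun y => (∑ σ : ℤˣ, coupling β μ (pot V) σ * β y * resWave μ (pot V) σ y).re)) ∧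
    Continuous (outResolvent (pot V) (resFreq μ (pot V))
      (fun y => ((β y * groundState (pot V) y : ℝ) : ℂ))) ∧
    Continuous (gradGam β L μ (pot V)) := by
  obtain ⟨b1, b2, b3, b4⟩ := h.base haL hL
  have cψ : Continuous (groundState (pot V)) := continuousOn_univ.1 b4.sol.cont
  have lβ := hβ.locallyIntegrable (by norm_num)
  have ce := continuous_resWave haL hL0 hk (V := V) (μ := μ)
  have hH : (fun y => (∑ σ : ℤˣ, coupling β μ (pot V) σ * β y * resWave μ (pot V) σ y).re) =
      fun y => β y * (∑ σ : ℤˣ, coupling β μ (pot V) σ * resWave μ (pot V) σ y).re := by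
    ext y
    rw [← Complex.re_ofReal_mul, Finset.mul_sum]
    congr 1
    exact Finset.sum_congr rfl fun σ _ => by ring
  have cR : Continuous (resolventPc (pot V)
      (fun y => (∑ σ : ℤˣ, coupling β μ (pot V) σ * β y * resWave μ (pot V) σ y).re)) := by
    rw [hH]
    obtain ⟨v, hv, -⟩ := resolventPc_solOn haL hL0 hL b1 b2 b4 b3.normalized
      (locallyIntegrable_mul_continuous lβ (f := fun y =>
        (∑ σ : ℤˣ, coupling β μ (pot V) σ * resWave μ (pot V) σ y).re) (by fun_prop))
      fun x hx => by rw [hβL x hx, zero_mul]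
    exact continuousOn_univ.1 hv.cont
  have cg : Continuous (outResolvent (pot V) (resFreq μ (pot V))
      (fun y => ((β y * groundState (pot V) y : ℝ) : ℂ))) :=
    continuousOn_univ.1 (outResolvent_isOutgoing haL hL0 V hk
      (locallyIntegrable_ofReal (𝕜 := ℂ) (locallyIntegrable_mul_continuous lβ cψ))
      fun x hx => by simp [hβL x hx]).sol.cont
  refine ⟨cψ, cR, cg, ?_⟩
  unfold gradGam
  generalize resolventPc (pot V) _ = R at cR ⊢
  generalize outResolvent (pot V) _ _ = g at cg ⊢
  generalize groundState (pot V) = ψ at cψ ⊢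
  generalize resWave μ (pot V) = e at ce ⊢
  fun_prop

/-- The chain rule for the decay rate along a branch of ground states. -/
theorem IsBranch.hasFDerivAt_Gam (hL : -L ≤ L) (hβ : MemLp β 2 volume) (haL : a < L)
    (hβL : ∀ x, x ∉ Icc (-L) L → β x = 0) {φ : L2Icc a → ℝ}
    {Ψ : L2Icc a → Lp ℝ 2 (volume : Measure ℝ)} {w : L2Icc a → C(Icc (-L) L, ℝ)}
    (h : IsBranch L V φ Ψ w) {K : L2Icc a → ℝ} {K' : L2Icc a →L[ℝ] ℝ}
    (hKV : K V ≠ 0) (hK : HasFDerivAt K K' V) (hKe : ∀ᶠ U in 𝓝 V, resFreq μ (pot U) = K U)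
    {e : ℤˣ → L2Icc a → C(Icc (-L) L, ℂ)} {De : ℤˣ → L2Icc a →L[ℝ] C(Icc (-L) L, ℂ)}
    (he : ∀ σ, HasFDerivAt (e σ) (De σ) V)
    (hw : ∀ σ, ∀ᶠ U in 𝓝 V, ∀ x : Icc (-L) L, e σ U x = resWave μ (pot U) σ x) :
    ∃ D : L2Icc a →L[ℝ] ℝ, HasFDerivAt (fun U : L2Icc a => Gam β μ (pot U)) D V ∧
      ∀ δ, D δ = 1 / (16 * K V) * (∑ σ : ℤˣ,
            2 * (pairRe hL hβ (Ψ V) (e σ V) * pairRe hL hβ (fderiv ℝ Ψ V δ) (e σ V) +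
              pairIm hL hβ (Ψ V) (e σ V) * pairIm hL hβ (fderiv ℝ Ψ V δ) (e σ V))) +
          ∑ σ : ℤˣ, 1 / (16 * K V) *
            (2 * (pairRe hL hβ (Ψ V) (e σ V) * pairRe hL hβ (Ψ V) (De σ δ) +
              pairIm hL hβ (Ψ V) (e σ V) * pairIm hL hβ (Ψ V) (De σ δ))) -
          Gam β μ (pot V) / K V * K' δ := by
  choose D h1 h2 using fun σ => hasFDerivAt_pair_sq hL hβ h.diff_state.hasFDerivAt (he σ)
  -- Differentiating the prefactor multiplies it by `-K' / K`, which is the source of the term `-(Γ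
  -- / k) δk`.
  have hk : HasFDerivAt (fun U => 1 / (16 * K U)) (-(1 / (16 * K V ^ 2)) • K') V := by
    have hd : HasDerivAt (fun k : ℝ => 1 / (16 * k)) (-(1 / (16 * K V ^ 2))) (K V) := by
      have := ((hasDerivAt_inv hKV).const_mul (1 / 16))
      refine (this.congr_of_eventuallyEq (Eventually.of_forall fun k => ?_)).congr_deriv ?_
      · simp only; rw [one_div, one_div, mul_inv]
      · field_simp
    exact hd.comp_hasFDerivAt V hK
  have hG := hk.mul (HasFDerivAt.fun_sum (u := Finset.univ) fun σ _ => h1 σ)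
  have hev : ∀ᶠ U in 𝓝 V, Gam β μ (pot U) = 1 / (16 * K U) * ∑ σ : ℤˣ,
      (pairRe hL hβ (Ψ U) (e σ U) ^ 2 + pairIm hL hβ (Ψ U) (e σ U) ^ 2) := by
    filter_upwards [h.eventually, hKe, eventually_all.2 hw] with U ⟨hφ, hE, ψ, v, hd, hn, hΨ, _⟩ hKU
      hwU
    -- For each `U` the ground state is the branch up to a sign depending on `U`, possibly
    -- discontinuously; `Γ` does not see it.
    obtain ⟨-, s, hs, hgs⟩ := groundState_eq haL hL hφ hE hd hn
    have hP : (s • Ψ U : Lp ℝ 2 (volume : Measure ℝ)) =ᵐ[volume] groundState (pot U) := by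
      filter_upwards [Lp.coeFn_smul s (Ψ U), hΨ] with x h3 h4
      rw [h3, hgs, Pi.smul_apply, h4, smul_eq_mul]
    rw [Gam, goldenRule_eq hL hβ hβL _ hP fun σ x => (hwU σ x).symm, hKU]
    congr 1
    exact Finset.sum_congr rfl fun σ _ => pair_smul_sq hL hβ hs _ _
  refine ⟨_, hG.congr_of_eventuallyEq hev, fun δ => ?_⟩
  rw [hev.self_of_nhds]
  simp only [add_apply, smul_apply, sum_apply, smul_eq_mul, h2]
  rw [Finset.sum_add_distrib, ← Finset.mul_sum Finset.univ _ (1 / (16 * K V))]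
  field_simp
  ring

/-- The explicit gradient pairs with `δ` to the sum of the variations in the ground state, in the
distorted plane waves and in the frequency. -/
theorem IsBranch.inner_gradGam (hL : -L ≤ L) (hβ : MemLp β 2 volume) (haL : a < L) (hL0 : 0 < L)
    (hβL : ∀ x, x ∉ Icc (-L) L → β x = 0) {φ : L2Icc a → ℝ}
    {Ψ : L2Icc a → Lp ℝ 2 (volume : Measure ℝ)} {w : L2Icc a → C(Icc (-L) L, ℝ)}
    (h : IsBranch L V φ Ψ w) {K : L2Icc a → ℝ} {K' : L2Icc a →L[ℝ] ℝ}
    (hk : resFreq μ (pot V) ≠ 0) (hKV : K V = resFreq μ (pot V)) (hK : HasFDerivAt K K' V)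
    (hK' : ∀ δ, K' δ = 1 / (2 * resFreq μ (pot V)) *
      ∫ t in (-L)..L, pot δ t * groundState (pot V) t ^ 2)
    {De : ℤˣ → L2Icc a →L[ℝ] C(Icc (-L) L, ℂ)}
    (hDe : ∀ σ, HasFDerivAt (fun U => waveSol hL σ (U, K U)) (De σ) V)
    {e : ℤˣ → C(Icc (-L) L, ℂ)} (he : ∀ σ, ∀ x : Icc (-L) L, resWave μ (pot V) σ x = e σ x)
    (hG : MemLp (gradGam β L μ (pot V)) 2 (volume.restrict (Icc (-a) a))) (δ : L2Icc a) :
    inner ℝ hG.toLp δ = 1 / (16 * K V) * (∑ σ : ℤˣ,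
            2 * (pairRe hL hβ (Ψ V) (e σ) * pairRe hL hβ (fderiv ℝ Ψ V δ) (e σ) +
              pairIm hL hβ (Ψ V) (e σ) * pairIm hL hβ (fderiv ℝ Ψ V δ) (e σ))) +
          ∑ σ : ℤˣ, 1 / (16 * K V) *
            (2 * (pairRe hL hβ (Ψ V) (e σ) * pairRe hL hβ (Ψ V) (De σ δ) +
              pairIm hL hβ (Ψ V) (e σ) * pairIm hL hβ (Ψ V) (De σ δ))) -
          Gam β μ (pot V) / K V * K' δ := by
  obtain ⟨cψ, cR, cg, -⟩ := continuous_gradGam haL hL0 hL hβ hβL hk h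
  rw [inner_toLp_eq_intervalIntegral haL hL hG δ]
  have h1 := intervalIntegral_gradient (locallyIntegrable_pot δ) cR cψ cg
    (continuous_resWave haL hL0 hk) (-(1 / (8 * resFreq μ (pot V))))
    (Gam β μ (pot V) / (2 * resFreq μ (pot V) ^ 2)) (1 / (8 * resFreq μ (pot V)))
    (coupling β μ (pot V)) (fun σ => 1 / (2 * (resFreq μ (pot V) : ℂ)) *
      ∫ y, ((β y * groundState (pot V) y : ℝ) : ℂ) * auxA L μ (pot V) σ y) (-L) L
  refine h1.trans ?_
  have h2 := sum_pair_deriv_state hL hβ haL hL0 hβL h he δ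
  have h3 := fun σ => pair_deriv_wave hL hβ haL hL0 hβL h.state_eq cψ hk hKV hK σ (hDe σ) (he σ) δ
  have h5 := Finset.mul_sum Finset.univ (fun σ => pairRe hL hβ (Ψ V) (e σ) *
    pairRe hL hβ (fderiv ℝ Ψ V δ) (e σ) + pairIm hL hβ (Ψ V) (e σ) *
    pairIm hL hβ (fderiv ℝ Ψ V δ) (e σ)) 2
  rw [h2] at h5
  rw [← h5, hK', hKV, sub_add_eq_add_sub, sub_eq_sub_iff_add_eq_add]
  -- Substituting `K' δ = (1 / 2k) ∫ δ ψ²` turns the contribution of `A_±` into an integral of `δ`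
  -- against `ψ²`, as in the explicit gradient.
  have h6 : ∀ σ, 1 / (16 * resFreq μ (pot V)) *
      (2 * (pairRe hL hβ (Ψ V) (e σ) * pairRe hL hβ (Ψ V) (De σ δ) +
        pairIm hL hβ (Ψ V) (e σ) * pairIm hL hβ (Ψ V) (De σ δ))) = 1 / (8 * resFreq μ (pot V)) *
      (coupling β μ (pot V) σ * (1 / (2 * (resFreq μ (pot V) : ℂ)) *
        (∫ y, ((β y * groundState (pot V) y : ℝ) : ℂ) * auxA L μ (pot V) σ y) *
        ((∫ t in (-L)..L, pot δ t * groundState (pot V) t ^ 2 : ℝ) : ℂ) -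
        ∫ t in (-L)..L, (pot δ t : ℂ) * (outResolvent (pot V) (resFreq μ (pot V))
          (fun y => ((β y * groundState (pot V) y : ℝ) : ℂ)) t * resWave μ (pot V) σ t))).re := by
    intro σ
    rw [h3 σ, hK']
    push_cast
    rw [mul_right_comm (1 / (2 * (resFreq μ (pot V) : ℂ)))]
    ring
  rw [Finset.sum_congr rfl fun σ _ => h6 σ]
  generalize (Finset.sum (Finset.univ : Finset ℤˣ) _ : ℝ) = S
  field_simp
  ring

end FermiGoldenRule
end

/-! ### Assembly of the theorem. -/

open FermiGoldenRule in
theorem mainTheorem9 (a L μ : ℝ) (hL : a < L)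
    (β : ℝ → ℝ) (hβ : MemLp β 2 volume) (hβL : ∀ x, x ∉ Icc (-L) L → β x = 0)
    (V : FermiGoldenRule.L2Icc a)
    (hV : ∃! E : ℝ, FermiGoldenRule.IsNegEigenvalue (FermiGoldenRule.pot V) E)
    (hk : 0 < FermiGoldenRule.groundEnergy (FermiGoldenRule.pot V) + μ) :
    -- `φ_{V±}` solves its boundary value problem on `[-L, L]`
    (∀ σ : ℤˣ,
      FermiGoldenRule.IsSol (FermiGoldenRule.pot V)
          ((FermiGoldenRule.resFreq μ (FermiGoldenRule.pot V) : ℂ) ^ 2)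
          (fun y => (FermiGoldenRule.pot V y : ℂ) *
            FermiGoldenRule.planeWave σ (FermiGoldenRule.resFreq μ (FermiGoldenRule.pot V)) y)
          (FermiGoldenRule.resPhi μ (FermiGoldenRule.pot V) σ) ∧
        deriv (FermiGoldenRule.resPhi μ (FermiGoldenRule.pot V) σ) L =
          Complex.I * FermiGoldenRule.resFreq μ (FermiGoldenRule.pot V) *
            FermiGoldenRule.resPhi μ (FermiGoldenRule.pot V) σ L ∧
        - deriv (FermiGoldenRule.resPhi μ (FermiGoldenRule.pot V) σ) (-L) =
          Complex.I * FermiGoldenRule.resFreq μ (FermiGoldenRule.pot V) *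
            FermiGoldenRule.resPhi μ (FermiGoldenRule.pot V) σ (-L)) ∧
    -- the explicit expression is the Fréchet derivative of `Γ` at `V`
    ∃ hG : MemLp (FermiGoldenRule.gradGam β L μ (FermiGoldenRule.pot V)) 2
        (volume.restrict (Icc (-a) a)),
      HasGradientAt
        (fun U : FermiGoldenRule.L2Icc a => FermiGoldenRule.Gam β μ (FermiGoldenRule.pot U))
        hG.toLp V ∧
      -- the chain rule formula
      ∃ (gk : FermiGoldenRule.L2Icc a)
        (Ψ : FermiGoldenRule.L2Icc a → Lp ℝ 2 (volume : Measure ℝ))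
        (DΨ : FermiGoldenRule.L2Icc a →L[ℝ] Lp ℝ 2 (volume : Measure ℝ))
        (e : ℤˣ → FermiGoldenRule.L2Icc a → C(Icc (-L) L, ℂ))
        (De : ℤˣ → FermiGoldenRule.L2Icc a →L[ℝ] C(Icc (-L) L, ℂ))
        (DΓψ : Lp ℝ 2 (volume : Measure ℝ) →L[ℝ] ℝ)
        (DΓe : ℤˣ → C(Icc (-L) L, ℂ) →L[ℝ] ℝ),
        -- `δk_V/δV`
        HasGradientAt
          (fun U : FermiGoldenRule.L2Icc a =>
            FermiGoldenRule.resFreq μ (FermiGoldenRule.pot U)) gk V ∧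
        -- `δψ_V/δV`, for the branch of normalized eigenfunctions through `ψ_V`
        Ψ V =ᵐ[volume] FermiGoldenRule.groundState (FermiGoldenRule.pot V) ∧
        (∀ᶠ U in 𝓝 V, ∃ ψ : ℝ → ℝ,
          FermiGoldenRule.IsBoundState (FermiGoldenRule.pot U)
            (FermiGoldenRule.groundEnergy (FermiGoldenRule.pot U)) ψ ∧ Ψ U =ᵐ[volume] ψ) ∧
        HasFDerivAt Ψ DΨ V ∧
        -- `δe_{V±}(·, k_V)/δV`, on `[-L, L]`
        (∀ σ : ℤˣ, (∀ᶠ U in 𝓝 V, ∀ x : Icc (-L) L,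
            e σ U x = FermiGoldenRule.resWave μ (FermiGoldenRule.pot U) σ x) ∧
          HasFDerivAt (e σ) (De σ) V) ∧
        -- `δΓ/δψ_V`
        HasFDerivAt
          (fun ψ : Lp ℝ 2 (volume : Measure ℝ) =>
            FermiGoldenRule.goldenRule β (FermiGoldenRule.resFreq μ (FermiGoldenRule.pot V)) ψ
              (FermiGoldenRule.resWave μ (FermiGoldenRule.pot V))) DΓψ (Ψ V) ∧
        -- `δΓ/δe_{V±}`
        (∀ σ : ℤˣ, HasFDerivAt
          (fun w : C(Icc (-L) L, ℂ) =>
            FermiGoldenRule.goldenRule β (FermiGoldenRule.resFreq μ (FermiGoldenRule.pot V))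
              (FermiGoldenRule.groundState (FermiGoldenRule.pot V))
              (Function.update (FermiGoldenRule.resWave μ (FermiGoldenRule.pot V)) σ
                (FermiGoldenRule.extendZero w))) (DΓe σ) (e σ V)) ∧
        ∀ δV : FermiGoldenRule.L2Icc a,
          inner ℝ (hG.toLp) δV =
            DΓψ (DΨ δV) + ∑ σ : ℤˣ, DΓe σ (De σ δV)
              - FermiGoldenRule.Gam β μ (FermiGoldenRule.pot V) /
                  FermiGoldenRule.resFreq μ (FermiGoldenRule.pot V) * inner ℝ gk δV := by
  obtain ⟨E, hE, -⟩ := id hV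
  have hL0 : 0 < L := hE.pos hL
  have hLL : -L ≤ L := by linarith
  obtain ⟨φ, Ψ, w, h⟩ := exists_branch hL hL0 hLL hV
  obtain ⟨K, K', hKV, hKe, hK, hK'⟩ := h.exists_freq hL hLL hk
  have hk0 : resFreq μ (pot V) ≠ 0 := (Real.sqrt_pos.2 hk).ne'
  have hKV0 : K V ≠ 0 := by rwa [hKV]
  refine ⟨resPhi_isSol hL hL0 hk0, ?_⟩
  -- The waves are taken along the differentiable frequency `K`, which agrees with `k_U` near `V`,
  -- so that `e` is differentiable and coincides there with the restricted `resWave`.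
  set e : ℤˣ → L2Icc a → C(Icc (-L) L, ℂ) := fun σ U => waveSol hLL σ (U, K U) with he_def
  have hDe : ∀ σ, HasFDerivAt (e σ) (fderiv ℝ (e σ) V) V := fun σ =>
    (DifferentiableAt.comp (g := waveSol hLL σ) V
      (differentiableAt_waveSol hLL σ (q := (V, K V)) hKV0) (differentiableAt_id.prodMk hK.differentiableAt)).hasFDerivAt
  have hw : ∀ σ, ∀ᶠ U in 𝓝 V, ∀ x : Icc (-L) L, e σ U x = resWave μ (pot U) σ x := by
    intro σ
    filter_upwards [hKe, hK.continuousAt.eventually_ne hKV0] with U h1 h2 x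
    rw [resWave, h1, distorted_eq_waveSol hL hL0 hLL U σ h2 x]
  have he : ∀ σ, ∀ x : Icc (-L) L, resWave μ (pot V) σ x = e σ V x := fun σ x =>
    ((hw σ).self_of_nhds x).symm
  have hG := (continuous_gradGam hL hL0 hLL hβ hβL hk0 h).2.2.2.memLp_Icc (-a) a
  obtain ⟨D, hD, hDδ⟩ := h.hasFDerivAt_Gam (μ := μ) hLL hβ hL hβL hKV0 hK hKe hDe hw
  have hin := h.inner_gradGam hLL hβ hL hL0 hβL hk0 hKV hK hK' hDe he hG
  obtain ⟨DΓψ, hψ, hψδ⟩ := hasFDerivAt_goldenRule_state hLL hβ hβL (resFreq μ (pot V)) he (Ψ V)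
  choose DΓe hΓe hΓeδ using fun σ =>
    hasFDerivAt_goldenRule_wave hLL hβ hβL (resFreq μ (pot V)) he h.state_eq σ
  refine ⟨hG, ?_, (InnerProductSpace.toDual ℝ (L2Icc a)).symm K', Ψ, fderiv ℝ Ψ V, e,
    fun σ => fderiv ℝ (e σ) V, DΓψ, DΓe, ?_, h.state_eq, ?_, h.diff_state.hasFDerivAt,
    fun σ => ⟨hw σ, hDe σ⟩, hψ, hΓe, fun δ => ?_⟩
  -- The functional paired from the explicit gradient and the derivative from the product rule are
  -- given by the same expression in the variations.
  · have : InnerProductSpace.toDual ℝ (L2Icc a) hG.toLp = D := by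
      ext δ
      rw [InnerProductSpace.toDual_apply_apply, hin, hDδ]
    rw [hasGradientAt_iff_hasFDerivAt, this]
    exact hD
  · rw [hasGradientAt_iff_hasFDerivAt, LinearIsometryEquiv.apply_symm_apply]
    exact hK.congr_of_eventuallyEq hKe
  · filter_upwards [h.eventually] with U ⟨hφ, hEU, ψ, v, hd, hn, hΨ, _⟩
    exact ⟨ψ, by rw [hEU]; exact hd.isBoundState hL hφ hn, hΨ⟩
  · rw [InnerProductSpace.toDual_symm_apply, hin, hψδ, hKV]
    simp only [hΓeδ]
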